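/- Let $R$ be a reduced crystallographic root system (possibly empty) with simple roots $\Delta$ and finite Weyl group $W$, realised in a finite-dimensional real vector space $V_0\supseteq\mathbb{R}\Delta$ with coroots $\alpha^\vee\in V_0^*$, and let $V=\mathbb{C}\otimes_{\mathbb{R}}V_0$. Let $k:\Delta\to\mathbb{R}$ be constant on simple roots in the same $W$-orbit. Let $\mathbb{H}$ be the graded affine Hecke algebra: the unital associative $\mathbb{C}$-algebra generated by $\mathbb{C}[W]=\bigoplus_w\mathbb{C}t_w$ and $S(V)$ with the relations $t_{s_\alpha}v-s_\alpha(v)t_{s_\alpha}=k_\alpha\langle v,\alpha^\vee\rangle$ ($\alpha\in\Delta$, $v\in V$). Let $w_0$ be the longest element of $W$ and $\theta$ the involution of $\mathbb{H}$ with $\theta(v)=-w_0(v)$ and $\theta(t_w)=t_{w_0ww_0^{-1}}$; let $\langle\theta\rangle$ be the group of order two acting on $\mathbb{H}$ through $\theta$. For finite-dimensional $\mathbb{H}\rtimes\langle\theta\rangle$-modules $X_1,X_2$ put $$\mathrm{EP}^\theta_{\mathbb{H}}(X_1,X_2)=\sum_i(-1)^i\,\mathrm{trace}\bigl(\theta^*:\mathrm{Ext}^i_{\mathbb{H}}(X_1,X_2)\to\mathrm{Ext}^i_{\mathbb{H}}(X_1,X_2)\bigr),$$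 where $\mathrm{Ext}$ is taken in the category of $\mathbb{H}$-modules and $\theta^*$ is induced by $\theta$ (it is $\psi\mapsto\theta\circ\psi\circ\theta$ for $i=0$). All these $\mathrm{Ext}^i_{\mathbb{H}}(X_1,X_2)$ are finite-dimensional, and they vanish for $i>\dim V$. Fix a $W$-invariant inner product on $V_0$. Let $\widetilde W\subset\mathrm{Pin}(V_0)$ be the spin cover of $W$, the preimage of $W\subset O(V_0)$ in the Pin group of the Clifford algebra with relations $v^2=-\langle v,v\rangle$. Let $S$ be the simple module of the complexified Clifford algebra if $\dim V$ is even, and the sum $S^+\oplus S^-$ of its two simple modules if $\dim V$ is odd, regarded as a representation of $\widetilde W$. Let $n=1$ if $\dim V$ is even and $n=2$ if $\dim V$ is odd. For a finite-dimensional $\mathbb{H}\rtimes\langle\theta\rangle$-module $X$ let $X^\pm$ be the $\pm1$-eigenspaces of $\theta t_{w_0}$ on $X$, which are representations of $W$, and let $I^\theta(X)=(X^+-X^-)\otimes S$ be the $\theta$-twisted Dirac index, a virtual representation of $\widetilde W$. 1. For all finite-dimensional $\mathbb{H}\rtimes\langle\theta\rangle$-modules $X_1,X_2$, $$n\cdot\mathrm{EP}^\theta_{\mathbb{H}}(X_1,X_2)=\langle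 I^\theta(X_1),I^\theta(X_2)\rangle_{\widetilde W},$$ where $\langle A,B\rangle_{\widetilde W}=|\widetilde W|^{-1}\sum_{g\in\widetilde W}\chi_A(g)\overline{\chi_B(g)}$ is the standard inner product of (virtual) representations of the finite group $\widetilde W$. 2. $\mathrm{EP}^\theta_{\mathbb{H}}$ extends to a Hermitian form on the complexified Grothendieck group $K_{\mathbb{C}}$ of finite-dimensional $\mathbb{H}\rtimes\langle\theta\rangle$-modules, and this form is positive semidefinite. 3. Let $K^1\subset K_{\mathbb{C}}$ be the span of the classes $[X]$ of the irreducible $\mathbb{H}\rtimes\langle\theta\rangle$-modules $X$ that are reducible over $\mathbb{H}$, and $K^2$ the span of the classes $[X]+[\overline X]$ with $X$ irreducible over $\mathbb{H}$, where $\overline X$ is $X$ with the action of $\theta$ replaced by its negative. The form descends to $K^\theta_{\mathbb{H}}=K_{\mathbb{C}}/(K^1+K^2)$ and then to $\mathrm{Ell}^\theta_{\mathbb{H}}=K^\theta_{\mathbb{H}}/\mathrm{rad}(\mathrm{EP}^\theta_{\mathbb{H}})$, on which it is a (positive definite Hermitian) inner product. -/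

import Mathlib

open scoped TensorProduct
universe u
namespace GradedHecke
section RootData

variable {ι V₀ N : Type u} [AddCommGroup V₀] [Module ℝ V₀] [AddCommGroup N] [Module ℝ N]
  {P : RootPairing ι ℝ V₀ N}

/-- The number of inversions of `w`, that is the Coxeter length of `w`: the number of positive
roots that `w` makes negative. -/
noncomputable def inversionNumber (b : P.Base) (w : P.weylGroup) : ℕ :=
  Nat.card {i : ι // b.IsPos i ∧ ¬ b.IsPos (w • i)}

theorem exists_longest [Finite ι] (b : P.Base) :
    ∃ w : P.weylGroup, ∀ w', inversionNumber b w' ≤ inversionNumber b w := by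
  have hb : BddAbove (Set.range (inversionNumber b)) := by
    refine ⟨Nat.card ι, ?_⟩
    rintro _ ⟨w, rfl⟩
    exact Finite.card_subtype_le _
  obtain ⟨w, hw⟩ := Nat.sSup_mem (Set.range_nonempty (inversionNumber b)) hb
  exact ⟨w, fun w' => hw ▸ le_csSup hb ⟨w', rfl⟩⟩

/-- The longest element `w₀` of the Weyl group. -/
noncomputable def longest [Finite ι] (b : P.Base) : P.weylGroup := (exists_longest b).choose

theorem root_smul (w : P.weylGroup) (i : ι) : P.root (w • i) = w • P.root i :=
  RootPairing.Equiv.root_indexEquiv_eq_smul (P := P) i w.1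

theorem coroot'_smul (w : P.weylGroup) (i : ι) (v : V₀) :
    P.coroot' (w • i) (w • v) = P.coroot' i v := by
  have h1 : w.1.coweightMap (P.coroot (w • i)) = P.coroot i := by
    have := congrFun w.1.coroot_coweightMap (w • i)
    refine this.trans ?_
    change P.coroot (w.1.indexEquiv.symm (w.1.indexEquiv i)) = _
    simp
  have h2 := LinearMap.congr_fun
    (LinearMap.congr_fun w.1.weight_coweight_transpose (P.coroot (w • i))) v
  simp only [LinearMap.comp_apply, h1] at h2
  exact h2

theorem root_neg (i : ι) : P.root (P.reflectionPerm i i) = -P.root i := by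
  simp [RootPairing.root_reflectionPerm]

theorem coroot'_neg (i : ι) : P.coroot' (P.reflectionPerm i i) = -P.coroot' i := by
  ext v
  simp [RootPairing.coroot', RootPairing.coroot_reflectionPerm]

theorem ofIdx_neg (i : ι) :
    RootPairing.weylGroup.ofIdx P (P.reflectionPerm i i) = RootPairing.weylGroup.ofIdx P i := by
  apply Subtype.ext
  apply RootPairing.Equiv.weightHom_injective P
  ext v
  change P.reflection _ v = P.reflection _ v
  simp only [RootPairing.reflection_apply, root_neg, coroot'_neg, LinearMap.neg_apply, neg_smul, smul_neg, neg_neg]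

theorem conj_ofIdx (w : P.weylGroup) (i : ι) :
    w * RootPairing.weylGroup.ofIdx P i * w⁻¹ = RootPairing.weylGroup.ofIdx P (w • i) := by
  apply Subtype.ext
  apply RootPairing.Equiv.weightHom_injective P
  ext v
  change w • RootPairing.weylGroup.ofIdx P i • w⁻¹ • v = RootPairing.weylGroup.ofIdx P (w • i) • v
  obtain ⟨v, rfl⟩ : ∃ x, v = w • x := ⟨w⁻¹ • v, by simp⟩
  rw [inv_smul_smul]
  change w • P.reflection i v = P.reflection (w • i) (w • v)
  simp only [RootPairing.reflection_apply, coroot'_smul, root_smul]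
  rw [smul_sub]
  congr 1
  exact smul_comm w.1 _ _


theorem height_neg_of_not_isPos (b : P.Base) {i : ι} (h : ¬ b.IsPos i) : b.height i < 0 := by
  have := b.height_ne_zero i
  rw [RootPairing.Base.isPos_iff] at h
  lia

variable [Finite ι] [P.IsCrystallographic] [P.IsReduced]

theorem longest_smul_simple (b : P.Base) {i : ι} (hi : i ∈ b.support) :
    ¬ b.IsPos (longest b • i) := by
  intro hpos
  let neg := P.indexNeg
  set w := longest b
  set s := RootPairing.weylGroup.ofIdx P i
  have hs (j : ι) : s • j = P.reflectionPerm i j := rfl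
  have hss (j : ι) : s • s • j = j := by simp [hs]
  have hii : ¬ b.IsPos (s • i) := by
    have := (RootPairing.Base.IsPos.neg_iff_not (b := b) i).not
    simp only [not_not] at this
    exact this.mpr (b.isPos_of_mem_support hi)
  have hlt : inversionNumber b w < inversionNumber b (w * s) := by
    have : Nat.card (Option {j : ι // b.IsPos j ∧ ¬ b.IsPos (w • j)}) ≤
        Nat.card {j : ι // b.IsPos j ∧ ¬ b.IsPos ((w * s) • j)} := by
      have hne (j : {j : ι // b.IsPos j ∧ ¬ b.IsPos (w • j)}) : j.1 ≠ i := by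
        rintro h
        exact j.2.2 (h ▸ hpos)
      let f : Option {j : ι // b.IsPos j ∧ ¬ b.IsPos (w • j)} →
          {j : ι // b.IsPos j ∧ ¬ b.IsPos ((w * s) • j)} := fun o => match o with
        | none => ⟨i, b.isPos_of_mem_support hi, by
            have h1 : w • s • i = - (w • i) := by
              apply P.root.injective
              rw [root_smul, hs, root_neg, smul_neg, ← root_smul]
              simp
            rw [mul_smul, h1, RootPairing.Base.IsPos.neg_iff_not]
            simpa using hpos⟩
        | some j => ⟨s • j.1, j.2.1.reflectionPerm hi (hne j), by
            rw [mul_smul, hss]; exact j.2.2⟩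
      apply Nat.card_le_card_of_injective f
      rintro (_ | j) (_ | j') h
      · rfl
      · have h' : i = s • j'.1 := congrArg Subtype.val h
        have : j'.1 = s • i := by rw [h', hss]
        exact absurd (this ▸ j'.2.1) hii
      · have h' : s • j.1 = i := congrArg Subtype.val h
        have : j.1 = s • i := by rw [← h', hss]
        exact absurd (this ▸ j.2.1) hii
      · have h' : s • j.1 = s • j'.1 := congrArg Subtype.val h
        rw [smul_left_cancel_iff] at h'
        rw [Subtype.ext h']
    rw [Finite.card_option] at this
    exact this
  exact absurd ((exists_longest b).choose_spec (w * s)) (not_le.mpr hlt)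

theorem longest_smul_pos (b : P.Base) {i : ι} (hi : b.IsPos i) :
    ¬ b.IsPos (longest b • i) := by
  refine RootPairing.Base.IsPos.induction_on_add hi
    (p := fun i => ¬ b.IsPos (longest b • i)) (fun i hi => longest_smul_simple b hi) ?_
  · intro i j k hk hi hj
    have h : P.root (longest b • k) = P.root (longest b • i) + P.root (longest b • j) := by
      simp only [root_smul, hk, smul_add]
    rw [RootPairing.Base.isPos_iff, b.height_add h]
    have h1 := height_neg_of_not_isPos b hi
    have h2 := height_neg_of_not_isPos b (longest_smul_simple b hj)
    lia

/-- `-w₀` permutes the simple roots. -/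
theorem neg_longest_smul_mem (b : P.Base) {i : ι} (hi : i ∈ b.support) :
    P.reflectionPerm (longest b • i) (longest b • i) ∈ b.support := by
  let neg := P.indexNeg
  set w := longest b with hw
  by_contra hm
  change -(w • i) ∉ b.support at hm
  have hpos : b.IsPos (-(w • i)) :=
    (RootPairing.Base.IsPos.neg_iff_not (b := b) _).mpr (longest_smul_simple b hi)
  obtain ⟨j, hj, hj'⟩ := hpos.exists_mem_support_pos_pairingIn
  rw [P.zero_lt_pairingIn_iff'] at hj'
  have hij : -(w • i) ≠ j := by rintro h; exact hm (h ▸ hj)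
  obtain ⟨k, hk⟩ := P.root_sub_root_mem_of_pairingIn_pos hj' hij
  have hkpos : b.IsPos k := by
    have := b.height_sub hk
    rw [RootPairing.Base.height_one_of_mem_support hj] at this
    rw [RootPairing.Base.isPos_iff']
    rw [RootPairing.Base.isPos_iff] at hpos
    lia
  have key (l : ι) (hl : b.IsPos l) : b.height (w⁻¹ • l) < 0 := by
    apply height_neg_of_not_isPos
    intro h
    have := longest_smul_pos b h
    rw [← hw, smul_inv_smul] at this
    exact this hl
  have hsum : P.root (-(w • i)) = P.root k + P.root j := by rw [hk]; abel
  have hsum' : P.root (-i) = P.root (w⁻¹ • k) + P.root (w⁻¹ • j) := by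
    simp only [root_smul, ← smul_add, ← hsum]
    change P.root (P.reflectionPerm i i) =
      w⁻¹ • P.root (P.reflectionPerm (w • i) (w • i))
    rw [root_neg, root_neg, smul_neg, root_smul, inv_smul_smul]
  have h1 := b.height_add hsum'
  rw [RootPairing.Base.height_reflectionPerm_self,
    RootPairing.Base.height_one_of_mem_support hi] at h1
  have h2 := key k hkpos
  have h3 := key j (b.isPos_of_mem_support hj)
  lia
end RootData

section HeckeAlgebra

/-- The complexification `V = ℂ ⊗ V₀`. -/
abbrev Cplx (V₀ : Type u) [AddCommGroup V₀] [Module ℝ V₀] : Type u := ℂ ⊗[ℝ] V₀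

variable {ι V₀ N : Type u} [AddCommGroup V₀] [Module ℝ V₀] [AddCommGroup N] [Module ℝ N]
  {P : RootPairing ι ℝ V₀ N} {b : P.Base}

/-- The action of the Weyl group on `V`. -/
noncomputable def weylAct (w : P.weylGroup) : Cplx V₀ →ₗ[ℂ] Cplx V₀ :=
  (P.weylGroupRootRep w).baseChange ℂ

/-- The linear form `v ↦ ⟨v, αᵢ^∨⟩` on `V`. -/
noncomputable def corootForm (P : RootPairing ι ℝ V₀ N) (i : ι) : Cplx V₀ →ₗ[ℂ] ℂ :=
  Module.Dual.baseChange ℂ (P.coroot' i)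

/-- A parameter function on the simple roots, constant on simple roots in the same Weyl group
orbit. -/
structure Parameter (b : P.Base) where
  val : b.support → ℝ
  invariant : ∀ i j : b.support, (∃ w : P.weylGroup, w • P.root i = P.root j) → val i = val j

/-- The symbol `t_w`. -/
noncomputable def genT (w : P.weylGroup) : FreeAlgebra ℂ (P.weylGroup ⊕ Cplx V₀) :=
  FreeAlgebra.ι ℂ (Sum.inl w)

/-- The symbol `f_v`. -/
noncomputable def genF (P : RootPairing ι ℝ V₀ N) (v : Cplx V₀) :
    FreeAlgebra ℂ (P.weylGroup ⊕ Cplx V₀) :=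
  FreeAlgebra.ι ℂ (Sum.inr v)

/-- The defining relations of the graded affine Hecke algebra: those of `ℂ[W]`, those of `S(V)`
and `t_{s_α} v - s_α(v) t_{s_α} = k_α ⟨v, α^∨⟩` for simple `α`. -/
inductive HeckeRel (k : Parameter b) : FreeAlgebra ℂ (P.weylGroup ⊕ Cplx V₀) →
    FreeAlgebra ℂ (P.weylGroup ⊕ Cplx V₀) → Prop
  | one : HeckeRel k (genT 1) 1
  | mul (w w' : P.weylGroup) : HeckeRel k (genT (w * w')) (genT w * genT w')
  | add (v v' : Cplx V₀) : HeckeRel k (genF P (v + v')) (genF P v + genF P v')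
  | smul (c : ℂ) (v : Cplx V₀) : HeckeRel k (genF P (c • v)) (c • genF P v)
  | comm (v v' : Cplx V₀) : HeckeRel k (genF P v * genF P v') (genF P v' * genF P v)
  | cross (i : b.support) (v : Cplx V₀) : HeckeRel k
      (genT (RootPairing.weylGroup.ofIdx P i) * genF P v -
        genF P (weylAct (RootPairing.weylGroup.ofIdx P i) v) *
          genT (RootPairing.weylGroup.ofIdx P i))
      (algebraMap ℂ _ ((k.val i : ℂ) * corootForm P i v))

/-- The graded affine Hecke algebra. -/
def Hecke (k : Parameter b) : Type u := RingQuot (HeckeRel k)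

noncomputable instance (k : Parameter b) : Ring (Hecke k) :=
  inferInstanceAs (Ring (RingQuot (HeckeRel k)))

noncomputable instance (k : Parameter b) : Algebra ℂ (Hecke k) :=
  inferInstanceAs (Algebra ℂ (RingQuot (HeckeRel k)))

/-- The quotient map from the free algebra. -/
noncomputable def Hecke.mk (k : Parameter b) :
    FreeAlgebra ℂ (P.weylGroup ⊕ Cplx V₀) →ₐ[ℂ] Hecke k :=
  RingQuot.mkAlgHom ℂ (HeckeRel k)

/-- The element `t_w` of the graded affine Hecke algebra. -/
noncomputable def Hecke.t (k : Parameter b) (w : P.weylGroup) : Hecke k := Hecke.mk k (genT w)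

/-- The element `v` of the graded affine Hecke algebra. -/
noncomputable def Hecke.f (k : Parameter b) (v : Cplx V₀) : Hecke k := Hecke.mk k (genF P v)

theorem Hecke.mk_rel (k : Parameter b) {x y : FreeAlgebra ℂ (P.weylGroup ⊕ Cplx V₀)}
    (h : HeckeRel k x y) : Hecke.mk k x = Hecke.mk k y :=
  RingQuot.mkAlgHom_rel ℂ h

theorem Hecke.t_one (k : Parameter b) : Hecke.t k 1 = 1 :=
  (Hecke.mk_rel k HeckeRel.one).trans (map_one _)

theorem Hecke.t_mul (k : Parameter b) (w w' : P.weylGroup) :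
    Hecke.t k (w * w') = Hecke.t k w * Hecke.t k w' :=
  (Hecke.mk_rel k (HeckeRel.mul w w')).trans (map_mul _ _ _)

theorem Hecke.f_add (k : Parameter b) (v v' : Cplx V₀) :
    Hecke.f k (v + v') = Hecke.f k v + Hecke.f k v' :=
  (Hecke.mk_rel k (HeckeRel.add v v')).trans (map_add _ _ _)

theorem Hecke.f_smul (k : Parameter b) (c : ℂ) (v : Cplx V₀) :
    Hecke.f k (c • v) = c • Hecke.f k v :=
  (Hecke.mk_rel k (HeckeRel.smul c v)).trans (map_smul _ _ _)

theorem Hecke.f_comm (k : Parameter b) (v v' : Cplx V₀) :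
    Hecke.f k v * Hecke.f k v' = Hecke.f k v' * Hecke.f k v := by
  have := Hecke.mk_rel k (HeckeRel.comm v v')
  rwa [map_mul, map_mul] at this

theorem Hecke.cross (k : Parameter b) (i : b.support) (v : Cplx V₀) :
    Hecke.t k (RootPairing.weylGroup.ofIdx P i) * Hecke.f k v -
      Hecke.f k (weylAct (RootPairing.weylGroup.ofIdx P i) v) *
        Hecke.t k (RootPairing.weylGroup.ofIdx P i) =
      algebraMap ℂ _ ((k.val i : ℂ) * corootForm P i v) := by
  have := Hecke.mk_rel k (HeckeRel.cross i v)
  rwa [map_sub, map_mul, map_mul, AlgHom.commutes] at this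

theorem weylAct_mul (w w' : P.weylGroup) (v : Cplx V₀) :
    weylAct (w * w') v = weylAct w (weylAct w' v) := by
  simp only [weylAct, map_mul, Module.End.mul_eq_comp, LinearMap.baseChange_comp,
    LinearMap.comp_apply]

theorem corootForm_smul (w : P.weylGroup) (i : ι) (v : Cplx V₀) :
    corootForm P (w • i) (weylAct w v) = corootForm P i v := by
  induction v using TensorProduct.induction_on with
  | zero => simp
  | add x y hx hy => simp only [map_add, hx, hy]
  | tmul c v =>
    have := coroot'_smul w i v
    simp only [corootForm, weylAct, LinearMap.baseChange_tmul, Module.Dual.baseChange_apply_tmul]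
    rw [← this]
    rfl

theorem corootForm_neg (i : ι) :
    corootForm P (P.reflectionPerm i i) = -corootForm P i := by
  ext v
  simp [corootForm, coroot'_neg]

variable [Finite ι] [P.IsCrystallographic] [P.IsReduced]

/-- The values of `θ` on the generators: `θ(t_w) = t_{w₀ w w₀⁻¹}` and `θ(v) = -w₀(v)`. -/
noncomputable def thetaGen (k : Parameter b) : P.weylGroup ⊕ Cplx V₀ → Hecke k
  | Sum.inl w => Hecke.t k (longest b * w * (longest b)⁻¹)
  | Sum.inr v => Hecke.f k (-weylAct (longest b) v)

theorem thetaGen_rel (k : Parameter b) ⦃x y : FreeAlgebra ℂ (P.weylGroup ⊕ Cplx V₀)⦄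
    (h : HeckeRel k x y) :
    FreeAlgebra.lift ℂ (thetaGen k) x = FreeAlgebra.lift ℂ (thetaGen k) y := by
  induction h with
  | one => simp [genT, thetaGen, Hecke.t_one]
  | mul w w' =>
    simp only [genT, thetaGen, map_mul, FreeAlgebra.lift_ι_apply, ← Hecke.t_mul]
    congr 1
    group
  | add v v' =>
    simp only [genF, thetaGen, map_add, FreeAlgebra.lift_ι_apply, ← Hecke.f_add]
    congr 1
    abel
  | smul c v =>
    simp only [genF, thetaGen, map_smul, FreeAlgebra.lift_ι_apply, ← Hecke.f_smul, smul_neg]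
  | comm v v' =>
    simp only [genF, thetaGen, map_mul, FreeAlgebra.lift_ι_apply]
    exact Hecke.f_comm k _ _
  | cross i v =>
    set w := longest b with hw
    have hmem := neg_longest_smul_mem b i.2
    rw [← hw] at hmem
    set j : b.support := ⟨P.reflectionPerm (w • (i : ι)) (w • (i : ι)), hmem⟩ with hj
    have hs : w * RootPairing.weylGroup.ofIdx P i * w⁻¹ = RootPairing.weylGroup.ofIdx P j := by
      rw [conj_ofIdx, hj, ofIdx_neg]
    have hk : k.val i = k.val j := by
      apply k.invariant
      refine ⟨RootPairing.weylGroup.ofIdx P (w • (i : ι)) * w, ?_⟩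
      rw [mul_smul, ← root_smul, ← root_smul]
      rfl
    have hv : weylAct w (weylAct (RootPairing.weylGroup.ofIdx P i) v) =
        weylAct (RootPairing.weylGroup.ofIdx P j) (weylAct w v) := by
      rw [← weylAct_mul, ← weylAct_mul, ← hs]
      simp
    have hc : corootForm P i v = corootForm P j (-weylAct w v) := by
      rw [hj, corootForm_neg, map_neg, LinearMap.neg_apply, neg_neg, corootForm_smul]
    simp only [genT, genF, thetaGen, map_sub, map_mul, FreeAlgebra.lift_ι_apply,
      AlgHom.commutes, ← hw]
    rw [hs, hk, hc, hv, ← map_mul, ← Hecke.cross, map_neg (weylAct _)]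

/-- The automorphism `θ` of the graded affine Hecke algebra. -/
noncomputable def theta (k : Parameter b) : Hecke k →ₐ[ℂ] Hecke k :=
  RingQuot.liftAlgHom ℂ ⟨FreeAlgebra.lift ℂ (thetaGen k), fun _ _ h => thetaGen_rel k h⟩

theorem theta_t (k : Parameter b) (w : P.weylGroup) :
    theta k (Hecke.t k w) = Hecke.t k (longest b * w * (longest b)⁻¹) := by
  refine (RingQuot.liftAlgHom_mkAlgHom_apply ℂ _ (fun _ _ h => thetaGen_rel k h) _).trans ?_
  simp [genT, thetaGen]

theorem theta_f (k : Parameter b) (v : Cplx V₀) :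
    theta k (Hecke.f k v) = Hecke.f k (-weylAct (longest b) v) := by
  refine (RingQuot.liftAlgHom_mkAlgHom_apply ℂ _ (fun _ _ h => thetaGen_rel k h) _).trans ?_
  simp [genF, thetaGen]

end HeckeAlgebra

section Modules

variable {ι V₀ N : Type u} [AddCommGroup V₀] [Module ℝ V₀] [AddCommGroup N] [Module ℝ N]
  {P : RootPairing ι ℝ V₀ N} {b : P.Base} [Finite ι] [P.IsCrystallographic] [P.IsReduced]

/-- A finite-dimensional module over the crossed product `ℍ ⋊ ⟨θ⟩`, where `⟨θ⟩` has order two: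
a finite-dimensional `ℍ`-module with an operator `θ`, of square one, such that
`θ (h x) = θ(h) (θ x)`. -/
structure TwistedModule (k : Parameter b) : Type (u + 1) where
  carrier : Type u
  [addCommGroup : AddCommGroup carrier]
  [complexModule : Module ℂ carrier]
  [heckeModule : Module (Hecke k) carrier]
  [isScalarTower : IsScalarTower ℂ (Hecke k) carrier]
  [finite : Module.Finite ℂ carrier]
  tw : carrier →ₗ[ℂ] carrier
  tw_tw : ∀ x, tw (tw x) = x
  tw_smul : ∀ (h : Hecke k) (x : carrier), tw (h • x) = theta k h • tw x

attribute [instance] TwistedModule.addCommGroup TwistedModule.complexModule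
  TwistedModule.heckeModule TwistedModule.isScalarTower TwistedModule.finite

namespace TwistedModule

variable {k : Parameter b}

/-- The restriction of `X` to the Weyl group. -/
noncomputable def weylRep (X : TwistedModule k) : Representation ℂ P.weylGroup X.carrier where
  toFun w := Algebra.lsmul ℂ ℂ X.carrier (Hecke.t k w)
  map_one' := by rw [Hecke.t_one, map_one]
  map_mul' w w' := by rw [Hecke.t_mul, map_mul]

theorem weylRep_apply (X : TwistedModule k) (w : P.weylGroup) (x : X.carrier) :
    X.weylRep w x = Hecke.t k w • x := rfl

/-- The action of `θ t_{w₀}` on `X`. -/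
noncomputable def twLongest (X : TwistedModule k) : Module.End ℂ X.carrier :=
  X.tw ∘ₗ X.weylRep (longest b)

theorem twLongest_weylRep (X : TwistedModule k) (w : P.weylGroup) (x : X.carrier) :
    X.twLongest (X.weylRep w x) = X.weylRep w (X.twLongest x) := by
  have htw (u : P.weylGroup) (y : X.carrier) :
      X.tw (X.weylRep u y) = X.weylRep (longest b * u * (longest b)⁻¹) (X.tw y) := by
    rw [weylRep_apply, X.tw_smul, theta_t, weylRep_apply]
  -- `θ² = 1` on `X` forces conjugation by `w₀²` to act trivially
  have hsq (u : P.weylGroup) (y : X.carrier) : X.weylRep u y =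
      X.weylRep (longest b * (longest b * u * (longest b)⁻¹) * (longest b)⁻¹) y := by
    have h := htw (longest b * u * (longest b)⁻¹) (X.tw y)
    rw [X.tw_tw, ← htw u y, X.tw_tw] at h
    exact h
  have hmul (u u' : P.weylGroup) (y : X.carrier) :
      X.weylRep u (X.weylRep u' y) = X.weylRep (u * u') y := by
    rw [map_mul, Module.End.mul_apply]
  simp only [twLongest, LinearMap.comp_apply]
  rw [hmul, htw, htw, hmul, hsq (w * _)]
  congr 2
  group

/-- The eigenspace of `θ t_{w₀}` on `X` for the eigenvalue `c`, as a subrepresentation of the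
Weyl group; `X⁺` and `X⁻` are the cases `c = 1` and `c = -1`. -/
noncomputable def eigenRep (X : TwistedModule k) (c : ℂ) : Subrepresentation X.weylRep where
  toSubmodule := X.twLongest.eigenspace c
  apply_mem_toSubmodule w x hx := by
    rw [Module.End.mem_eigenspace_iff] at hx ⊢
    rw [twLongest_weylRep, hx, map_smul]

/-- The module `X̄`, which is `X` as an `ℍ`-module and on which `θ` acts by its negative. -/
noncomputable def bar (X : TwistedModule k) : TwistedModule k where
  carrier := X.carrier
  tw := -X.tw
  tw_tw x := by simp [X.tw_tw]
  tw_smul h x := by simp [X.tw_smul]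

/-- `X` is irreducible as an `ℍ ⋊ ⟨θ⟩`-module. -/
def IsIrreducible (X : TwistedModule k) : Prop :=
  Nontrivial X.carrier ∧
    ∀ U : Submodule (Hecke k) X.carrier, (∀ x ∈ U, X.tw x ∈ U) → U = ⊥ ∨ U = ⊤

/-- There is a short exact sequence `0 → X → Y → Z → 0` of `ℍ ⋊ ⟨θ⟩`-modules. -/
def IsExtension (X Y Z : TwistedModule k) : Prop :=
  ∃ (f : X.carrier →ₗ[Hecke k] Y.carrier) (g : Y.carrier →ₗ[Hecke k] Z.carrier),
    (∀ x, f (X.tw x) = Y.tw (f x)) ∧ (∀ y, g (Y.tw y) = Z.tw (g y)) ∧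
      Function.Injective f ∧ Function.Exact f g ∧ Function.Surjective g

end TwistedModule

end Modules

section EulerPoincare

open CategoryTheory Abelian

variable {ι V₀ N : Type u} [AddCommGroup V₀] [Module ℝ V₀] [AddCommGroup N] [Module ℝ N]
  {P : RootPairing ι ℝ V₀ N} {b : P.Base} [Finite ι] [P.IsCrystallographic] [P.IsReduced]
  {k : Parameter b}

/-- `X` in the category of `ℍ`-modules. -/
noncomputable abbrev TwistedModule.toHecke (X : TwistedModule k) : ModuleCat.{u} (Hecke k) :=
  ModuleCat.of (Hecke k) X.carrier

/-- The functor `M ↦ M^θ` on `ℍ`-modules. -/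
noncomputable abbrev twistFunctor (k : Parameter b) :
    ModuleCat.{u} (Hecke k) ⥤ ModuleCat.{u} (Hecke k) :=
  ModuleCat.restrictScalars (theta k).toRingHom

/-- The operator `θ` of `X` as a morphism of `ℍ`-modules `X ⟶ X^θ`. -/
noncomputable def TwistedModule.toTwist (X : TwistedModule k) :
    X.toHecke ⟶ (twistFunctor k).obj X.toHecke :=
  ModuleCat.ofHom (Y := (twistFunctor k).obj X.toHecke)
    { toFun := fun x => X.tw x
      map_add' := fun x y => map_add X.tw x y
      map_smul' := fun h x => X.tw_smul h x }

/-- The operator `θ` of `X` as a morphism of `ℍ`-modules `X^θ ⟶ X`. -/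
noncomputable def TwistedModule.ofTwist (X : TwistedModule k) :
    (twistFunctor k).obj X.toHecke ⟶ X.toHecke :=
  ModuleCat.ofHom (X := (twistFunctor k).obj X.toHecke)
    { toFun := fun x => X.tw x
      map_add' := fun x y => map_add X.tw x y
      map_smul' := fun h x => by
        let x' : X.carrier := x
        change X.tw (theta k h • x') = h • X.tw x'
        obtain ⟨y, hy⟩ : ∃ y, x' = X.tw y := ⟨X.tw x', (X.tw_tw x').symm⟩
        rw [hy, ← X.tw_smul, X.tw_tw, X.tw_tw] }

theorem twistFunctor_exact (k : Parameter b) (S : ShortComplex (ModuleCat.{u} (Hecke k)))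
    (h : S.Exact) : (S.map (twistFunctor k)).Exact := by
  rw [ShortComplex.ShortExact.moduleCat_exact_iff_function_exact] at h ⊢
  exact h

instance (k : Parameter b) : Limits.PreservesFiniteLimits (twistFunctor k) :=
  (((twistFunctor k).exact_tfae.out 1 3 :
    _ ↔ Limits.PreservesFiniteLimits _ ∧ Limits.PreservesFiniteColimits _).mp
      (twistFunctor_exact k)).1

instance (k : Parameter b) : Limits.PreservesFiniteColimits (twistFunctor k) :=
  (((twistFunctor k).exact_tfae.out 1 3 :
    _ ↔ Limits.PreservesFiniteLimits _ ∧ Limits.PreservesFiniteColimits _).mp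
      (twistFunctor_exact k)).2

/-- The group `Ext^n_ℍ(X, Y)` in the category of `ℍ`-modules. -/
abbrev HeckeExt (X Y : TwistedModule k) (n : ℕ) : Type u := Ext.{u} X.toHecke Y.toHecke n

/-- The operator `θ^*` on `Ext^n_ℍ(X, Y)`: apply `M ↦ M^θ` and compose with `θ : X ⟶ X^θ` and
`θ : Y^θ ⟶ Y`. In degree zero it is `ψ ↦ θ ∘ ψ ∘ θ`. -/
noncomputable def thetaStar (X Y : TwistedModule k) (n : ℕ) :
    Module.End ℂ (HeckeExt X Y n) :=
  (Ext.mk₀ Y.ofTwist).postcompOfLinear ℂ X.toHecke (add_zero n) ∘ₗ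
    (Ext.mk₀ X.toTwist).precompOfLinear ℂ ((twistFunctor k).obj Y.toHecke) (zero_add n) ∘ₗ
      (twistFunctor k).mapExtLinearMap ℂ X.toHecke Y.toHecke n

/-- The `θ`-twisted Euler-Poincaré pairing. -/
noncomputable def twistedEP (X Y : TwistedModule k) : ℂ :=
  ∑ᶠ n : ℕ, (-1) ^ n * LinearMap.trace ℂ (HeckeExt X Y n) (thetaStar X Y n)

end EulerPoincare

section VirtualRepresentations

/-- A virtual complex representation of the group `G`, presented as a formal difference
`pos - neg` of two representations. -/
structure VirtualRep (G : Type u) [Group G] : Type (u + 1) where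
  pos : Rep.{u} ℂ G
  neg : Rep.{u} ℂ G

/-- The character of a virtual representation. -/
noncomputable def VirtualRep.character {G : Type u} [Group G] (A : VirtualRep G) (g : G) : ℂ :=
  LinearMap.trace ℂ A.pos (A.pos.ρ g) - LinearMap.trace ℂ A.neg (A.neg.ρ g)

/-- The standard inner product `|G|⁻¹ ∑_g χ_A(g) conj(χ_B(g))` on virtual representations of the
finite group `G`. -/
noncomputable def VirtualRep.inner {G : Type u} [Group G] (A B : VirtualRep G) : ℂ :=
  (Nat.card G : ℂ)⁻¹ * ∑ᶠ g : G, A.character g * star (B.character g)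

end VirtualRepresentations

section Spin

variable {ι V₀ N : Type u} [AddCommGroup V₀] [Module ℝ V₀] [AddCommGroup N] [Module ℝ N]

/-- A Weyl group invariant inner product on `V₀`, given by its quadratic form. -/
structure InvariantForm (P : RootPairing ι ℝ V₀ N) where
  form : QuadraticForm ℝ V₀
  posDef : form.PosDef
  invariant : ∀ (w : P.weylGroup) (v : V₀), form (w • v) = form v

variable {P : RootPairing ι ℝ V₀ N}

/-- The Clifford algebra of `V₀`, with relations `v² = -⟨v, v⟩`. -/
abbrev Cliff (Q : InvariantForm P) : Type u := CliffordAlgebra (-Q.form)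

/-- The spin cover of the Weyl group `W`: the preimage of `W ⊆ O(V₀)` under the double cover
`Pin(V₀) → O(V₀)` sending `a` to `v ↦ ε(a) v a⁻¹`, where `ε` is the main involution of the Clifford
algebra. An element is written as a pair of an element of `W` and a lift of it. -/
def spinCover (Q : InvariantForm P) : Subgroup (P.weylGroup × pinGroup (-Q.form)) where
  carrier := {x | ∀ v : V₀, CliffordAlgebra.involute (x.2 : Cliff Q) *
    CliffordAlgebra.ι (-Q.form) v = CliffordAlgebra.ι (-Q.form) (x.1 • v) * (x.2 : Cliff Q)}
  one_mem' v := by simp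
  mul_mem' {x y} hx hy v := by
    simp only [Set.mem_ofPred_eq] at hx hy
    simp only [Prod.fst_mul, Prod.snd_mul, Submonoid.coe_mul, map_mul, mul_smul]
    rw [mul_assoc, hy, ← mul_assoc, hx, mul_assoc]
  inv_mem' {x} hx v := by
    simp only [Set.mem_ofPred_eq] at hx
    have h := hx (x.1⁻¹ • v)
    rw [smul_inv_smul] at h
    have h1 : ((x⁻¹).2 : Cliff Q) * (x.2 : Cliff Q) = 1 := by
      rw [← Submonoid.coe_mul, Prod.snd_inv, inv_mul_cancel, Submonoid.coe_one]
    have h2 : (x.2 : Cliff Q) * ((x⁻¹).2 : Cliff Q) = 1 := by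
      rw [← Submonoid.coe_mul, Prod.snd_inv, mul_inv_cancel, Submonoid.coe_one]
    have h3 : CliffordAlgebra.involute ((x⁻¹).2 : Cliff Q) *
        CliffordAlgebra.involute (x.2 : Cliff Q) = 1 := by
      rw [← map_mul, h1, map_one]
    calc CliffordAlgebra.involute ((x⁻¹).2 : Cliff Q) * CliffordAlgebra.ι (-Q.form) v
        = CliffordAlgebra.involute ((x⁻¹).2 : Cliff Q) *
            (CliffordAlgebra.ι (-Q.form) v * (x.2 : Cliff Q)) * ((x⁻¹).2 : Cliff Q) := by
          rw [mul_assoc, mul_assoc, h2, mul_one]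
      _ = CliffordAlgebra.ι (-Q.form) ((x⁻¹).1 • v) * ((x⁻¹).2 : Cliff Q) := by
          rw [← h, ← mul_assoc (CliffordAlgebra.involute _), h3, one_mul, Prod.fst_inv]

/-- The projection of the spin cover to the Weyl group. -/
noncomputable def spinCover.proj (Q : InvariantForm P) : spinCover Q →* P.weylGroup :=
  (MonoidHom.fst _ _).comp (spinCover Q).subtype

/-- `S` is the sum of the simple modules of the complexified Clifford algebra, each taken once:
the unique simple module if `dim V` is even, and the sum of the two simple modules `S⁺` and `S⁻` if
`dim V` is odd. -/
def IsSpinModule (Q : InvariantForm P) (S : Type u) [AddCommGroup S]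
    [Module (ℂ ⊗[ℝ] Cliff Q) S] : Prop :=
  (Even (Module.finrank ℝ V₀) → IsSimpleModule (ℂ ⊗[ℝ] Cliff Q) S) ∧
  (Odd (Module.finrank ℝ V₀) → ∃ S₁ S₂ : Submodule (ℂ ⊗[ℝ] Cliff Q) S, IsCompl S₁ S₂ ∧
    IsSimpleModule (ℂ ⊗[ℝ] Cliff Q) S₁ ∧ IsSimpleModule (ℂ ⊗[ℝ] Cliff Q) S₂ ∧
      IsEmpty (S₁ ≃ₗ[ℂ ⊗[ℝ] Cliff Q] S₂))

/-- The action of the spin cover on a module over the complexified Clifford algebra. -/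
noncomputable def spinRep (Q : InvariantForm P) (S : Type u) [AddCommGroup S] [Module ℂ S]
    [Module (ℂ ⊗[ℝ] Cliff Q) S] [IsScalarTower ℂ (ℂ ⊗[ℝ] Cliff Q) S] :
    Representation ℂ (spinCover Q) S where
  toFun g := Algebra.lsmul ℂ ℂ S ((1 : ℂ) ⊗ₜ[ℝ] (g.1.2 : Cliff Q))
  map_one' := by
    change Algebra.lsmul ℂ ℂ S (1 : ℂ ⊗[ℝ] Cliff Q) = 1
    exact map_one _
  map_mul' g h := by
    rw [← map_mul, Algebra.TensorProduct.tmul_mul_tmul, one_mul]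
    rfl

end Spin

section DiracIndex

variable {ι V₀ N : Type u} [AddCommGroup V₀] [Module ℝ V₀] [AddCommGroup N] [Module ℝ N]
  {P : RootPairing ι ℝ V₀ N} {b : P.Base} [Finite ι] [P.IsCrystallographic] [P.IsReduced]
  {k : Parameter b}

/-- The representation `X^± ⊗ S` of the spin cover, where `X^±` is the `± 1`-eigenspace of
`θ t_{w₀}` (`c = ± 1`), on which the spin cover acts through the Weyl group. -/
noncomputable def eigenTensorSpin (Q : InvariantForm P) (S : Type u) [AddCommGroup S] [Module ℂ S]
    [Module (ℂ ⊗[ℝ] Cliff Q) S] [IsScalarTower ℂ (ℂ ⊗[ℝ] Cliff Q) S] (X : TwistedModule k)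
    (c : ℂ) : Rep.{u} ℂ (spinCover Q) :=
  Rep.of (Representation.tprod
    ((X.eigenRep c).toRepresentation.comp (spinCover.proj Q)) (spinRep Q S))

/-- The `θ`-twisted Dirac index `I^θ(X) = (X⁺ - X⁻) ⊗ S`. -/
noncomputable def diracIndex (Q : InvariantForm P) (S : Type u) [AddCommGroup S] [Module ℂ S]
    [Module (ℂ ⊗[ℝ] Cliff Q) S] [IsScalarTower ℂ (ℂ ⊗[ℝ] Cliff Q) S] (X : TwistedModule k) :
    VirtualRep (spinCover Q) where
  pos := eigenTensorSpin Q S X 1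
  neg := eigenTensorSpin Q S X (-1)

end DiracIndex

section EllipticSpace

variable {ι V₀ N : Type u} [AddCommGroup V₀] [Module ℝ V₀] [AddCommGroup N] [Module ℝ N]
  {P : RootPairing ι ℝ V₀ N} {b : P.Base} [Finite ι] [P.IsCrystallographic] [P.IsReduced]

/-- The complexified Grothendieck group of the category of finite-dimensional
`ℍ ⋊ ⟨θ⟩`-modules. -/
abbrev GrothendieckSpace (k : Parameter b) : Type (u + 1) :=
  (TwistedModule k →₀ ℂ) ⧸ Submodule.span ℂ
    {x | ∃ X Y Z : TwistedModule k, X.IsExtension Y Z ∧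
      x = Finsupp.single Y (1 : ℂ) - Finsupp.single X 1 - Finsupp.single Z 1}

/-- The class `[X]` in the complexified Grothendieck group. -/
noncomputable def TwistedModule.cls {k : Parameter b} (X : TwistedModule k) :
    GrothendieckSpace k :=
  Submodule.Quotient.mk (Finsupp.single X (1 : ℂ))

/-- The span `K¹` of the classes of irreducible modules that are reducible over `ℍ`. -/
noncomputable def K1 (k : Parameter b) : Submodule ℂ (GrothendieckSpace k) :=
  Submodule.span ℂ
    {x | ∃ X : TwistedModule k, X.IsIrreducible ∧ ¬ IsSimpleModule (Hecke k) X.carrier ∧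
      x = X.cls}

/-- The span `K²` of the classes `[X ⊕ X̄] = [X] + [X̄]`, for irreducible modules `X` that are
irreducible over `ℍ`. -/
noncomputable def K2 (k : Parameter b) : Submodule ℂ (GrothendieckSpace k) :=
  Submodule.span ℂ
    {x | ∃ X : TwistedModule k, X.IsIrreducible ∧ IsSimpleModule (Hecke k) X.carrier ∧
      x = X.cls + X.bar.cls}

/-- The space `K^θ_ℍ`. -/
abbrev KTheta (k : Parameter b) : Type (u + 1) := GrothendieckSpace k ⧸ (K1 k ⊔ K2 k)

/-- The quotient `K^θ_ℍ / rad(E)` by the radical of a sesquilinear form `E`. If `E` is the form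
induced by the twisted Euler-Poincaré pairing, this is the twisted elliptic space. -/
abbrev EllTheta {k : Parameter b} (E : KTheta k →ₗ[ℂ] KTheta k →ₗ⋆[ℂ] ℂ) : Type (u + 1) :=
  KTheta k ⧸ LinearMap.ker E

end EllipticSpace

end GradedHecke

open GradedHecke

set_option linter.unusedSectionVars false

/-! Write χ_X(w) for the trace of θ t_{w₀} t_w on X, that is, the character of X⁺ − X⁻ (`twChar`).
All three claims follow from one formula (`twistedEP_eq_star`): EP^θ(X, Y) = |W|⁻¹ Σ_w χ_X(w)
conj(χ_Y(w)) tr(w, ⋀V₀).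

The formula comes from a Koszul resolution of Y by the modules coinduced from the W-representations
Hom(⋀^i V₀, Y). Coinduced modules are injective because W is finite (`coind_injective`). The
Poincaré–Birkhoff–Witt theorem (`pbwEquiv`) reduces exactness to that of a polynomial Koszul
complex, which has an Euler homotopy (`kosz_exact`). The resolution stops in degree dim V, whence
the finiteness and the vanishing of Ext. It carries an action of θ, so dimension shifting
(`HasTwistedEuler.shift`) turns EP^θ into an alternating sum of traces on Hom_W(X, Hom(⋀^i V₀, Y)).
On V₀ the involution θ is −w₀; its sign (−1)^i on ⋀^i cancels the sign of the Euler characteristic.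
The weight is therefore tr(w, ⋀V₀) = det(1 + w) and not det(1 − w).

On the spin side, the exterior and Clifford algebras agree as representations of the isometries. A
lift g of w acts on the Clifford algebra by x ↦ g x g*, up to the main involution, which gives tr(w,
⋀V₀) = 2^d τ(g)², where τ is the normalised trace and d = dim V (`extTrace_proj`). A functional that
is tracial and invariant under the main involution is a multiple of τ; together with a count of
intertwiners by a separability idempotent this yields χ_S = dim S · τ and (dim S)² = n 2^d
(`spinModule_trace`). Hence |χ_S(g)|² = n tr(w, ⋀V₀), and averaging over the spin cover instead of W
gives the identity with the Dirac index (`mul_twistedEP_eq_inner`).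

The weight is 2^d times a square, so it is nonnegative: the form is positive semidefinite, and its
null vectors lie in the radical (`extForm_eq_zero`). It descends to K^θ because χ is additive on
extensions, changes sign when θ does, and vanishes on an irreducible module that is reducible over
ℍ, where θ exchanges two complementary submodules (`twChar_eq_zero_of_not_isSimpleModule`). -/

namespace GradedHecke

/-! ### The Weyl group: generation, the exchange condition, w₀² = 1 and finiteness. -/

section WeylGroup

variable {ι V₀ N : Type u} [AddCommGroup V₀] [Module ℝ V₀] [AddCommGroup N] [Module ℝ N]
  {P : RootPairing ι ℝ V₀ N}

open RootPairing.weylGroup (ofIdx)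

theorem ofIdx_mul_self (i : ι) : ofIdx P i * ofIdx P i = 1 := by
  apply Subtype.ext
  apply RootPairing.Equiv.weightHom_injective P
  ext v
  change P.reflection i (P.reflection i v) = v
  simp

theorem ofIdx_smul_vec (i : ι) (v : V₀) : ofIdx P i • v = v - P.coroot' i v • P.root i := by
  change P.reflection i v = _
  rw [RootPairing.reflection_apply]

theorem ofIdx_smul_idx (i j : ι) : ofIdx P i • j = P.reflectionPerm i j := rfl

theorem smul_reflectionPerm (w : P.weylGroup) (i : ι) :
    w • P.reflectionPerm i i = P.reflectionPerm (w • i) (w • i) := by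
  apply P.root.injective
  rw [root_smul, root_neg, root_neg, smul_neg, root_smul]

theorem not_isPos_reflectionPerm (b : P.Base) (i : ι) :
    ¬ b.IsPos (P.reflectionPerm i i) ↔ b.IsPos i := by
  have := (RootPairing.Base.IsPos.neg_iff_not (b := b) i).not
  rw [not_not] at this
  exact this

theorem isPos_reflectionPerm (b : P.Base) (i : ι) :
    b.IsPos (P.reflectionPerm i i) ↔ ¬ b.IsPos i :=
  RootPairing.Base.IsPos.neg_iff_not (b := b) i

/-- The parameter function, extended to a Weyl group invariant function on all roots. -/
noncomputable def Parameter.onRoot {b : P.Base} (k : Parameter b) (j : ι) : ℂ :=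
  open Classical in
  if h : ∃ i : b.support, ∃ w : P.weylGroup, w • (i : ι) = j then (k.val h.choose : ℂ) else 0

/-- The choice of a simple root in the orbit is harmless, because the parameter is constant on
simple roots of one orbit. -/
theorem Parameter.onRoot_simple {b : P.Base} (k : Parameter b) (i : b.support) :
    k.onRoot i = k.val i := by
  have h : ∃ i' : b.support, ∃ w : P.weylGroup, w • (i' : ι) = i := ⟨i, 1, one_smul _ _⟩
  rw [Parameter.onRoot, dif_pos h, k.invariant h.choose i]
  obtain ⟨w, hw⟩ := h.choose_spec
  exact ⟨w, by rw [← root_smul, hw]⟩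

theorem Parameter.onRoot_smul {b : P.Base} (k : Parameter b) (w : P.weylGroup) (j : ι) :
    k.onRoot (w • j) = k.onRoot j := by
  have h : (∃ i' : b.support, ∃ u : P.weylGroup, u • (i' : ι) = w • j) ↔
      ∃ i' : b.support, ∃ u : P.weylGroup, u • (i' : ι) = j := by
    refine exists_congr fun i' => ⟨fun ⟨u, hu⟩ => ⟨w⁻¹ * u, ?_⟩, fun ⟨u, hu⟩ => ⟨w * u, ?_⟩⟩
    · rw [mul_smul, hu, inv_smul_smul]
    · rw [mul_smul, hu]
  by_cases h1 : ∃ i' : b.support, ∃ u : P.weylGroup, u • (i' : ι) = j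
  · have h2 := h.mpr h1
    rw [Parameter.onRoot, Parameter.onRoot, dif_pos h1, dif_pos h2, k.invariant h2.choose h1.choose]
    obtain ⟨u, hu⟩ := h1.choose_spec
    obtain ⟨u', hu'⟩ := h2.choose_spec
    refine ⟨u⁻¹ * w⁻¹ * u', ?_⟩
    rw [← root_smul, mul_smul, mul_smul, hu', inv_smul_smul]
    exact congrArg P.root (inv_smul_eq_iff.mpr hu.symm)
  · rw [Parameter.onRoot, Parameter.onRoot, dif_neg h1, dif_neg (h.not.mpr h1)]

variable [Finite ι] [P.IsCrystallographic] [P.IsReduced]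

/-- The simple reflections generate the Weyl group. -/
theorem weyl_induction (b : P.Base) {p : P.weylGroup → Prop} (one : p 1)
    (mul : ∀ i ∈ b.support, ∀ w, p w → p (ofIdx P i * w)) (w : P.weylGroup) : p w := by
  let H : Subgroup P.weylGroup := Subgroup.closure {g | ∃ i ∈ b.support, g = ofIdx P i}
  have hrefl (i : ι) : ofIdx P i ∈ H := by
    refine b.induction_reflect i (p := fun i => ofIdx P i ∈ H) ?_ ?_ ?_
    · intro i hi
      rwa [ofIdx_neg]
    · exact fun i hi => Subgroup.subset_closure ⟨i, hi, rfl⟩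
    -- The reflection in s_j(α_i) is s_j s_i s_j, so membership in the subgroup propagates from the
    -- simple roots to all roots.
    · intro i j hi hj
      rw [← ofIdx_smul_idx, ← conj_ofIdx]
      have hj' : ofIdx P j ∈ H := Subgroup.subset_closure ⟨j, hj, rfl⟩
      exact H.mul_mem (H.mul_mem hj' hi) (H.inv_mem hj')
  have hall : w ∈ H := by
    obtain ⟨w, hw⟩ := w
    induction hw using RootPairing.weylGroup.induction with
    | mem i => exact hrefl i
    | one => exact H.one_mem
    | mul x y hx hy h1 h2 => exact H.mul_mem h1 h2
  refine Subgroup.closure_induction_left (p := fun g _ => p g) one ?_ ?_ hall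
  · rintro _ ⟨i, hi, rfl⟩ y _ hy
    exact mul i hi y hy
  · rintro _ ⟨i, hi, rfl⟩ y _ hy
    rw [show (ofIdx P i)⁻¹ = ofIdx P i from inv_eq_of_mul_eq_one_left (ofIdx_mul_self i)]
    exact mul i hi y hy

/-- The element of the Weyl group given by a word in the simple reflections. -/
noncomputable def wordProd (b : P.Base) (L : List b.support) : P.weylGroup :=
  (L.map fun i => ofIdx P (i : ι)).prod

theorem exists_wordProd (b : P.Base) (w : P.weylGroup) : ∃ L : List b.support, wordProd b L = w := by
  refine weyl_induction b (p := fun w => ∃ L : List b.support, wordProd b L = w)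
    ⟨[], by simp [wordProd]⟩ ?_ w
  rintro i hi w ⟨L, rfl⟩
  exact ⟨⟨i, hi⟩ :: L, by simp [wordProd]⟩

/-- The exchange condition. Apply the letters to α_i from the right end of the word: the letter that
first makes the root negative is the reflection in the root it meets, so deleting this letter has
the same effect as multiplying by s_i on the right. -/
theorem wordProd_exchange (b : P.Base) {i : ι} (hi : i ∈ b.support) (L : List b.support)
    (h : ¬ b.IsPos (wordProd b L • i)) :
    ∃ L' : List b.support, L'.length < L.length ∧ wordProd b L * ofIdx P i = wordProd b L' := by
  induction L with
  | nil => exact absurd (by simpa [wordProd] using b.isPos_of_mem_support hi) h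
  | cons j M ih =>
    have hL : wordProd b (j :: M) = ofIdx P (j : ι) * wordProd b M := by simp [wordProd]
    by_cases hM : b.IsPos (wordProd b M • i)
    · refine ⟨M, by simp, ?_⟩
      -- A simple reflection makes no positive root negative except its own simple root.
      have hj : wordProd b M • i = j := by
        by_contra hne
        refine h ?_
        rw [hL, mul_smul]
        exact hM.reflectionPerm j.2 hne
      rw [hL, ← hj, ← conj_ofIdx]
      have := ofIdx_mul_self (P := P) i
      simp [mul_assoc, this]
    · obtain ⟨M', hlen, hM'⟩ := ih hM
      refine ⟨j :: M', by simpa using hlen, ?_⟩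
      rw [hL, mul_assoc, hM']
      simp [wordProd]

/-- An element of the Weyl group preserving positivity of the simple roots is trivial. -/
theorem eq_one_of_isPos_smul (b : P.Base) (w : P.weylGroup)
    (h : ∀ i ∈ b.support, b.IsPos (w • i)) : w = 1 := by
  have key (n : ℕ) : ∀ L : List b.support, L.length = n →
      (∀ i ∈ b.support, b.IsPos (wordProd b L • i)) → wordProd b L = 1 := by
    induction n using Nat.strong_induction_on with
    | _ n ih =>
    intro L hL hpos
    rcases List.eq_nil_or_concat L with rfl | ⟨M, i, rfl⟩
    · simp [wordProd]
    · rw [List.concat_eq_append] at *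
      have hcat : wordProd b (M ++ [i]) = wordProd b M * ofIdx P (i : ι) := by simp [wordProd]
      rw [hcat] at hpos ⊢
      -- The word ends in s_i and keeps α_i positive, so the shorter word M sends α_i to a negative
      -- root; exchange then gives a strictly shorter word for the same element.
      have hneg : ¬ b.IsPos (wordProd b M • (i : ι)) := by
        have := hpos i i.2
        rw [mul_smul, ofIdx_smul_idx, smul_reflectionPerm, isPos_reflectionPerm] at this
        exact this
      obtain ⟨M', hlen, hM'⟩ := wordProd_exchange b i.2 M hneg
      rw [hM'] at hpos ⊢
      refine ih M'.length ?_ M' rfl hpos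
      rw [← hL]
      simp only [List.length_append, List.length_cons, List.length_nil]
      omega
  obtain ⟨L, rfl⟩ := exists_wordProd b w
  exact key _ L rfl h

/-- Since −w₀ permutes the simple roots and w₀ makes them negative, w₀² sends simple roots to
positive roots. -/
theorem longest_mul_self (b : P.Base) : longest b * longest b = 1 := by
  refine eq_one_of_isPos_smul b _ fun i hi => ?_
  have h := longest_smul_simple b (neg_longest_smul_mem b hi)
  rwa [smul_reflectionPerm, not_isPos_reflectionPerm, ← mul_smul] at h

theorem longest_inv (b : P.Base) : (longest b)⁻¹ = longest b :=
  inv_eq_of_mul_eq_one_left (longest_mul_self b)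

/-- The action on the finite set of root indices is faithful: an element that fixes every index
preserves positivity. The roots need not span `V₀` for this. -/
theorem finite_weylGroup (b : P.Base) : Finite P.weylGroup := by
  refine Finite.of_injective (MulAction.toPermHom P.weylGroup ι) ?_
  rw [injective_iff_map_eq_one]
  intro w hw
  refine eq_one_of_isPos_smul b w fun i hi => ?_
  have : w • i = i := Equiv.congr_fun hw i
  rw [this]
  exact b.isPos_of_mem_support hi

end WeylGroup

/-! ### The regular representation and the Poincaré–Birkhoff–Witt theorem. -/

section PBW

variable {ι V₀ N : Type u} [AddCommGroup V₀] [Module ℝ V₀] [AddCommGroup N] [Module ℝ N]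
  {P : RootPairing ι ℝ V₀ N} {b : P.Base}

open RootPairing.weylGroup (ofIdx)

theorem weylAct_one (v : Cplx V₀) : weylAct (1 : P.weylGroup) v = v := by
  simp [weylAct]

theorem weylAct_ofIdx (i : ι) (v : Cplx V₀) :
    weylAct (ofIdx P i) v = v - corootForm P i v • ((1 : ℂ) ⊗ₜ[ℝ] P.root i) := by
  induction v using TensorProduct.induction_on with
  | zero => simp
  | add x y hx hy => simp only [map_add, hx, hy, add_smul]; abel
  | tmul c v =>
    have : weylAct (ofIdx P i) (c ⊗ₜ[ℝ] v) = c ⊗ₜ[ℝ] (ofIdx P i • v) := rfl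
    rw [this, ofIdx_smul_vec, corootForm, Module.Dual.baseChange_apply_tmul,
      TensorProduct.tmul_sub, TensorProduct.tmul_smul]
    congr 1
    rw [TensorProduct.smul_tmul', TensorProduct.smul_tmul', smul_eq_mul, mul_one]

theorem corootForm_root (i : ι) : corootForm P i ((1 : ℂ) ⊗ₜ[ℝ] P.root i) = 2 := by
  rw [corootForm, Module.Dual.baseChange_apply_tmul]
  simp [RootPairing.coroot']

theorem corootForm_weylAct_ofIdx (i : ι) (v : Cplx V₀) :
    corootForm P i (weylAct (ofIdx P i) v) = -corootForm P i v := by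
  rw [weylAct_ofIdx, map_sub, map_smul, corootForm_root, smul_eq_mul]
  ring

section lift
variable (k : Parameter b) {A : Type*} [Ring A] [Algebra ℂ A]
    (T : P.weylGroup → A) (F : Cplx V₀ → A) (one : T 1 = 1) (mul : ∀ w w', T (w * w') = T w * T w')
    (add : ∀ v v', F (v + v') = F v + F v') (smul : ∀ (c : ℂ) v, F (c • v) = c • F v)
    (comm : ∀ v v', F v * F v' = F v' * F v)
    (cross : ∀ (i : b.support) v, T (ofIdx P i) * F v - F (weylAct (ofIdx P i) v) * T (ofIdx P i) =
      algebraMap ℂ A ((k.val i : ℂ) * corootForm P i v))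

include one mul add smul comm cross in
theorem Hecke.lift_rel ⦃x y : FreeAlgebra ℂ (P.weylGroup ⊕ Cplx V₀)⦄ (h : HeckeRel k x y) :
    FreeAlgebra.lift ℂ (Sum.elim T F) x = FreeAlgebra.lift ℂ (Sum.elim T F) y := by
  induction h with
  | one => simp [genT, one]
  | mul w w' => simp [genT, mul]
  | add v v' => simp [genF, add]
  | smul c v => simp [genF, smul]
  | comm v v' => simp [genF, comm v v']
  | cross i v =>
    simp only [genT, genF, map_sub, map_mul, FreeAlgebra.lift_ι_apply, Sum.elim_inl,
      Sum.elim_inr, cross, AlgHom.commutes]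

/-- The universal property of the graded affine Hecke algebra. -/
noncomputable def Hecke.lift : Hecke k →ₐ[ℂ] A :=
  RingQuot.liftAlgHom ℂ ⟨FreeAlgebra.lift ℂ (Sum.elim T F),
    Hecke.lift_rel k T F one mul add smul comm cross⟩

theorem Hecke.lift_t (w : P.weylGroup) :
    Hecke.lift k T F one mul add smul comm cross (Hecke.t k w) = T w := by
  refine (RingQuot.liftAlgHom_mkAlgHom_apply ℂ _
    (Hecke.lift_rel k T F one mul add smul comm cross) _).trans ?_
  simp [genT]

theorem Hecke.lift_f (v : Cplx V₀) :
    Hecke.lift k T F one mul add smul comm cross (Hecke.f k v) = F v := by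
  refine (RingQuot.liftAlgHom_mkAlgHom_apply ℂ _
    (Hecke.lift_rel k T F one mul add smul comm cross) _).trans ?_
  simp [genF]

end lift

theorem Hecke.induction (k : Parameter b) {p : Hecke k → Prop}
    (algebraMap : ∀ c : ℂ, p (algebraMap ℂ _ c)) (t : ∀ w, p (Hecke.t k w))
    (f : ∀ v, p (Hecke.f k v)) (mul : ∀ x y, p x → p y → p (x * y))
    (add : ∀ x y, p x → p y → p (x + y)) (h : Hecke k) : p h := by
  obtain ⟨x, rfl⟩ := RingQuot.mkAlgHom_surjective ℂ (HeckeRel k) h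
  induction x using FreeAlgebra.induction with
  | grade0 c => rw [AlgHom.commutes]; exact algebraMap c
  | grade1 x => cases x with
    | inl w => exact t w
    | inr v => exact f v
  | mul x y hx hy => rw [map_mul]; exact mul _ _ hx hy
  | add x y hx hy => rw [map_add]; exact add _ _ hx hy

/-- `f` as a linear map. -/
noncomputable def Hecke.fLin (k : Parameter b) : Cplx V₀ →ₗ[ℂ] Hecke k where
  toFun := Hecke.f k
  map_add' := Hecke.f_add k
  map_smul' := Hecke.f_smul k

/-- The cross relation at s_i(v), solved for the product with the vector on the left; the form ⟨·,
α_i^∨⟩ changes sign under s_i. -/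
theorem Hecke.f_mul_t (k : Parameter b) (i : b.support) (v : Cplx V₀) :
    Hecke.f k v * Hecke.t k (ofIdx P i) = Hecke.t k (ofIdx P i) * Hecke.f k (weylAct (ofIdx P i) v) +
      algebraMap ℂ _ ((k.val i : ℂ) * corootForm P i v) := by
  have h := Hecke.cross k i (weylAct (ofIdx P i) v)
  rw [← weylAct_mul, ofIdx_mul_self, weylAct_one, corootForm_weylAct_ofIdx, mul_neg, map_neg,
    sub_eq_iff_eq_add] at h
  rw [h]
  abel

variable {σ : Type} (e : Module.Basis σ ℝ V₀)

/-- The linear polynomial attached to an element of `V`, in coordinates given by a basis. -/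
noncomputable def linPoly : Cplx V₀ →ₗ[ℂ] MvPolynomial σ ℂ :=
  (e.baseChange ℂ).constr ℂ MvPolynomial.X

theorem linPoly_basis (a : σ) : linPoly e ((1 : ℂ) ⊗ₜ[ℝ] e a) = MvPolynomial.X a := by
  rw [← Module.Basis.baseChange_apply, linPoly, Module.Basis.constr_basis]

section polyHom
variable (k : Parameter b)

/-- The subalgebra generated by `V`. -/
noncomputable abbrev polySubalgebra : Subalgebra ℂ (Hecke k) :=
  Algebra.adjoin ℂ (Set.range fun a => Hecke.f k ((1 : ℂ) ⊗ₜ[ℝ] e a))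

/-- The homomorphism from the polynomial ring `S(V)` to the graded affine Hecke algebra. -/
noncomputable def polyHom : MvPolynomial σ ℂ →ₐ[ℂ] Hecke k :=
  -- Evaluation of polynomials needs a commutative target, hence the detour through the subalgebra
  -- generated by V.
  haveI : IsMulCommutative (polySubalgebra e k) := Algebra.isMulCommutative_adjoin ℂ (by
    rintro _ ⟨a, rfl⟩ _ ⟨a', rfl⟩
    exact Hecke.f_comm k _ _)
  letI : CommRing (polySubalgebra e k) :=
    { (inferInstance : Ring (polySubalgebra e k)) with mul_comm := mul_comm' }
  (polySubalgebra e k).val.comp (MvPolynomial.aeval fun a =>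
    (⟨Hecke.f k ((1 : ℂ) ⊗ₜ[ℝ] e a), Algebra.subset_adjoin ⟨a, rfl⟩⟩ : polySubalgebra e k))

theorem polyHom_X (a : σ) : polyHom e k (MvPolynomial.X a) = Hecke.f k ((1 : ℂ) ⊗ₜ[ℝ] e a) := by
  simp [polyHom]

theorem polyHom_linPoly (v : Cplx V₀) : polyHom e k (linPoly e v) = Hecke.f k v := by
  have : (polyHom e k).toLinearMap ∘ₗ linPoly e = Hecke.fLin k := by
    refine (e.baseChange ℂ).ext fun a => ?_
    rw [Module.Basis.baseChange_apply, LinearMap.comp_apply, linPoly_basis]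
    exact polyHom_X e k a
  exact LinearMap.congr_fun this v

end polyHom

variable [Finite ι]

/-- The space `ℂ[W] ⊗ S(V)`, which carries the regular representation of the graded affine Hecke
algebra. -/
abbrev RegSpace (P : RootPairing ι ℝ V₀ N) (σ : Type) : Type u := P.weylGroup →₀ MvPolynomial σ ℂ

noncomputable def regT (u : P.weylGroup) : Module.End ℂ (RegSpace P σ) :=
  Finsupp.lmapDomain _ ℂ (u * ·)

omit [Finite ι] in
theorem regT_single (u w : P.weylGroup) (p : MvPolynomial σ ℂ) :
    regT u (Finsupp.single w p) = Finsupp.single (u * w) p := by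
  simp [regT]

open Classical in
/-- The coefficient of `t_{s_j w}` in `v t_w - t_w w⁻¹(v)`. -/
noncomputable def invCoeff (k : Parameter b) (w : P.weylGroup) (j : ι) (v : Cplx V₀) : ℂ :=
  if b.IsPos j ∧ ¬ b.IsPos (w⁻¹ • j) then k.onRoot j * corootForm P j v else 0

attribute [local instance] Fintype.ofFinite

/-- Moving v to the right through t_w by repeated use of the cross relation leaves t_w w⁻¹(v) plus
one correction for each positive root made negative by w⁻¹. This formula is imposed here as a
definition, and the relations are verified afterwards. -/
noncomputable def regF (k : Parameter b) (v : Cplx V₀) : Module.End ℂ (RegSpace P σ) :=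
  Finsupp.lsum ℂ fun w => Finsupp.lsingle w ∘ₗ LinearMap.mulLeft ℂ (linPoly e (weylAct w⁻¹ v)) +
    ∑ j : ι, invCoeff k w j v • Finsupp.lsingle (ofIdx P j * w)

theorem regF_single (k : Parameter b) (v : Cplx V₀) (w : P.weylGroup) (p : MvPolynomial σ ℂ) :
    regF e k v (Finsupp.single w p) = Finsupp.single w (linPoly e (weylAct w⁻¹ v) * p) +
      ∑ j : ι, invCoeff k w j v • Finsupp.single (ofIdx P j * w) p := by
  rw [regF, Finsupp.lsum_single]
  simp

theorem regF_single_one (k : Parameter b) (v : Cplx V₀) (p : MvPolynomial σ ℂ) :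
    regF e k v (Finsupp.single 1 p) = Finsupp.single 1 (linPoly e v * p) := by
  have h0 (j : ι) : invCoeff k 1 j v = 0 := by simp [invCoeff]
  simp only [regF_single, h0, zero_smul, Finset.sum_const_zero, add_zero, inv_one, weylAct_one]

omit [Finite ι] in
theorem invCoeff_add (k : Parameter b) (w : P.weylGroup) (j : ι) (v v' : Cplx V₀) :
    invCoeff k w j (v + v') = invCoeff k w j v + invCoeff k w j v' := by
  unfold invCoeff
  split_ifs <;> simp [mul_add]

omit [Finite ι] in
theorem invCoeff_smul (k : Parameter b) (w : P.weylGroup) (j : ι) (c : ℂ) (v : Cplx V₀) :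
    invCoeff k w j (c • v) = c * invCoeff k w j v := by
  unfold invCoeff
  split_ifs
  · simp; ring
  · simp

theorem regF_add (k : Parameter b) (v v' : Cplx V₀) :
    regF e k (v + v') = regF e k v + regF e k v' := by
  refine Finsupp.lhom_ext fun w p => ?_
  simp only [LinearMap.add_apply, regF_single, map_add, add_mul, Finsupp.single_add, invCoeff_add,
    add_smul, Finset.sum_add_distrib]
  abel

theorem regF_smul (k : Parameter b) (c : ℂ) (v : Cplx V₀) :
    regF e k (c • v) = c • regF e k v := by
  refine Finsupp.lhom_ext fun w p => ?_
  simp only [LinearMap.smul_apply, regF_single, map_smul, smul_mul_assoc, invCoeff_smul, mul_smul,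
    smul_add, Finset.smul_sum, Finsupp.smul_single]

variable [P.IsCrystallographic] [P.IsReduced]

/-- After reindexing the second sum by s_i the corrections cancel root by root, since s_i permutes
the positive roots other than α_i. Only α_i and −α_i remain; exactly one of them contributes,
according to the sign of w⁻¹(α_i), and it contributes k_i⟨v, α_i^∨⟩ in both cases. -/
theorem reg_cross_single (k : Parameter b) (i : b.support) (v : Cplx V₀) (w : P.weylGroup)
    (p : MvPolynomial σ ℂ) :
    regT (ofIdx P i) (regF e k v (Finsupp.single w p)) -
      regF e k (weylAct (ofIdx P i) v) (regT (ofIdx P i) (Finsupp.single w p)) =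
      ((k.val i : ℂ) * corootForm P i v) • Finsupp.single w p := by
  set s := ofIdx P (i : ι) with hs
  have hss : s * s = 1 := ofIdx_mul_self _
  have hinv : s⁻¹ = s := inv_eq_of_mul_eq_one_left hss
  have hsi : s • (i : ι) = P.reflectionPerm i i := rfl
  have hipos : b.IsPos (i : ι) := b.isPos_of_mem_support i.2
  have hne : (i : ι) ≠ s • (i : ι) := by
    intro h
    have := (not_isPos_reflectionPerm b (i : ι)).mpr hipos
    rw [← hsi, ← h] at this
    exact this hipos
  simp only [regT_single, regF_single, map_add, map_sum, map_smul]
  have h1 : weylAct (s * w)⁻¹ (weylAct s v) = weylAct w⁻¹ v := by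
    rw [← weylAct_mul]
    congr 2
    group
  rw [h1, add_sub_add_left_eq_sub,
    ← Equiv.sum_comp (MulAction.toPerm s : Equiv.Perm ι)
      (fun j => invCoeff k (s * w) j (weylAct s v) • Finsupp.single (ofIdx P j * (s * w)) p),
    ← Finset.sum_sub_distrib]
  have h2 (j : ι) : invCoeff k w j v • Finsupp.single (s * (ofIdx P j * w)) p -
      invCoeff k (s * w) (MulAction.toPerm s j) (weylAct s v) •
        Finsupp.single (ofIdx P (MulAction.toPerm s j) * (s * w)) p =
      (invCoeff k w j v - invCoeff k (s * w) (s • j) (weylAct s v)) •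
        Finsupp.single (s * (ofIdx P j * w)) p := by
    have h : s * (ofIdx P j * w) = ofIdx P (s • j) * (s * w) := by rw [← conj_ofIdx]; group
    rw [sub_smul, MulAction.toPerm_apply, h]
  simp only [h2]
  have h3 (j : ι) : invCoeff k (s * w) (s • j) (weylAct s v) =
      open Classical in
      if b.IsPos (s • j) ∧ ¬ b.IsPos (w⁻¹ • j) then k.onRoot j * corootForm P j v else 0 := by
    rw [invCoeff, k.onRoot_smul, corootForm_smul, ← mul_smul]
    congr 5
    group
  rw [Finset.sum_eq_add (i : ι) (s • (i : ι)) hne]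
  · have h4 : s * (ofIdx P (i : ι) * w) = w := by rw [← mul_assoc, ← hs, hss, one_mul]
    have h5 : s * (ofIdx P (s • (i : ι)) * w) = w := by
      rw [← conj_ofIdx, ← hs, ← mul_assoc, hss, one_mul, hinv, hss, one_mul]
    rw [h4, h5, ← add_smul]
    congr 1
    rw [h3, h3, invCoeff, invCoeff, ← mul_smul s s, hss, one_smul, k.onRoot_smul, hsi,
      corootForm_neg, smul_reflectionPerm, isPos_reflectionPerm, isPos_reflectionPerm,
      k.onRoot_simple]
    split_ifs <;> first | (exfalso; tauto) | simp
  · rintro j - ⟨hj1, hj2⟩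
    rw [h3, invCoeff]
    have : b.IsPos (s • j) ↔ b.IsPos j := by
      constructor
      · intro h
        have h' := h.reflectionPerm i.2 (fun h' => hj2 (by rw [← h', ← mul_smul, hss, one_smul]))
        have : s • s • j = P.reflectionPerm i (s • j) := rfl
        rwa [← this, ← mul_smul, hss, one_smul] at h'
      · exact fun h => h.reflectionPerm i.2 hj1
    rw [this, sub_self, zero_smul]
  · simp
  · simp

theorem reg_cross (k : Parameter b) (i : b.support) (v : Cplx V₀) :
    regT (ofIdx P i) * regF e k v - regF e k (weylAct (ofIdx P i) v) * regT (ofIdx P i) =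
      algebraMap ℂ (Module.End ℂ (RegSpace P σ)) ((k.val i : ℂ) * corootForm P i v) := by
  refine Finsupp.lhom_ext fun w p => ?_
  rw [Module.algebraMap_end_apply]
  exact reg_cross_single e k i v w p

/-- By induction on w in simple reflections. At w = 1 the operators are multiplications in a
polynomial ring. The cross relation moves both operators past t_{s_i}, where the induction
hypothesis applies. -/
theorem reg_comm (k : Parameter b) (v v' : Cplx V₀) :
    regF e k v * regF e k v' = regF e k v' * regF e k v := by
  have key (w : P.weylGroup) : ∀ (p : MvPolynomial σ ℂ) (v v' : Cplx V₀),
      regF e k v (regF e k v' (Finsupp.single w p)) =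
        regF e k v' (regF e k v (Finsupp.single w p)) := by
    refine weyl_induction b (p := fun w => ∀ (p : MvPolynomial σ ℂ) (v v' : Cplx V₀),
      regF e k v (regF e k v' (Finsupp.single w p)) =
        regF e k v' (regF e k v (Finsupp.single w p))) ?_ ?_ w
    · intro p v v'
      rw [regF_single_one, regF_single_one, regF_single_one, regF_single_one, mul_left_comm]
    · intro i hi w ih p v v'
      set i' : b.support := ⟨i, hi⟩
      have hF (v : Cplx V₀) (x : RegSpace P σ) : regF e k v (regT (ofIdx P i) x) =
          regT (ofIdx P i) (regF e k (weylAct (ofIdx P i) v) x) +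
            ((k.val i' : ℂ) * corootForm P i v) • x := by
        have h := LinearMap.congr_fun (reg_cross e k i' (weylAct (ofIdx P i) v)) x
        rw [← weylAct_mul, ofIdx_mul_self, weylAct_one, corootForm_weylAct_ofIdx,
          Module.algebraMap_end_apply] at h
        simp only [LinearMap.sub_apply, Module.End.mul_apply] at h
        rw [sub_eq_iff_eq_add] at h
        rw [h, mul_neg, neg_smul]
        abel
      rw [← regT_single]
      set x := Finsupp.single w p
      -- Writing s_i(v) as v minus a multiple of the root makes the leftover terms symmetric in the
      -- two vectors.
      have hx (v : Cplx V₀) : regF e k (weylAct (ofIdx P i) v) x = regF e k v x -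
          corootForm P i v • regF e k ((1 : ℂ) ⊗ₜ[ℝ] P.root i) x := by
        rw [weylAct_ofIdx, sub_eq_add_neg, ← neg_smul, regF_add, regF_smul]
        simp [sub_eq_add_neg]
      simp only [hF, map_add, map_smul]
      rw [ih p (weylAct (ofIdx P i) v)]
      rw [hx, hx]
      module
  refine Finsupp.lhom_ext fun w p => ?_
  exact key w p v v'

/-- The regular representation of the graded affine Hecke algebra on `ℂ[W] ⊗ S(V)`. -/
noncomputable def regRep (k : Parameter b) : Hecke k →ₐ[ℂ] Module.End ℂ (RegSpace P σ) :=
  Hecke.lift k regT (regF e k)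
    (Finsupp.lhom_ext fun w p => by rw [regT_single, one_mul]; rfl)
    (fun u u' => Finsupp.lhom_ext fun w p => by
      rw [Module.End.mul_apply, regT_single, regT_single, regT_single, mul_assoc])
    (regF_add e k) (regF_smul e k) (reg_comm e k) (reg_cross e k)

theorem regRep_t (k : Parameter b) (u : P.weylGroup) : regRep e k (Hecke.t k u) = regT u :=
  Hecke.lift_t ..

theorem regRep_f (k : Parameter b) (v : Cplx V₀) : regRep e k (Hecke.f k v) = regF e k v :=
  Hecke.lift_f ..

theorem regRep_polyHom (k : Parameter b) (p q : MvPolynomial σ ℂ) :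
    regRep e k (polyHom e k p) (Finsupp.single 1 q) = Finsupp.single 1 (p * q) := by
  induction p using MvPolynomial.induction_on generalizing q with
  | C c =>
    rw [← MvPolynomial.algebraMap_eq, AlgHom.commutes, AlgHom.commutes,
      Module.algebraMap_end_apply, Finsupp.smul_single, Algebra.smul_def]
  | add p p' hp hp' => simp only [map_add, LinearMap.add_apply, hp, hp', add_mul, Finsupp.single_add]
  | mul_X p a hp =>
    rw [map_mul, map_mul, Module.End.mul_apply, polyHom_X, regRep_f, regF_single_one,
      linPoly_basis, hp, mul_assoc]

/-- The map `ℂ[W] ⊗ S(V) → ℍ`. -/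
noncomputable def pbwMap (k : Parameter b) : RegSpace P σ →ₗ[ℂ] Hecke k :=
  Finsupp.lsum ℂ fun w => LinearMap.mulLeft ℂ (Hecke.t k w) ∘ₗ (polyHom e k).toLinearMap

omit [Finite ι] [P.IsCrystallographic] [P.IsReduced] in
theorem pbwMap_single (k : Parameter b) (w : P.weylGroup) (p : MvPolynomial σ ℂ) :
    pbwMap e k (Finsupp.single w p) = Hecke.t k w * polyHom e k p := by
  rw [pbwMap, Finsupp.lsum_single]
  rfl

omit [Finite ι] [P.IsCrystallographic] [P.IsReduced] in
theorem t_mul_pbwMap (k : Parameter b) (u : P.weylGroup) (x : RegSpace P σ) :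
    Hecke.t k u * pbwMap e k x = pbwMap e k (regT u x) := by
  induction x using Finsupp.induction_linear with
  | zero => simp
  | add x y hx hy => rw [map_add, mul_add, hx, hy, map_add, map_add]
  | single w p => rw [pbwMap_single, regT_single, pbwMap_single, Hecke.t_mul, mul_assoc]

/-- Linear independence in the PBW theorem: acting on 1 ⊗ 1 recovers the coefficients. -/
theorem regRep_pbwMap (k : Parameter b) (x : RegSpace P σ) :
    regRep e k (pbwMap e k x) (Finsupp.single 1 1) = x := by
  induction x using Finsupp.induction_linear with
  | zero => simp
  | add x y hx hy => rw [map_add, map_add, LinearMap.add_apply, hx, hy]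
  | single w p =>
    rw [pbwMap_single, map_mul, Module.End.mul_apply, regRep_polyHom, regRep_t, regT_single,
      mul_one, mul_one]

/-- The spanning half of the PBW theorem: the range is a left ideal, and it contains 1. -/
theorem mul_pbwMap_mem (k : Parameter b) (h : Hecke k) :
    ∀ x ∈ LinearMap.range (pbwMap e k), h * x ∈ LinearMap.range (pbwMap e k) := by
  induction h using Hecke.induction with
  | algebraMap c =>
    intro x hx
    rw [← Algebra.smul_def]
    exact Submodule.smul_mem _ c hx
  | t w =>
    rintro _ ⟨x, rfl⟩
    rw [t_mul_pbwMap]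
    exact ⟨_, rfl⟩
  | f v =>
    have key (w : P.weylGroup) : ∀ (v : Cplx V₀) (p : MvPolynomial σ ℂ),
        Hecke.f k v * (Hecke.t k w * polyHom e k p) ∈ LinearMap.range (pbwMap e k) := by
      refine weyl_induction b (p := fun w => ∀ (v : Cplx V₀) (p : MvPolynomial σ ℂ),
        Hecke.f k v * (Hecke.t k w * polyHom e k p) ∈ LinearMap.range (pbwMap e k)) ?_ ?_ w
      · intro v p
        refine ⟨Finsupp.single 1 (linPoly e v * p), ?_⟩
        rw [pbwMap_single, map_mul, polyHom_linPoly, Hecke.t_one, one_mul, one_mul]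
      · intro i hi w ih v p
        rw [Hecke.t_mul, mul_assoc, ← mul_assoc, Hecke.f_mul_t k ⟨i, hi⟩, add_mul, mul_assoc]
        refine Submodule.add_mem _ ?_ ?_
        · obtain ⟨y, hy⟩ := ih (weylAct (ofIdx P i) v) p
          rw [← hy, t_mul_pbwMap]
          exact ⟨_, rfl⟩
        · rw [← Algebra.smul_def, ← pbwMap_single]
          exact Submodule.smul_mem _ _ ⟨_, rfl⟩
    rintro _ ⟨x, rfl⟩
    induction x using Finsupp.induction_linear with
    | zero => simp
    | add x y hx hy => rw [map_add, mul_add]; exact Submodule.add_mem _ hx hy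
    | single w p => rw [pbwMap_single]; exact key w v p
  | mul x y hx hy =>
    intro z hz
    rw [mul_assoc]
    exact hx _ (hy _ hz)
  | add x y hx hy =>
    intro z hz
    rw [add_mul]
    exact Submodule.add_mem _ (hx _ hz) (hy _ hz)

/-- The Poincaré–Birkhoff–Witt theorem for the graded affine Hecke algebra. -/
noncomputable def pbwEquiv (k : Parameter b) : RegSpace P σ ≃ₗ[ℂ] Hecke k :=
  LinearEquiv.ofBijective (pbwMap e k)
    ⟨Function.LeftInverse.injective
      (g := fun h => regRep e k h (Finsupp.single 1 1)) (regRep_pbwMap e k), fun h => by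
      have h1 : (1 : Hecke k) ∈ LinearMap.range (pbwMap e k) :=
        ⟨Finsupp.single 1 1, by rw [pbwMap_single, Hecke.t_one, map_one, one_mul]⟩
      simpa using mul_pbwMap_mem e k h 1 h1⟩

theorem pbwEquiv_single (k : Parameter b) (w : P.weylGroup) (p : MvPolynomial σ ℂ) :
    pbwEquiv e k (Finsupp.single w p) = Hecke.t k w * polyHom e k p :=
  pbwMap_single e k w p

theorem pbwEquiv_symm_t_mul (k : Parameter b) (u : P.weylGroup) (h : Hecke k) :
    (pbwEquiv e k).symm (Hecke.t k u * h) = regT u ((pbwEquiv e k).symm h) := by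
  rw [LinearEquiv.symm_apply_eq]
  have := t_mul_pbwMap e k u ((pbwEquiv e k).symm h)
  rwa [show pbwMap e k ((pbwEquiv e k).symm h) = h from (pbwEquiv e k).apply_symm_apply h] at this

end PBW

/-! ### Contraction, wedge and induced maps on exterior powers. -/

section Exterior

variable {V : Type*} [AddCommGroup V] [Module ℝ V]

open CliffordAlgebra in
theorem contractLeft_mem_exteriorPower (ξ : Module.Dual ℝ V) (i : ℕ) :
    ∀ x ∈ ⋀[ℝ]^(i + 1) V, contractLeft (Q := (0 : QuadraticForm ℝ V)) ξ x ∈ ⋀[ℝ]^i V := by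
  induction i with
  | zero =>
    intro x hx
    rw [zero_add, ExteriorAlgebra.exteriorPower, pow_one] at hx
    obtain ⟨v, rfl⟩ := hx
    rw [ExteriorAlgebra.exteriorPower, pow_zero]
    exact ⟨ξ v, Eq.trans (by simp [Algebra.algebraMap_eq_smul_one]) (contractLeft_ι _ ξ v).symm⟩
  | succ i ih =>
    intro x hx
    rw [ExteriorAlgebra.exteriorPower, pow_succ'] at hx
    induction hx using Submodule.mul_induction_on' with
    | mem_mul_mem m hm y hy =>
      obtain ⟨v, rfl⟩ := hm
      change contractLeft ξ (CliffordAlgebra.ι 0 v * y) ∈ _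
      rw [contractLeft_ι_mul]
      refine Submodule.sub_mem _ (Submodule.smul_mem _ _ hy) ?_
      rw [ExteriorAlgebra.exteriorPower, pow_succ']
      exact Submodule.mul_mem_mul ⟨v, rfl⟩ (ih y hy)
    | add x _ y _ hx hy => rw [map_add]; exact Submodule.add_mem _ hx hy

theorem map_mem_exteriorPower (f : V →ₗ[ℝ] V) (i : ℕ) :
    ∀ x ∈ ⋀[ℝ]^i V, (ExteriorAlgebra.map f).toLinearMap x ∈ ⋀[ℝ]^i V := by
  intro x hx
  have h := Submodule.mem_map_of_mem (f := (ExteriorAlgebra.map f).toLinearMap) hx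
  have h' : (⋀[ℝ]^i V).map (ExteriorAlgebra.map f).toLinearMap =
      ((LinearMap.range (ExteriorAlgebra.ι ℝ (M := V))).map
        (ExteriorAlgebra.map f).toLinearMap) ^ i := Submodule.map_pow _ _ _
  rw [h'] at h
  have h1 : (LinearMap.range (ExteriorAlgebra.ι ℝ (M := V))).map
      (ExteriorAlgebra.map f).toLinearMap ≤ LinearMap.range (ExteriorAlgebra.ι ℝ (M := V)) := by
    rintro _ ⟨_, ⟨v, rfl⟩, rfl⟩
    exact ⟨f v, (ExteriorAlgebra.map_apply_ι f v).symm⟩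
  exact pow_le_pow_left' h1 i h

/-- Contraction of an exterior form with a linear form. -/
noncomputable def contr (i : ℕ) (ξ : Module.Dual ℝ V) : ⋀[ℝ]^(i + 1) V →ₗ[ℝ] ⋀[ℝ]^i V :=
  (CliffordAlgebra.contractLeft (Q := (0 : QuadraticForm ℝ V)) ξ).restrict
    (contractLeft_mem_exteriorPower ξ i)

/-- Left multiplication by a vector. -/
noncomputable def wedge (i : ℕ) (v : V) : ⋀[ℝ]^i V →ₗ[ℝ] ⋀[ℝ]^(i + 1) V :=
  (LinearMap.mulLeft ℝ (ExteriorAlgebra.ι ℝ v)).restrict fun x hx => by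
    rw [ExteriorAlgebra.exteriorPower, pow_succ']
    exact Submodule.mul_mem_mul ⟨v, rfl⟩ hx

/-- The map induced on an exterior power by a linear map. -/
noncomputable def extMap (i : ℕ) (f : V →ₗ[ℝ] V) : ⋀[ℝ]^i V →ₗ[ℝ] ⋀[ℝ]^i V :=
  (ExteriorAlgebra.map f).toLinearMap.restrict (map_mem_exteriorPower f i)

theorem coe_contr (i : ℕ) (ξ : Module.Dual ℝ V) (x : ⋀[ℝ]^(i + 1) V) :
    (contr i ξ x : ExteriorAlgebra ℝ V) =
      CliffordAlgebra.contractLeft (Q := (0 : QuadraticForm ℝ V)) ξ (x : ExteriorAlgebra ℝ V) := rfl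

theorem coe_extMap (i : ℕ) (f : V →ₗ[ℝ] V) (x : ⋀[ℝ]^i V) :
    (extMap i f x : ExteriorAlgebra ℝ V) = ExteriorAlgebra.map f x := rfl

theorem contr_add (i : ℕ) (ξ η : Module.Dual ℝ V) : contr i (ξ + η) = contr i ξ + contr i η := by
  ext x
  simp [coe_contr]

theorem contr_smul (i : ℕ) (c : ℝ) (ξ : Module.Dual ℝ V) : contr i (c • ξ) = c • contr i ξ := by
  ext x
  simp [coe_contr]

theorem contr_sum {σ : Type*} (s : Finset σ) (i : ℕ) (ξ : σ → Module.Dual ℝ V) :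
    contr i (∑ a ∈ s, ξ a) = ∑ a ∈ s, contr i (ξ a) :=
  map_sum (⟨⟨contr i, contr_add i⟩, contr_smul i⟩ :
    Module.Dual ℝ V →ₗ[ℝ] (⋀[ℝ]^(i + 1) V →ₗ[ℝ] ⋀[ℝ]^i V)) ξ s

theorem contr_contr (i : ℕ) (ξ η : Module.Dual ℝ V) (x : ⋀[ℝ]^(i + 2) V) :
    contr i ξ (contr (i + 1) η x) = -contr i η (contr (i + 1) ξ x) := by
  apply Subtype.ext
  rw [coe_contr, coe_contr, Submodule.coe_neg, coe_contr, coe_contr]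
  exact CliffordAlgebra.contractLeft_comm _ _ _

theorem contr_wedge (i : ℕ) (ξ : Module.Dual ℝ V) (v : V) (x : ⋀[ℝ]^(i + 1) V) :
    contr (i + 1) ξ (wedge (i + 1) v x) = ξ v • x - wedge i v (contr i ξ x) := by
  apply Subtype.ext
  exact CliffordAlgebra.contractLeft_ι_mul _ _ _

theorem contr_wedge_zero (ξ : Module.Dual ℝ V) (v : V) (x : ⋀[ℝ]^0 V) :
    contr 0 ξ (wedge 0 v x) = ξ v • x := by
  apply Subtype.ext
  refine (CliffordAlgebra.contractLeft_ι_mul _ _ _).trans ?_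
  obtain ⟨x, hx⟩ := x
  rw [ExteriorAlgebra.exteriorPower, pow_zero] at hx
  obtain ⟨r, rfl⟩ := Submodule.mem_one.mp hx
  have : CliffordAlgebra.contractLeft (Q := (0 : QuadraticForm ℝ V)) ξ (algebraMap ℝ _ r) = 0 :=
    CliffordAlgebra.contractLeft_algebraMap _ _ _
  erw [this]
  simp

theorem contractLeft_map (f : V →ₗ[ℝ] V) (ξ : Module.Dual ℝ V) (y : ExteriorAlgebra ℝ V) :
    CliffordAlgebra.contractLeft (Q := (0 : QuadraticForm ℝ V)) ξ (ExteriorAlgebra.map f y) =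
      ExteriorAlgebra.map f
        (CliffordAlgebra.contractLeft (Q := (0 : QuadraticForm ℝ V)) (ξ ∘ₗ f) y) := by
  induction y using CliffordAlgebra.left_induction with
  | algebraMap r =>
    erw [AlgHom.commutes, CliffordAlgebra.contractLeft_algebraMap,
      CliffordAlgebra.contractLeft_algebraMap, map_zero]
  | add x y hx hy => simp only [map_add, hx, hy]
  | ι_mul y v hy =>
    have h : ExteriorAlgebra.map f (CliffordAlgebra.ι 0 v * y) =
        CliffordAlgebra.ι 0 (f v) * ExteriorAlgebra.map f y := by
      rw [map_mul]
      congr 1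
      exact ExteriorAlgebra.map_apply_ι f v
    rw [h, CliffordAlgebra.contractLeft_ι_mul, hy, CliffordAlgebra.contractLeft_ι_mul, map_sub,
      map_smul, map_mul]
    congr 2
    exact (ExteriorAlgebra.map_apply_ι f v).symm

theorem extMap_contr (i : ℕ) (f : V →ₗ[ℝ] V) (ξ : Module.Dual ℝ V) (x : ⋀[ℝ]^(i + 1) V) :
    contr i ξ (extMap (i + 1) f x) = extMap i f (contr i (ξ ∘ₗ f) x) := by
  apply Subtype.ext
  exact contractLeft_map f ξ x

/-- In the expansion of a wedge of reflected vectors, every term with two factors α vanishes, so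
only the first-order correction survives. -/
theorem map_reflection (α : V) (ξ : Module.Dual ℝ V) (s : V →ₗ[ℝ] V)
    (hs : ∀ v, s v = v - ξ v • α) (x : ExteriorAlgebra ℝ V) :
    ExteriorAlgebra.map s x = x - ExteriorAlgebra.ι ℝ α *
      CliffordAlgebra.contractLeft (Q := (0 : QuadraticForm ℝ V)) ξ x := by
  induction x using CliffordAlgebra.left_induction with
  | algebraMap r =>
    erw [AlgHom.commutes, CliffordAlgebra.contractLeft_algebraMap, mul_zero, sub_zero]
  | add x y hx hy => simp only [map_add, hx, hy, mul_add]; abel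
  | ι_mul y v hy =>
    have h : ExteriorAlgebra.map s (CliffordAlgebra.ι 0 v * y) =
        ExteriorAlgebra.ι ℝ (s v) * ExteriorAlgebra.map s y := by
      rw [map_mul]
      congr 1
      exact ExteriorAlgebra.map_apply_ι s v
    have h2 : ExteriorAlgebra.ι ℝ v * ExteriorAlgebra.ι ℝ α =
        -(ExteriorAlgebra.ι ℝ α * ExteriorAlgebra.ι ℝ v) :=
      eq_neg_of_add_eq_zero_left (ExteriorAlgebra.ι_add_mul_swap v α)
    rw [h, hy, CliffordAlgebra.contractLeft_ι_mul, hs, map_sub, map_smul]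
    generalize (CliffordAlgebra.contractLeft ξ) y = z
    change _ = ExteriorAlgebra.ι ℝ v * y - ExteriorAlgebra.ι ℝ α *
      (ξ v • y - ExteriorAlgebra.ι ℝ v * z)
    rw [sub_mul, mul_sub, mul_sub, mul_sub, ← mul_assoc, h2, smul_mul_assoc, smul_mul_assoc,
      ← mul_assoc (ExteriorAlgebra.ι ℝ α), ExteriorAlgebra.ι_sq_zero, zero_mul, smul_zero, sub_zero,
      neg_mul, mul_smul_comm, mul_assoc]
    abel

/-- The correction in `map_reflection` contains a second contraction with ξ, which gives zero. This
identity is what makes the Koszul differential compatible with W for every parameter k. -/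
theorem extMap_reflection_contr (i : ℕ) (α : V) (ξ : Module.Dual ℝ V) (s : V →ₗ[ℝ] V)
    (hs : ∀ v, s v = v - ξ v • α) (x : ⋀[ℝ]^(i + 1) V) :
    extMap i s (contr i ξ x) = contr i ξ x := by
  apply Subtype.ext
  rw [coe_extMap, map_reflection α ξ s hs, coe_contr, CliffordAlgebra.contractLeft_contractLeft,
    mul_zero, sub_zero]

variable {σ : Type} [Fintype σ] (e : Module.Basis σ ℝ V)

/-- The operator Σ e_a ∧ ι_a is the derivation extending the identity of V, so it multiplies by the
degree. -/
theorem sum_wedge_contr (i : ℕ) (x : ⋀[ℝ]^(i + 1) V) :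
    ∑ a, wedge i (e a) (contr i (e.coord a) x) = ((i + 1 : ℕ) : ℝ) • x := by
  have key : ∀ i : ℕ, ∀ x ∈ ⋀[ℝ]^i V, ∑ a, ExteriorAlgebra.ι ℝ (e a) *
      CliffordAlgebra.contractLeft (Q := (0 : QuadraticForm ℝ V)) (e.coord a) x = (i : ℝ) • x := by
    intro i
    induction i with
    | zero =>
      intro x hx
      rw [ExteriorAlgebra.exteriorPower, pow_zero] at hx
      obtain ⟨r, rfl⟩ := Submodule.mem_one.mp hx
      rw [Nat.cast_zero, zero_smul]
      refine Finset.sum_eq_zero fun a _ => ?_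
      have : CliffordAlgebra.contractLeft (Q := (0 : QuadraticForm ℝ V)) (e.coord a)
        (algebraMap ℝ _ r) = 0 := CliffordAlgebra.contractLeft_algebraMap _ _ _
      erw [this, mul_zero]
    | succ i ih =>
      intro x hx
      rw [ExteriorAlgebra.exteriorPower, pow_succ'] at hx
      induction hx using Submodule.mul_induction_on' with
      | mem_mul_mem m hm y hy =>
        obtain ⟨v, rfl⟩ := hm
        have h1 (a : σ) : CliffordAlgebra.contractLeft (Q := (0 : QuadraticForm ℝ V)) (e.coord a)
            (ExteriorAlgebra.ι ℝ v * y) = e.coord a v • y - ExteriorAlgebra.ι ℝ v *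
            CliffordAlgebra.contractLeft (Q := (0 : QuadraticForm ℝ V)) (e.coord a) y :=
          CliffordAlgebra.contractLeft_ι_mul _ _ _
        have h2 (a : σ) : ExteriorAlgebra.ι ℝ (e a) * ExteriorAlgebra.ι ℝ v =
            -(ExteriorAlgebra.ι ℝ v * ExteriorAlgebra.ι ℝ (e a)) :=
          eq_neg_of_add_eq_zero_left (ExteriorAlgebra.ι_add_mul_swap _ _)
        simp only [h1, mul_sub, ← mul_assoc, h2, neg_mul, sub_neg_eq_add, Finset.sum_add_distrib]
        simp only [mul_assoc, ← Finset.mul_sum]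
        rw [ih y hy, mul_smul_comm, Nat.cast_succ, add_smul, one_smul, add_comm]
        congr 1
        simp only [mul_smul_comm, ← smul_mul_assoc, ← Finset.sum_mul, ← map_smul, ← map_sum]
        congr 2
        exact e.sum_repr v
      | add x _ y _ hx hy =>
        simp only [map_add, mul_add, Finset.sum_add_distrib, hx, hy, smul_add]
  apply Subtype.ext
  rw [Submodule.coe_sum]
  exact key (i + 1) x x.2

end Exterior

/-! ### The Koszul differential. -/

section Koszul

variable {L L' L'' Y Y' : Type*} [AddCommGroup L] [Module ℝ L] [AddCommGroup L'] [Module ℝ L']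
  [AddCommGroup L''] [Module ℝ L''] [AddCommGroup Y] [Module ℂ Y] [AddCommGroup Y'] [Module ℂ Y']

/-- Composition with a complex linear map. -/
def postMap (A : Y →ₗ[ℂ] Y') : (L →ₗ[ℝ] Y) →ₗ[ℂ] (L →ₗ[ℝ] Y') where
  toFun φ := A.restrictScalars ℝ ∘ₗ φ
  map_add' φ ψ := by ext; simp
  map_smul' c φ := by ext; simp

/-- Precomposition with a real linear map. -/
def preMap (c : L' →ₗ[ℝ] L) : (L →ₗ[ℝ] Y) →ₗ[ℂ] (L' →ₗ[ℝ] Y) where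
  toFun φ := φ ∘ₗ c
  map_add' _ _ := rfl
  map_smul' _ _ := rfl

@[simp] theorem postMap_apply (A : Y →ₗ[ℂ] Y') (φ : L →ₗ[ℝ] Y) (x : L) :
    postMap A φ x = A (φ x) := rfl

@[simp] theorem preMap_apply (c : L' →ₗ[ℝ] L) (φ : L →ₗ[ℝ] Y) (x : L') :
    preMap c φ x = φ (c x) := rfl

variable {V : Type*} [AddCommGroup V] [Module ℝ V] {σ : Type} [Fintype σ]
  (e : Module.Basis σ ℝ V) {B : Type*} [Ring B] [Algebra ℂ B] (X : σ → B) (A : σ → Module.End ℂ Y)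

/-- The Koszul differential on linear maps from an algebra to alternating forms. -/
noncomputable def kosz (i : ℕ) :
    (B →ₗ[ℂ] (⋀[ℝ]^i V →ₗ[ℝ] Y)) →ₗ[ℂ] (B →ₗ[ℂ] (⋀[ℝ]^(i + 1) V →ₗ[ℝ] Y)) where
  toFun g := ∑ a, preMap (contr i (e.coord a)) ∘ₗ
    (postMap (A a) ∘ₗ g - g ∘ₗ LinearMap.mulLeft ℂ (X a))
  map_add' g h := by
    rw [← Finset.sum_add_distrib]
    refine Finset.sum_congr rfl fun a _ => ?_
    ext; simp; abel
  map_smul' c g := by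
    rw [Finset.smul_sum]
    refine Finset.sum_congr rfl fun a _ => ?_
    ext; simp [smul_sub]

theorem kosz_apply (i : ℕ) (g : B →ₗ[ℂ] (⋀[ℝ]^i V →ₗ[ℝ] Y)) (p : B) (x : ⋀[ℝ]^(i + 1) V) :
    kosz e X A i g p x = ∑ a, (A a (g p (contr i (e.coord a) x)) -
      g (X a * p) (contr i (e.coord a) x)) := by
  simp [kosz]

/-- The operators involved commute while contractions anticommute, so the double sum equals its own
negative. -/
theorem kosz_kosz (hX : ∀ a c, X a * X c = X c * X a) (hA : ∀ a c y, A a (A c y) = A c (A a y))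
    (i : ℕ) (g : B →ₗ[ℂ] (⋀[ℝ]^i V →ₗ[ℝ] Y)) :
    kosz e X A (i + 1) (kosz e X A i g) = 0 := by
  refine LinearMap.ext fun p => LinearMap.ext fun x => ?_
  simp only [kosz_apply, LinearMap.zero_apply, map_sum, map_sub, ← Finset.sum_sub_distrib]
  set T : σ → σ → Y := fun a c => A a (A c (g p (contr i (e.coord c) (contr (i + 1) (e.coord a) x)))) -
    A a (g (X c * p) (contr i (e.coord c) (contr (i + 1) (e.coord a) x))) -
    (A c (g (X a * p) (contr i (e.coord c) (contr (i + 1) (e.coord a) x))) -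
      g (X c * (X a * p)) (contr i (e.coord c) (contr (i + 1) (e.coord a) x))) with hT
  have hTT : ∀ a c, T a c = -T c a := by
    intro a c
    simp only [hT]
    rw [contr_contr i (e.coord c) (e.coord a), ← mul_assoc, ← mul_assoc, hX c a, hA a c]
    simp only [map_neg]
    abel
  change ∑ a, ∑ c, T a c = 0
  have h : ∑ a, ∑ c, T a c = -∑ a, ∑ c, T a c := by
    conv_lhs => rw [Finset.sum_comm]
    rw [← Finset.sum_neg_distrib]
    refine Finset.sum_congr rfl fun c _ => ?_
    rw [← Finset.sum_neg_distrib]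
    exact Finset.sum_congr rfl fun a _ => hTT a c
  have h2 : (2 : ℂ) • ∑ a, ∑ c, T a c = 0 := by
    rw [two_smul]
    nth_rewrite 1 [h]
    exact neg_add_cancel _
  exact (smul_eq_zero.mp h2).resolve_left two_ne_zero

/-- Evaluating the cocycle condition on e_a ∧ y isolates the a-th summand. Degree-zero cocycles are
thus the maps compatible with the generators. -/
theorem kosz_zero_eq_zero {f : B →ₗ[ℂ] (⋀[ℝ]^0 V →ₗ[ℝ] Y)} (hf : kosz e X A 0 f = 0) (a : σ)
    (p : B) : f (X a * p) = postMap (A a) (f p) := by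
  classical
  refine LinearMap.ext fun y => ?_
  have h := LinearMap.congr_fun (LinearMap.congr_fun hf p) (wedge 0 (e a) y)
  rw [kosz_apply] at h
  simp only [contr_wedge_zero, LinearMap.zero_apply] at h
  rw [Finset.sum_eq_single a] at h
  · simp only [Module.Basis.coord_apply, Module.Basis.repr_self, Finsupp.single_eq_same,
      one_smul] at h
    exact (sub_eq_zero.mp h).symm
  · intro c _ hc
    simp [Module.Basis.coord_apply, hc.symm]
  · simp

end Koszul

/-! ### Exactness of the polynomial Koszul complex by an Euler homotopy. -/

section PolyKoszul

open MvPolynomial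

variable {V Y : Type*} [AddCommGroup V] [Module ℝ V] [AddCommGroup Y] [Module ℂ Y]
  {σ : Type} [Fintype σ] (e : Module.Basis σ ℝ V) (A : σ → Module.End ℂ Y)

/-- Contraction with the Euler vector field. -/
noncomputable def eulerContr (i : ℕ)
    (g : MvPolynomial σ ℂ →ₗ[ℂ] (⋀[ℝ]^(i + 1) V →ₗ[ℝ] Y)) :
    MvPolynomial σ ℂ →ₗ[ℂ] (⋀[ℝ]^i V →ₗ[ℝ] Y) :=
  ∑ c, preMap (wedge i (e c)) ∘ₗ g ∘ₗ (pderiv c : Derivation ℂ _ _).toLinearMap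

theorem eulerContr_apply (i : ℕ) (g : MvPolynomial σ ℂ →ₗ[ℂ] (⋀[ℝ]^(i + 1) V →ₗ[ℝ] Y))
    (p : MvPolynomial σ ℂ) (x : ⋀[ℝ]^i V) :
    eulerContr e i g p x = ∑ c, g (pderiv c p) (wedge i (e c) x) := by
  simp [eulerContr]

/-- The Lie derivative along the Euler vector field. -/
noncomputable def eulerLie (i : ℕ) (g : MvPolynomial σ ℂ →ₗ[ℂ] (⋀[ℝ]^(i + 1) V →ₗ[ℝ] Y)) :
    MvPolynomial σ ℂ →ₗ[ℂ] (⋀[ℝ]^(i + 1) V →ₗ[ℝ] Y) :=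
  kosz e X A i (eulerContr e i g) + eulerContr e (i + 1) (kosz e X A (i + 1) g)

/-- A Cartan formula. The terms containing e_c ∧ ι_a occur with opposite signs in the two
composites; what remains comes from the product rule for X_a p and from the contraction of e_c. -/
theorem eulerLie_apply (i : ℕ) (g : MvPolynomial σ ℂ →ₗ[ℂ] (⋀[ℝ]^(i + 1) V →ₗ[ℝ] Y))
    (p : MvPolynomial σ ℂ) (x : ⋀[ℝ]^(i + 1) V) :
    eulerLie e A i g p x = ∑ a, A a (g (pderiv a p) x) - g (∑ a, X a * pderiv a p) x -
      ((i + 1 : ℕ) : ℂ) • g p x := by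
  classical
  have hd (a c : σ) : pderiv c (X a * p) = (if a = c then p else 0) + X a * pderiv c p := by
    rw [Derivation.leibniz, pderiv_X, smul_eq_mul, smul_eq_mul, add_comm, Pi.single_apply]
    split_ifs <;> simp
  have hc (a c : σ) : contr (i + 1) (e.coord a) (wedge (i + 1) (e c) x) =
      (if a = c then x else 0) - wedge i (e c) (contr i (e.coord a) x) := by
    rw [contr_wedge, Module.Basis.coord_apply, Module.Basis.repr_self, Finsupp.single_apply]
    by_cases h : a = c
    · simp [h]
    · simp [h, Ne.symm h]
  -- The summand i + 1 is the exterior degree, in the form given by `sum_wedge_contr`.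
  have hlast : ((i + 1 : ℕ) : ℂ) • g p x =
      ∑ a, g p (wedge i (e a) (contr i (e.coord a) x)) := by
    rw [← map_sum, sum_wedge_contr, map_smul]
    rw [← Complex.coe_smul]
    simp
  rw [hlast]
  have h1 : kosz e X A i (eulerContr e i g) p x =
      ∑ a, ∑ c, (A a (g (pderiv c p) (wedge i (e c) (contr i (e.coord a) x))) -
        g (X a * pderiv c p) (wedge i (e c) (contr i (e.coord a) x))) -
      ∑ a, g p (wedge i (e a) (contr i (e.coord a) x)) := by
    rw [kosz_apply, ← Finset.sum_sub_distrib]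
    refine Finset.sum_congr rfl fun a _ => ?_
    rw [eulerContr_apply, eulerContr_apply, map_sum, ← Finset.sum_sub_distrib]
    have : g p (wedge i (e a) (contr i (e.coord a) x)) =
        ∑ c, (if a = c then g p (wedge i (e c) (contr i (e.coord a) x)) else 0) := by simp
    rw [this, ← Finset.sum_sub_distrib]
    refine Finset.sum_congr rfl fun c _ => ?_
    rw [hd, map_add, LinearMap.add_apply]
    split_ifs <;> try simp only [map_zero, LinearMap.zero_apply]
    all_goals abel
  have h2 : eulerContr e (i + 1) (kosz e X A (i + 1) g) p x =
      ∑ a, (A a (g (pderiv a p) x) - g (X a * pderiv a p) x) -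
      ∑ a, ∑ c, (A a (g (pderiv c p) (wedge i (e c) (contr i (e.coord a) x))) -
        g (X a * pderiv c p) (wedge i (e c) (contr i (e.coord a) x))) := by
    rw [eulerContr_apply]
    simp only [kosz_apply]
    rw [Finset.sum_comm, ← Finset.sum_sub_distrib]
    refine Finset.sum_congr rfl fun a _ => ?_
    have : A a (g (pderiv a p) x) - g (X a * pderiv a p) x =
        ∑ c, (if a = c then A a (g (pderiv c p) x) - g (X a * pderiv c p) x else 0) := by simp
    rw [this, ← Finset.sum_sub_distrib]
    refine Finset.sum_congr rfl fun c _ => ?_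
    rw [hc]
    split_ifs <;> simp <;> abel
  rw [eulerLie, LinearMap.add_apply, LinearMap.add_apply, h1, h2, map_sum, LinearMap.sum_apply,
    Finset.sum_sub_distrib]
  abel

theorem sum_X_mul_pderiv_monomial (m : σ →₀ ℕ) :
    ∑ a, X a * pderiv a (monomial m (1 : ℂ)) = (m.degree : ℂ) • monomial m 1 := by
  have h (a : σ) : X a * pderiv a (monomial m (1 : ℂ)) = (m a : ℂ) • monomial m 1 := by
    rw [X_mul_pderiv_monomial, Nat.cast_smul_eq_nsmul]
  rw [Finset.sum_congr rfl fun a _ => h a, ← Finset.sum_smul, Finsupp.degree_eq_sum]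
  simp

omit [Fintype σ] in
theorem degree_sub_single {m : σ →₀ ℕ} {a : σ} (h : m a ≠ 0) :
    (m - Finsupp.single a 1).degree < m.degree := by
  have : m - Finsupp.single a 1 + Finsupp.single a 1 = m := by
    apply tsub_add_cancel_of_le
    rw [Finsupp.single_le_iff]
    lia
  have h2 := congrArg Finsupp.degree this
  rw [map_add, Finsupp.degree_single] at h2
  lia

theorem eulerLie_monomial (i : ℕ) (g : MvPolynomial σ ℂ →ₗ[ℂ] (⋀[ℝ]^(i + 1) V →ₗ[ℝ] Y))
    (m : σ →₀ ℕ) :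
    eulerLie e A i g (monomial m 1) =
      ∑ a, (m a : ℂ) • postMap (A a) (g (monomial (m - Finsupp.single a 1) 1)) -
      ((m.degree + (i + 1) : ℕ) : ℂ) • g (monomial m 1) := by
  refine LinearMap.ext fun x => ?_
  rw [eulerLie_apply, sum_X_mul_pderiv_monomial]
  have h (a : σ) : pderiv a (monomial m (1 : ℂ)) =
      (m a : ℂ) • monomial (m - Finsupp.single a 1) 1 := by
    rw [pderiv_monomial, one_mul, smul_monomial, smul_eq_mul, mul_one]
  simp only [h, map_smul, LinearMap.smul_apply, LinearMap.sub_apply, LinearMap.sum_apply,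
    postMap_apply, Nat.cast_add, add_smul, LinearMap.add_apply]
  abel

/-- On monomials the operator is triangular with respect to degree, with diagonal entry −(deg + i +
1), which is never zero. -/
theorem eulerLie_injective (i : ℕ) (g : MvPolynomial σ ℂ →ₗ[ℂ] (⋀[ℝ]^(i + 1) V →ₗ[ℝ] Y))
    (h : eulerLie e A i g = 0) : g = 0 := by
  have key : ∀ n : ℕ, ∀ m : σ →₀ ℕ, m.degree = n → g (monomial m 1) = 0 := by
    intro n
    induction n using Nat.strong_induction_on with
    | _ n ih =>
      intro m hm
      have h1 := eulerLie_monomial e A i g m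
      rw [h, LinearMap.zero_apply, Finset.sum_eq_zero, zero_sub, eq_comm, neg_eq_zero,
        smul_eq_zero] at h1
      · refine h1.resolve_left ?_
        exact_mod_cast (by lia : m.degree + (i + 1) ≠ 0)
      · intro a _
        by_cases ha : m a = 0
        · simp [ha]
        · rw [ih _ (hm ▸ degree_sub_single ha) _ rfl]; simp
  refine (MvPolynomial.basisMonomials σ ℂ).ext fun m => ?_
  simpa using key _ m rfl

/-- The solution of `eulerLie e A i g = F`, on monomials. -/
noncomputable def eulerSol (i : ℕ) (F : MvPolynomial σ ℂ →ₗ[ℂ] (⋀[ℝ]^(i + 1) V →ₗ[ℝ] Y))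
    (m : σ →₀ ℕ) : ⋀[ℝ]^(i + 1) V →ₗ[ℝ] Y :=
  ((m.degree + (i + 1) : ℕ) : ℂ)⁻¹ • (∑ a, (if _h : m a = 0 then 0 else
    (m a : ℂ) • postMap (A a) (eulerSol i F (m - Finsupp.single a 1))) - F (monomial m 1))
termination_by m.degree
decreasing_by exact degree_sub_single _h

/-- The same triangular system, solved degree by degree by `eulerSol`. -/
theorem eulerLie_surjective (i : ℕ) (F : MvPolynomial σ ℂ →ₗ[ℂ] (⋀[ℝ]^(i + 1) V →ₗ[ℝ] Y)) :
    ∃ g, eulerLie e A i g = F := by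
  refine ⟨(MvPolynomial.basisMonomials σ ℂ).constr ℂ (eulerSol A i F), ?_⟩
  refine (MvPolynomial.basisMonomials σ ℂ).ext fun m => ?_
  have hg (m : σ →₀ ℕ) : (MvPolynomial.basisMonomials σ ℂ).constr ℂ (eulerSol A i F)
      (monomial m 1) = eulerSol A i F m := by
    have := (MvPolynomial.basisMonomials σ ℂ).constr_basis ℂ (eulerSol A i F) m
    rwa [MvPolynomial.coe_basisMonomials] at this
  rw [MvPolynomial.coe_basisMonomials, eulerLie_monomial]
  simp only [hg]
  have hne : ((m.degree + (i + 1) : ℕ) : ℂ) ≠ 0 := by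
    exact_mod_cast (by lia : m.degree + (i + 1) ≠ 0)
  conv_lhs => rhs; rw [eulerSol, smul_inv_smul₀ hne]
  rw [sub_eq_iff_eq_add, add_sub_cancel]
  refine Finset.sum_congr rfl fun a _ => ?_
  split_ifs with h
  · simp [h]
  · rfl

/-- Put L = dι + ιd, where ι is the Euler contraction, and solve L G = F. Then 0 = dF = dιdG =
L(dG), so dG = 0 by injectivity of L, and F = d(ιG). -/
theorem kosz_exact (hA : ∀ a c y, A a (A c y) = A c (A a y)) (i : ℕ)
    (F : MvPolynomial σ ℂ →ₗ[ℂ] (⋀[ℝ]^(i + 1) V →ₗ[ℝ] Y)) (hF : kosz e X A (i + 1) F = 0) :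
    ∃ G, kosz e X A i G = F := by
  obtain ⟨G, hG⟩ := eulerLie_surjective e A i F
  have hX : ∀ a c : σ, (X a * X c : MvPolynomial σ ℂ) = X c * X a := fun a c => mul_comm _ _
  have h1 : kosz e X A (i + 1) G = 0 := by
    apply eulerLie_injective e A (i + 1)
    have h2 := hF
    rw [← hG, eulerLie, map_add, kosz_kosz e X A hX hA, zero_add] at h2
    rw [eulerLie, h2, kosz_kosz e X A hX hA, zero_add]
    refine LinearMap.ext fun p => LinearMap.ext fun x => ?_
    rw [eulerContr_apply]
    simp
  refine ⟨eulerContr e i G, ?_⟩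
  rw [← hG, eulerLie, h1]
  refine LinearMap.ext fun p => LinearMap.ext fun x => ?_
  simp [eulerContr_apply]

end PolyKoszul

open RootPairing.weylGroup (ofIdx)

/-! ### Functoriality of exterior powers and the invariant tensor of dual bases. -/

section ExtMap

variable {V : Type*} [AddCommGroup V] [Module ℝ V]

theorem extMap_id (i : ℕ) : extMap i (LinearMap.id : V →ₗ[ℝ] V) = LinearMap.id := by
  refine LinearMap.ext fun x => Subtype.ext ?_
  rw [coe_extMap, ExteriorAlgebra.map_id]
  rfl

theorem extMap_comp (i : ℕ) (f g : V →ₗ[ℝ] V) (x : ⋀[ℝ]^i V) :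
    extMap i (f ∘ₗ g) x = extMap i f (extMap i g x) := by
  apply Subtype.ext
  rw [coe_extMap, coe_extMap, coe_extMap, ← ExteriorAlgebra.map_comp_map]
  rfl

/-- Applied to −w₀, this is the sign that later cancels the sign of the Euler characteristic. -/
theorem extMap_neg (i : ℕ) (f : V →ₗ[ℝ] V) : extMap i (-f) = (-1 : ℝ) ^ i • extMap i f := by
  have key : ∀ i : ℕ, ∀ x ∈ ⋀[ℝ]^i V, ExteriorAlgebra.map (-f) x =
      (-1 : ℝ) ^ i • ExteriorAlgebra.map f x := by
    intro i
    induction i with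
    | zero =>
      intro x hx
      rw [ExteriorAlgebra.exteriorPower, pow_zero] at hx
      obtain ⟨r, rfl⟩ := Submodule.mem_one.mp hx
      rw [AlgHom.commutes, AlgHom.commutes, pow_zero, one_smul]
    | succ i ih =>
      intro x hx
      rw [ExteriorAlgebra.exteriorPower, pow_succ'] at hx
      induction hx using Submodule.mul_induction_on' with
      | mem_mul_mem m hm y hy =>
        obtain ⟨v, rfl⟩ := hm
        rw [map_mul, map_mul, ih y hy, ExteriorAlgebra.map_apply_ι, ExteriorAlgebra.map_apply_ι,
          LinearMap.neg_apply, map_neg, neg_mul, mul_smul_comm, pow_succ', neg_one_mul, neg_smul]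
      | add x _ y _ hx hy => rw [map_add, map_add, hx, hy, smul_add]
  refine LinearMap.ext fun x => Subtype.ext ?_
  exact key i x x.2

/-- The tensor Σ e_a ⊗ e^a does not depend on the basis, hence it is invariant under invertible
maps. -/
theorem sum_dual_basis {Y : Type*} [AddCommGroup Y] [Module ℝ Y] {σ : Type} [Fintype σ]
    (e : Module.Basis σ ℝ V) (D : V →ₗ[ℝ] Module.Dual ℝ V →ₗ[ℝ] Y) (g g' : V →ₗ[ℝ] V)
    (hg : ∀ v, g (g' v) = v) :
    ∑ a, D (g (e a)) (e.coord a ∘ₗ g') = ∑ a, D (e a) (e.coord a) := by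
  have h (a : σ) : D (g (e a)) (e.coord a ∘ₗ g') =
      ∑ c, D (e c) (e.coord c (g (e a)) • (e.coord a ∘ₗ g')) := by
    conv_lhs => rw [← e.sum_repr (g (e a))]
    simp only [map_sum, map_smul, LinearMap.sum_apply, LinearMap.smul_apply,
      Module.Basis.coord_apply]
  rw [Finset.sum_congr rfl fun a _ => h a, Finset.sum_comm]
  refine Finset.sum_congr rfl fun c _ => ?_
  rw [← map_sum]
  congr 1
  ext v
  simp only [LinearMap.sum_apply, LinearMap.smul_apply, LinearMap.comp_apply, smul_eq_mul]
  conv_rhs => rw [← hg v, ← e.sum_repr (g' v)]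
  simp only [map_sum, map_smul, smul_eq_mul, Module.Basis.coord_apply]
  exact Finset.sum_congr rfl fun a _ => mul_comm _ _

end ExtMap

/-! ### Modules coinduced from the Weyl group. -/

section Coinduced

variable {ι V₀ N : Type u} [AddCommGroup V₀] [Module ℝ V₀] [AddCommGroup N] [Module ℝ N]
  {P : RootPairing ι ℝ V₀ N} {b : P.Base}
  (k : Parameter b) {U : Type u} [AddCommGroup U] [Module ℂ U] (ρ : Representation ℂ P.weylGroup U)

/-- The module coinduced to the graded Hecke algebra from a representation of the Weyl group. -/
def coind : Submodule ℂ (Hecke k →ₗ[ℂ] U) where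
  carrier := {f | ∀ w h, f (Hecke.t k w * h) = ρ w (f h)}
  zero_mem' := by simp
  add_mem' hf hg w h := by
    simp only [LinearMap.add_apply, hf w h, hg w h, map_add]
  smul_mem' c f hf w h := by
    simp only [LinearMap.smul_apply, hf w h, map_smul]

variable {k ρ}

theorem coind_t_mul (f : coind k ρ) (w : P.weylGroup) (h : Hecke k) :
    f.1 (Hecke.t k w * h) = ρ w (f.1 h) := f.2 w h

noncomputable instance : SMul (Hecke k) (coind k ρ) where
  smul h f := ⟨f.1 ∘ₗ LinearMap.mulRight ℂ h, fun w h' => by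
    simp only [LinearMap.comp_apply, LinearMap.mulRight_apply, mul_assoc]
    exact f.2 w _⟩

@[simp] theorem coind_smul_apply (h : Hecke k) (f : coind k ρ) (x : Hecke k) :
    (h • f).1 x = f.1 (x * h) := rfl

/-- The module structure, over the additive group underlying the submodule. -/
noncomputable instance : @Module (Hecke k) (coind k ρ) _ (coind k ρ).addCommGroup.toAddCommMonoid where
  one_smul f := by apply Subtype.ext; ext x; simp
  mul_smul h h' f := by apply Subtype.ext; ext x; simp [mul_assoc]
  smul_zero h := by apply Subtype.ext; ext x; simp
  smul_add h f g := by apply Subtype.ext; ext x; simp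
  add_smul h h' f := by apply Subtype.ext; ext x; simp [mul_add]
  zero_smul f := by apply Subtype.ext; ext x; simp

instance : IsScalarTower ℂ (Hecke k) (coind k ρ) where
  smul_assoc c h f := by apply Subtype.ext; ext x; simp

/-- Evaluation at one. -/
noncomputable def coindEval : coind k ρ →ₗ[ℂ] U where
  toFun f := f.1 1
  map_add' _ _ := rfl
  map_smul' _ _ := rfl

variable {M : Type u} [AddCommGroup M] [Module ℂ M] [Module (Hecke k) M]
  [IsScalarTower ℂ (Hecke k) M]

/-- Frobenius reciprocity for coinduced modules. -/
noncomputable def coindLift (φ : M →ₗ[ℂ] U) (hφ : ∀ w m, φ (Hecke.t k w • m) = ρ w (φ m)) :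
    M →ₗ[Hecke k] coind k ρ where
  toFun m := ⟨{ toFun := fun h => φ (h • m)
                map_add' := fun h h' => by rw [add_smul, map_add]
                map_smul' := fun c h => by rw [smul_assoc, map_smul]; rfl }, fun w h => by
      simp only [LinearMap.coe_mk, AddHom.coe_mk, mul_smul, hφ]⟩
  map_add' m m' := by apply Subtype.ext; ext h; simp
  map_smul' h m := by apply Subtype.ext; ext x; simp [mul_smul]

omit [Module ℂ M] [IsScalarTower ℂ (Hecke k) M] in
theorem coind_hom_apply (g : M →ₗ[Hecke k] coind k ρ) (m : M) (h : Hecke k) :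
    (g m).1 h = (g (h • m)).1 1 := by simp

variable [Finite ι] [P.IsCrystallographic] [P.IsReduced]

/-- By Frobenius reciprocity it suffices to extend a W-equivariant map along an inclusion. Extend it
linearly and average over the finite group W. -/
theorem coind_injective : CategoryTheory.Injective (ModuleCat.of (Hecke k) (coind k ρ)) := by
  have hfin : Finite P.weylGroup := finite_weylGroup b
  have := Fintype.ofFinite P.weylGroup
  constructor
  intro X Y g m hm
  have hinj : Function.Injective m.hom := (ModuleCat.mono_iff_injective m).mp hm
  let _ : Module ℂ X := Module.compHom X (algebraMap ℂ (Hecke k))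
  let _ : Module ℂ Y := Module.compHom Y (algebraMap ℂ (Hecke k))
  have : IsScalarTower ℂ (Hecke k) X := ⟨fun c h x => by
    rw [Algebra.smul_def, mul_smul]; rfl⟩
  have : IsScalarTower ℂ (Hecke k) Y := ⟨fun c h x => by
    rw [Algebra.smul_def, mul_smul]; rfl⟩
  let m' : X →ₗ[ℂ] Y := m.hom.restrictScalars ℂ
  let g' : X →ₗ[Hecke k] coind k ρ := g.hom
  -- This retraction is only ℂ-linear; the average below restores equivariance.
  obtain ⟨r, hr⟩ := m'.exists_leftInverse_of_injective (LinearMap.ker_eq_bot.mpr hinj)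
  let φ₀ : Y →ₗ[ℂ] U := coindEval ∘ₗ (g'.restrictScalars ℂ) ∘ₗ r
  let φ : Y →ₗ[ℂ] U := (Fintype.card P.weylGroup : ℂ)⁻¹ •
    ∑ w : P.weylGroup, ρ w ∘ₗ φ₀ ∘ₗ Algebra.lsmul ℂ ℂ Y (Hecke.t k w⁻¹)
  have hφ : ∀ w y, φ (Hecke.t k w • y) = ρ w (φ y) := by
    intro w y
    simp only [φ, LinearMap.smul_apply, LinearMap.sum_apply, LinearMap.comp_apply, map_smul,
      map_sum, Algebra.lsmul_coe]
    congr 1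
    refine Fintype.sum_equiv (Equiv.mulLeft w⁻¹) _ _ fun v => ?_
    simp only [Equiv.coe_mulLeft, ← mul_smul, ← Hecke.t_mul, mul_inv_rev, inv_inv]
    rw [← Module.End.mul_apply (ρ w), ← map_mul, mul_inv_cancel_left]
  refine ⟨ModuleCat.ofHom (coindLift φ hφ), ?_⟩
  refine ModuleCat.hom_ext (LinearMap.ext fun x => Subtype.ext (LinearMap.ext fun h => ?_))
  change φ (h • m.hom x) = (g' x).1 h
  rw [← map_smul, coind_hom_apply]
  have hr' : ∀ x, r (m.hom x) = x := fun x => LinearMap.congr_fun hr x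
  simp only [φ, φ₀, LinearMap.smul_apply, LinearMap.sum_apply, LinearMap.comp_apply,
    Algebra.lsmul_coe, ← map_smul m.hom, hr', LinearMap.restrictScalars_apply]
  have hterm (w : P.weylGroup) : ρ w (coindEval (g' (Hecke.t k w⁻¹ • h • x))) =
      (g' (h • x)).1 1 := by
    change ρ w ((g' (Hecke.t k w⁻¹ • h • x)).1 1) = _
    rw [← coind_t_mul, mul_one, coind_hom_apply, ← mul_smul, ← Hecke.t_mul, mul_inv_cancel,
      Hecke.t_one, one_smul]
  rw [Finset.sum_congr rfl fun w _ => hterm w, Finset.sum_const, Finset.card_univ,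
    ← Nat.cast_smul_eq_nsmul ℂ, smul_smul, inv_mul_cancel₀, one_smul]
  exact_mod_cast Fintype.card_ne_zero

variable {σ : Type} (e : Module.Basis σ ℝ V₀)

/-- By the PBW theorem ℍ is generated by the polynomials as a left ℂ[W]-module. -/
theorem coind_ext_poly {f g : coind k ρ}
    (h : ∀ p, f.1 (polyHom e k p) = g.1 (polyHom e k p)) : f = g := by
  apply Subtype.ext
  have : f.1 ∘ₗ (pbwEquiv e k).toLinearMap = g.1 ∘ₗ (pbwEquiv e k).toLinearMap := by
    refine Finsupp.lhom_ext fun w p => ?_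
    simp only [LinearMap.comp_apply, LinearEquiv.coe_coe]
    erw [pbwEquiv_single]
    rw [coind_t_mul, coind_t_mul, h]
  ext x
  obtain ⟨y, rfl⟩ := (pbwEquiv e k).surjective x
  exact LinearMap.congr_fun this y

/-- By the PBW theorem ℍ is free over ℂ[W] on a basis of the polynomials, so values on polynomials
may be prescribed. With `coind_ext_poly` this identifies the coinduced module with Hom(S(V), U). -/
theorem exists_coind_poly (G : MvPolynomial σ ℂ →ₗ[ℂ] U) :
    ∃ f : coind k ρ, ∀ p, f.1 (polyHom e k p) = G p := by
  let F : RegSpace P σ →ₗ[ℂ] U := Finsupp.lsum ℂ fun w => ρ w ∘ₗ G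
  have hF (w : P.weylGroup) (p : MvPolynomial σ ℂ) : F (Finsupp.single w p) = ρ w (G p) := by
    simp [F]
  have hT (u : P.weylGroup) : F ∘ₗ regT u = ρ u ∘ₗ F := by
    refine Finsupp.lhom_ext fun w p => ?_
    simp only [LinearMap.comp_apply]
    erw [regT_single, hF, hF]
    rw [map_mul]
    rfl
  refine ⟨⟨F ∘ₗ (pbwEquiv e k).symm.toLinearMap, fun w h => ?_⟩, fun p => ?_⟩
  · simp only [LinearMap.comp_apply, LinearEquiv.coe_coe, pbwEquiv_symm_t_mul]
    exact LinearMap.congr_fun (hT w) _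
  · simp only [LinearMap.comp_apply, LinearEquiv.coe_coe]
    have : polyHom e k p = pbwEquiv e k (Finsupp.single 1 p) := by
      rw [pbwEquiv_single, Hecke.t_one, one_mul]
    rw [this, LinearEquiv.symm_apply_apply, hF, map_one]
    rfl

end Coinduced

open CategoryTheory Abelian

/-! ### Traces in exact sequences. -/

section TraceExact

variable {K U V W : Type*} [Field K] [AddCommGroup U] [Module K U] [AddCommGroup V] [Module K V]
  [AddCommGroup W] [Module K W] [Module.Finite K V]

theorem trace_add_of_exact (i : U →ₗ[K] V) (p : V →ₗ[K] W) (hi : Function.Injective i)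
    (hp : Function.Surjective p) (hip : Function.Exact i p) (fU : Module.End K U)
    (fV : Module.End K V) (fW : Module.End K W) (h1 : ∀ x, i (fU x) = fV (i x))
    (h2 : ∀ x, p (fV x) = fW (p x)) :
    LinearMap.trace K V fV = LinearMap.trace K U fU + LinearMap.trace K W fW := by
  have : Module.Finite K U := Module.Finite.of_injective i hi
  have : Module.Finite K W := Module.Finite.of_surjective p hp
  obtain ⟨s, hs⟩ := p.exists_rightInverse_of_surjective (LinearMap.range_eq_top.mpr hp)
  have hs' (w : W) : p (s w) = w := LinearMap.congr_fun hs w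
  obtain ⟨r, hr⟩ := i.exists_leftInverse_of_injective (LinearMap.ker_eq_bot.mpr hi)
  have hr' (u : U) : r (i u) = u := LinearMap.congr_fun hr u
  set q : V →ₗ[K] V := LinearMap.id - s ∘ₗ p with hq
  have hqr (v : V) : i (r (q v)) = q v := by
    obtain ⟨u, hu⟩ := (hip (q v)).mp (by simp [hq, hs'])
    rw [← hu, hr']
  -- Each summand factors through an end of the sequence, and cyclicity of the trace moves it there.
  have hdec : fV = i ∘ₗ (fU ∘ₗ r ∘ₗ q) + (fV ∘ₗ s) ∘ₗ p := by
    ext v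
    simp only [LinearMap.add_apply, LinearMap.comp_apply, h1, hqr]
    simp [hq]
  have e1 : (fU ∘ₗ r ∘ₗ q) ∘ₗ i = fU := by
    ext u
    have : p (i u) = 0 := (hip _).mpr ⟨u, rfl⟩
    simp [hq, this, hr']
  have e2 : p ∘ₗ (fV ∘ₗ s) = fW := by
    ext w
    simp [h2, hs']
  calc LinearMap.trace K V fV
      = LinearMap.trace K V (i ∘ₗ (fU ∘ₗ r ∘ₗ q)) + LinearMap.trace K V ((fV ∘ₗ s) ∘ₗ p) := by
        rw [← map_add, ← hdec]
    _ = _ := by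
        rw [← LinearMap.trace_comp_comm' i, ← LinearMap.trace_comp_comm' (fV ∘ₗ s) p, e1, e2]

omit [Module.Finite K V] in
theorem trace_eq_of_equiv (e : U ≃ₗ[K] V) (fU : Module.End K U) (fV : Module.End K V)
    (h : ∀ x, e (fU x) = fV (e x)) : LinearMap.trace K U fU = LinearMap.trace K V fV := by
  rw [← LinearMap.trace_conj' fU e]
  congr 1
  ext v
  simp [LinearEquiv.conj_apply, h]

/-- Cut the sequence at the image of the middle map into two short exact sequences. -/
theorem trace_four_term {Z : Type*} [AddCommGroup Z] [Module K Z] [Module.Finite K W]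
    (i : U →ₗ[K] V) (p : V →ₗ[K] W) (δ : W →ₗ[K] Z) (hi : Function.Injective i)
    (hip : Function.Exact i p) (hpδ : Function.Exact p δ) (hδ : Function.Surjective δ)
    (fU : Module.End K U) (fV : Module.End K V) (fW : Module.End K W) (fZ : Module.End K Z)
    (h1 : ∀ x, i (fU x) = fV (i x)) (h2 : ∀ x, p (fV x) = fW (p x))
    (h3 : ∀ x, δ (fW x) = fZ (δ x)) :
    LinearMap.trace K U fU + LinearMap.trace K W fW =
      LinearMap.trace K V fV + LinearMap.trace K Z fZ := by
  have hK : ∀ x ∈ LinearMap.range p, fW x ∈ LinearMap.range p := by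
    rintro _ ⟨v, rfl⟩
    exact ⟨fV v, h2 v⟩
  have e1 := trace_add_of_exact i p.rangeRestrict hi p.surjective_rangeRestrict
    (fun v => by rw [← hip v, Subtype.ext_iff]; rfl) fU fV (fW.restrict hK) h1
    (fun v => Subtype.ext (h2 v))
  have e2 := trace_add_of_exact (LinearMap.range p).subtype δ Subtype.val_injective hδ
    (fun w => by rw [hpδ w]; simp) (fW.restrict hK) fW fZ (fun _ => rfl) h3
  rw [e1, e2, add_assoc]

end TraceExact

/-! ### The operator θ* on Ext and dimension shifting. -/

section TwistedExt

universe v w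

variable {C : Type u} [Category.{v} C] [Abelian C] [Linear ℂ C] [HasExt.{w} C] (F : C ⥤ C)
  [F.Additive] [F.Linear ℂ] [Limits.PreservesFiniteLimits F] [Limits.PreservesFiniteColimits F]
  {X : C} (τ : X ⟶ F.obj X)

/-- The operator on `Ext^n(X, M)` induced by an exact functor `F` and morphisms `X ⟶ F X` and
`F M ⟶ M`. -/
noncomputable def twOp {M : C} (s : F.obj M ⟶ M) (n : ℕ) : Module.End ℂ (Ext.{w} X M n) :=
  (Ext.mk₀ s).postcompOfLinear ℂ X (add_zero n) ∘ₗ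
    (Ext.mk₀ τ).precompOfLinear ℂ (F.obj M) (zero_add n) ∘ₗ F.mapExtLinearMap ℂ X M n

theorem twOp_apply {M : C} (s : F.obj M ⟶ M) (n : ℕ) (x : Ext.{w} X M n) :
    twOp F τ s n x = ((Ext.mk₀ τ).comp (x.mapExactFunctor F) (zero_add n)).comp (Ext.mk₀ s)
      (add_zero n) := rfl

theorem twOp_comp_mk₀ {M M' : C} (s : F.obj M ⟶ M) (s' : F.obj M' ⟶ M') (f : M ⟶ M')
    (hf : F.map f ≫ s' = s ≫ f) (n : ℕ) (x : Ext.{w} X M n) :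
    twOp F τ s' n (x.comp (Ext.mk₀ f) (add_zero n)) =
      (twOp F τ s n x).comp (Ext.mk₀ f) (add_zero n) := by
  rw [twOp_apply, twOp_apply, Ext.mapExactFunctor_comp, Ext.mapExactFunctor_mk₀]
  simp only [Ext.comp_assoc_of_third_deg_zero, Ext.mk₀_comp_mk₀, hf]

/-- The three twisting maps form a morphism from F(S) to S, and extension classes are natural, so
the long exact sequence is equivariant for θ*. -/
theorem twOp_comp_extClass {S : ShortComplex C} (hS : S.ShortExact) (s₁ : F.obj S.X₁ ⟶ S.X₁)
    (s₂ : F.obj S.X₂ ⟶ S.X₂) (s₃ : F.obj S.X₃ ⟶ S.X₃) (h₁ : F.map S.f ≫ s₂ = s₁ ≫ S.f)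
    (h₂ : F.map S.g ≫ s₃ = s₂ ≫ S.g) (n : ℕ) (x : Ext.{w} X S.X₃ n) :
    twOp F τ s₁ (n + 1) (x.comp hS.extClass rfl) =
      (twOp F τ s₃ n x).comp hS.extClass rfl := by
  let φ : S.map F ⟶ S := { τ₁ := s₁, τ₂ := s₂, τ₃ := s₃, comm₁₂ := h₁.symm, comm₂₃ := h₂.symm }
  have hnat := ShortComplex.ShortExact.extClass_naturality (hS.map_of_exact F) hS φ
  obtain ⟨E, hE, hnat'⟩ : ∃ E : Ext.{w} (F.obj S.X₃) (F.obj S.X₁) 1,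
      hS.extClass.mapExactFunctor F = E ∧
        E.comp (Ext.mk₀ s₁) (add_zero 1) = (Ext.mk₀ s₃).comp hS.extClass (zero_add 1) :=
    ⟨_, Ext.mapExactFunctor_extClass F hS, hnat⟩
  rw [twOp_apply, twOp_apply, Ext.mapExactFunctor_comp, hE,
    ← Ext.comp_assoc (Ext.mk₀ τ) (x.mapExactFunctor F) E (zero_add n) rfl (by lia),
    Ext.comp_assoc_of_third_deg_zero, hnat', Ext.comp_assoc_of_second_deg_zero]

theorem twOp_zero (M : C) (s : F.obj M ⟶ M) (f : X ⟶ M) :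
    twOp.{u, v, w} F τ s 0 (Ext.mk₀ f) = Ext.mk₀ (τ ≫ F.map f ≫ s) := by
  rw [twOp_apply, Ext.mapExactFunctor_mk₀, Ext.mk₀_comp_mk₀, Ext.mk₀_comp_mk₀, Category.assoc]

/-- The groups `Ext^n(X, M)` are finite-dimensional, zero for `n ≥ D`, and the alternating sum of
the traces of `twOp` is `r`. -/
structure HasTwistedEuler {M : C} (s : F.obj M ⟶ M) (D : ℕ) (r : ℂ) : Prop where
  finite : ∀ n, Module.Finite ℂ (Ext.{w} X M n)
  subsingleton : ∀ n, D ≤ n → Subsingleton (Ext.{w} X M n)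
  sum_trace : ∑ n ∈ Finset.range D, (-1) ^ n * LinearMap.trace ℂ _ (twOp.{u, v, w} F τ s n) = r

theorem hasTwistedEuler_of_isZero {M : C} (s : F.obj M ⟶ M) (hM : Limits.IsZero M) :
    HasTwistedEuler.{u, v, w} F τ s 0 0 := by
  have h (n : ℕ) : Subsingleton (Ext.{w} X M n) := by
    refine subsingleton_of_forall_eq 0 fun x => ?_
    rw [← Ext.comp_mk₀_id x, hM.eq_of_src (𝟙 M) 0, Ext.mk₀_zero, Ext.comp_zero]
  exact ⟨fun n => inferInstance, fun n _ => h n, by simp⟩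

/-- Injectivity of the middle term breaks the long exact sequence into a four-term sequence in
degrees 0 and 1 and isomorphisms Ext^n(X, X₃) ≅ Ext^{n+1}(X, X₁) for n ≥ 1. The shift of degree
gives the minus sign before r. -/
theorem HasTwistedEuler.shift {S : ShortComplex C} (hS : S.ShortExact)
    (s₁ : F.obj S.X₁ ⟶ S.X₁) (s₂ : F.obj S.X₂ ⟶ S.X₂) (s₃ : F.obj S.X₃ ⟶ S.X₃)
    (h₁ : F.map S.f ≫ s₂ = s₁ ≫ S.f) (h₂ : F.map S.g ≫ s₃ = s₂ ≫ S.g) [Injective S.X₂]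
    [Module.Finite ℂ (Ext.{w} X S.X₂ 0)] {D : ℕ} {r : ℂ}
    (h : HasTwistedEuler.{u, v, w} F τ s₃ D r) :
    HasTwistedEuler.{u, v, w} F τ s₁ (D + 1)
      (LinearMap.trace ℂ _ (twOp.{u, v, w} F τ s₂ 0) - r) := by
  have := hS.mono_f
  let δ (n : ℕ) : Ext.{w} X S.X₃ n →ₗ[ℂ] Ext.{w} X S.X₁ (n + 1) :=
    hS.extClass.postcompOfLinear ℂ X rfl
  have hδ (n : ℕ) (x) : δ n x = x.comp hS.extClass rfl := rfl
  let i : Ext.{w} X S.X₁ 0 →ₗ[ℂ] Ext.{w} X S.X₂ 0 :=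
    (Ext.mk₀ S.f).postcompOfLinear ℂ X (add_zero 0)
  let p : Ext.{w} X S.X₂ 0 →ₗ[ℂ] Ext.{w} X S.X₃ 0 :=
    (Ext.mk₀ S.g).postcompOfLinear ℂ X (add_zero 0)
  have hi : Function.Injective i := Ext.postcomp_mk₀_injective_of_mono X S.f
  have hsurj (n : ℕ) : Function.Surjective (δ n) := fun x =>
    Ext.covariant_sequence_exact₁ X hS x (Ext.eq_zero_of_injective _) rfl
  have hinj (n : ℕ) : Function.Injective (δ (n + 1)) := by
    rw [injective_iff_map_eq_zero]
    intro x hx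
    obtain ⟨y, rfl⟩ := Ext.covariant_sequence_exact₃ X hS x rfl hx
    rw [Ext.eq_zero_of_injective y, Ext.zero_comp]
  have hip : Function.Exact i p := fun y =>
    ⟨fun hy => Ext.covariant_sequence_exact₂ X hS y hy, by
      rintro ⟨x, rfl⟩
      change (x.comp (Ext.mk₀ S.f) (add_zero 0)).comp (Ext.mk₀ S.g) (add_zero 0) = 0
      rw [Ext.comp_assoc_of_third_deg_zero, Ext.mk₀_comp_mk₀, S.zero, Ext.mk₀_zero, Ext.comp_zero]⟩
  have hpδ : Function.Exact p (δ 0) := fun y =>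
    ⟨fun hy => Ext.covariant_sequence_exact₃ X hS y rfl hy, by
      rintro ⟨x, rfl⟩
      change (x.comp (Ext.mk₀ S.g) (add_zero 0)).comp hS.extClass rfl = 0
      rw [Ext.comp_assoc_of_second_deg_zero, hS.comp_extClass, Ext.comp_zero]⟩
  have hf3 := h.finite
  have h4 := trace_four_term i p (δ 0) hi hip hpδ (hsurj 0) (twOp.{u, v, w} F τ s₁ 0)
    (twOp.{u, v, w} F τ s₂ 0) (twOp.{u, v, w} F τ s₃ 0) (twOp.{u, v, w} F τ s₁ 1)
    (fun x => (twOp_comp_mk₀ F τ s₁ s₂ S.f h₁ 0 x).symm)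
    (fun x => (twOp_comp_mk₀ F τ s₂ s₃ S.g h₂ 0 x).symm)
    (fun x => (twOp_comp_extClass F τ hS s₁ s₂ s₃ h₁ h₂ 0 x).symm)
  have hshift (n : ℕ) : LinearMap.trace ℂ _ (twOp.{u, v, w} F τ s₁ (n + 2)) =
      LinearMap.trace ℂ _ (twOp.{u, v, w} F τ s₃ (n + 1)) :=
    (trace_eq_of_equiv (LinearEquiv.ofBijective (δ (n + 1)) ⟨hinj n, hsurj (n + 1)⟩) _ _
      (fun x => (twOp_comp_extClass F τ hS s₁ s₂ s₃ h₁ h₂ (n + 1) x).symm)).symm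
  have hvan (n : ℕ) (hn : D ≤ n) : Subsingleton (Ext.{w} X S.X₁ (n + 1)) := by
    have := h.subsingleton n hn
    exact (hsurj n).subsingleton
  have htr0 {M : C} (s : F.obj M ⟶ M) (n : ℕ) (hs : Subsingleton (Ext.{w} X M n)) :
      LinearMap.trace ℂ _ (twOp.{u, v, w} F τ s n) = 0 := by
    rw [Subsingleton.elim (twOp.{u, v, w} F τ s n) 0, map_zero]
  refine ⟨fun n => ?_, fun n hn => ?_, ?_⟩
  · cases n with
    | zero => exact Module.Finite.of_injective i hi
    | succ n => exact Module.Finite.of_surjective (δ n) (hsurj n)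
  · obtain ⟨m, rfl⟩ : ∃ m, n = m + 1 := ⟨n - 1, by lia⟩
    exact hvan m (by lia)
  · have hr := h.sum_trace
    cases D with
    -- Here only degree 0 is summed; the four-term sequence also involves Ext¹(X, X₁), which
    -- vanishes as a quotient of Ext⁰(X, X₃) = 0.
    | zero =>
      rw [htr0 s₃ 0 (h.subsingleton 0 le_rfl), htr0 s₁ 1 (hvan 0 le_rfl), add_zero, add_zero] at h4
      simp only [Finset.range_zero, Finset.sum_empty] at hr
      simp [← hr, h4]
    | succ D =>
      rw [Finset.sum_range_succ'] at hr ⊢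
      rw [Finset.sum_range_succ', ← hr, ← sub_eq_zero]
      have : ∀ n, (-1 : ℂ) ^ (n + 1 + 1) * LinearMap.trace ℂ _ (twOp.{u, v, w} F τ s₁ (n + 1 + 1)) =
          -((-1 : ℂ) ^ (n + 1) * LinearMap.trace ℂ _ (twOp.{u, v, w} F τ s₃ (n + 1))) := by
        intro n
        rw [← hshift n]
        ring
      simp only [this, Finset.sum_neg_distrib]
      linear_combination h4

end TwistedExt

open RootPairing.weylGroup (ofIdx)

/-! ### The Koszul resolution by coinduced modules. -/

section Resolution

theorem sum_extMap_contr {V Y : Type*} [AddCommGroup V] [Module ℝ V] [AddCommGroup Y] [Module ℂ Y]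
    {σ : Type} [Fintype σ] (e : Module.Basis σ ℝ V) (i : ℕ) (D : V →ₗ[ℝ] ⋀[ℝ]^i V →ₗ[ℝ] Y)
    (g : V →ₗ[ℝ] V) (hg : ∀ v, g (g v) = v) (x : ⋀[ℝ]^(i + 1) V) :
    ∑ a, D (g (e a)) (extMap i g (contr i (e.coord a) x)) =
      ∑ a, D (e a) (contr i (e.coord a) (extMap (i + 1) g x)) := by
  have h (a : σ) : extMap i g (contr i (e.coord a) x) =
      contr i (e.coord a ∘ₗ g) (extMap (i + 1) g x) := by
    rw [extMap_contr]
    have : (e.coord a ∘ₗ g) ∘ₗ g = e.coord a := by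
      refine LinearMap.ext fun v => ?_
      rw [LinearMap.comp_apply, LinearMap.comp_apply, hg]
    rw [this]
  simp only [h]
  let c : Module.Dual ℝ V →ₗ[ℝ] ⋀[ℝ]^i V :=
    { toFun := fun ξ => contr i ξ (extMap (i + 1) g x)
      map_add' := fun ξ η => by rw [contr_add]; rfl
      map_smul' := fun r ξ => by rw [contr_smul]; rfl }
  exact sum_dual_basis e (D.compl₂ c) g g hg

variable {ι V₀ N : Type u} [AddCommGroup V₀] [Module ℝ V₀] [AddCommGroup N] [Module ℝ N]
  {P : RootPairing ι ℝ V₀ N} {b : P.Base}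

theorem weylAct_tmul (w : P.weylGroup) (v : V₀) :
    weylAct w ((1 : ℂ) ⊗ₜ[ℝ] v) = (1 : ℂ) ⊗ₜ[ℝ] (P.weylGroupRootRep w v) := rfl

theorem corootForm_tmul (i : ι) (v : V₀) :
    corootForm P i ((1 : ℂ) ⊗ₜ[ℝ] v) = (P.coroot' i v : ℂ) := by
  simp [corootForm, Module.Dual.baseChange_apply_tmul]

theorem weylGroupRootRep_ofIdx (i : ι) (v : V₀) :
    P.weylGroupRootRep (ofIdx P i) v = v - P.coroot' i v • P.root i :=
  P.reflection_apply i v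

variable (k : Parameter b) (Y : Type u) [AddCommGroup Y] [Module ℂ Y] [Module (Hecke k) Y]
  [IsScalarTower ℂ (Hecke k) Y]

/-- The restriction of a module over the graded Hecke algebra to the Weyl group. -/
noncomputable def weylRestrict : Representation ℂ P.weylGroup Y where
  toFun w := Algebra.lsmul ℂ ℂ Y (Hecke.t k w)
  map_one' := by rw [Hecke.t_one, map_one]
  map_mul' w w' := by rw [Hecke.t_mul, map_mul]

/-- The Weyl group acting on alternating forms with values in `Y`. -/
noncomputable def formRep (i : ℕ) : Representation ℂ P.weylGroup (⋀[ℝ]^i V₀ →ₗ[ℝ] Y) where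
  toFun w := postMap (weylRestrict k Y w) ∘ₗ preMap (extMap i (P.weylGroupRootRep w⁻¹))
  map_one' := by
    refine LinearMap.ext fun φ => LinearMap.ext fun x => ?_
    simp only [LinearMap.comp_apply, postMap_apply, preMap_apply, map_one, inv_one,
      Module.End.one_apply]
    rw [Module.End.one_eq_id, extMap_id, LinearMap.id_apply]
  map_mul' w w' := by
    refine LinearMap.ext fun φ => LinearMap.ext fun x => ?_
    simp only [LinearMap.comp_apply, postMap_apply, preMap_apply, map_mul, mul_inv_rev,
      Module.End.mul_apply]
    rw [Module.End.mul_eq_comp, extMap_comp]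

variable {k Y}

theorem formRep_apply (i : ℕ) (w : P.weylGroup) (φ : ⋀[ℝ]^i V₀ →ₗ[ℝ] Y) (x : ⋀[ℝ]^i V₀) :
    formRep k Y i w φ x = Hecke.t k w • φ (extMap i (P.weylGroupRootRep w⁻¹) x) := rfl

variable (k) in
/-- The operators by which the elements of `V` act on `Y`. -/
noncomputable def vecAct {σ : Type} (e : Module.Basis σ ℝ V₀) (a : σ) : Module.End ℂ Y :=
  Algebra.lsmul ℂ ℂ Y (Hecke.f k ((1 : ℂ) ⊗ₜ[ℝ] e a))

/-- The bilinear form `v ↦ v f(h) - f(v h)`. -/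
noncomputable def vecComm (i : ℕ) (φ : ⋀[ℝ]^i V₀ →ₗ[ℝ] Y)
    (f : Hecke k →ₗ[ℂ] (⋀[ℝ]^i V₀ →ₗ[ℝ] Y)) (h : Hecke k) : V₀ →ₗ[ℝ] ⋀[ℝ]^i V₀ →ₗ[ℝ] Y where
  toFun v := postMap (Algebra.lsmul ℂ ℂ Y (Hecke.f k ((1 : ℂ) ⊗ₜ[ℝ] v))) φ -
    f (Hecke.f k ((1 : ℂ) ⊗ₜ[ℝ] v) * h)
  map_add' v v' := by
    refine LinearMap.ext fun x => ?_
    simp only [TensorProduct.tmul_add, Hecke.f_add, add_mul, map_add, LinearMap.add_apply,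
      LinearMap.sub_apply, postMap_apply, Algebra.lsmul_coe]
    abel
  map_smul' r v := by
    refine LinearMap.ext fun x => ?_
    have : (1 : ℂ) ⊗ₜ[ℝ] (r • v) = (r : ℂ) • ((1 : ℂ) ⊗ₜ[ℝ] v) := by
      rw [TensorProduct.smul_tmul', TensorProduct.tmul_smul, TensorProduct.smul_tmul']
      simp
    simp only [this, Hecke.f_smul, smul_mul_assoc, map_smul, LinearMap.smul_apply,
      LinearMap.sub_apply, postMap_apply, Algebra.lsmul_coe, RingHom.id_apply, smul_sub]
    simp only [Complex.coe_smul]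

theorem vecComm_apply (i : ℕ) (φ : ⋀[ℝ]^i V₀ →ₗ[ℝ] Y)
    (f : Hecke k →ₗ[ℂ] (⋀[ℝ]^i V₀ →ₗ[ℝ] Y)) (h : Hecke k) (v : V₀) (x : ⋀[ℝ]^i V₀) :
    vecComm i φ f h v x = Hecke.f k ((1 : ℂ) ⊗ₜ[ℝ] v) • φ x -
      f (Hecke.f k ((1 : ℂ) ⊗ₜ[ℝ] v) * h) x := rfl

variable {σ : Type} [Fintype σ] (e : Module.Basis σ ℝ V₀)

variable (k) in
/-- The vectors of a basis as elements of the graded Hecke algebra. -/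
noncomputable def vecElt (a : σ) : Hecke k := Hecke.f k ((1 : ℂ) ⊗ₜ[ℝ] e a)

theorem kosz_eq_vecComm (i : ℕ) (f : Hecke k →ₗ[ℂ] (⋀[ℝ]^i V₀ →ₗ[ℝ] Y)) (h : Hecke k)
    (x : ⋀[ℝ]^(i + 1) V₀) :
    kosz e (vecElt k e) (vecAct k e) i f h x =
      ∑ a, vecComm i (f h) f h (e a) (contr i (e.coord a) x) := by
  rw [kosz_apply]
  rfl

/-- Moving vectors past t_s yields the expected equivariant term and corrections proportional to
k_s. Summed over the basis, the corrections involve only the contraction with the coroot of s, which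
the reflection s fixes (`extMap_reflection_contr`), so they cancel. -/
theorem kosz_t_simple_mul (i : ℕ) (f : coind k (formRep k Y i)) (s : b.support) (h : Hecke k) :
    kosz e (vecElt k e) (vecAct k e) i f.1 (Hecke.t k (ofIdx P s) * h) =
      formRep k Y (i + 1) (ofIdx P s) (kosz e (vecElt k e) (vecAct k e) i f.1 h) := by
  refine LinearMap.ext fun x => ?_
  set g := P.weylGroupRootRep (ofIdx P s) with hgdef
  set c : ℂ := (k.val s : ℂ) with hc
  have hinv : (ofIdx P (s : ι))⁻¹ = ofIdx P s := inv_eq_of_mul_eq_one_left (ofIdx_mul_self _)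
  have hg (v : V₀) : g (g v) = v := by
    rw [hgdef, ← Module.End.mul_apply, ← map_mul, ofIdx_mul_self, map_one]
    rfl
  have hft (v : V₀) : Hecke.f k ((1 : ℂ) ⊗ₜ[ℝ] v) * Hecke.t k (ofIdx P s) =
      Hecke.t k (ofIdx P s) * Hecke.f k ((1 : ℂ) ⊗ₜ[ℝ] g v) +
        algebraMap ℂ (Hecke k) (c * (P.coroot' s v : ℂ)) := by
    rw [Hecke.f_mul_t, weylAct_tmul, corootForm_tmul]
  have key (v : V₀) (z : ⋀[ℝ]^i V₀) : vecComm i (f.1 (Hecke.t k (ofIdx P s) * h)) f.1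
      (Hecke.t k (ofIdx P s) * h) v z =
      Hecke.t k (ofIdx P s) • vecComm i (f.1 h) f.1 h (g v) (extMap i g z) +
        (c * (P.coroot' s v : ℂ)) • (f.1 h (extMap i g z) - f.1 h z) := by
    rw [vecComm_apply, vecComm_apply, ← mul_assoc, hft, add_mul, map_add, mul_assoc, coind_t_mul,
      coind_t_mul, LinearMap.add_apply, formRep_apply, formRep_apply, hinv, ← hgdef, ← mul_smul,
      hft, ← Algebra.smul_def, map_smul, add_smul, algebraMap_smul, smul_sub, smul_sub, mul_smul,
      LinearMap.smul_apply]
    abel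
  rw [kosz_eq_vecComm, formRep_apply, hinv, ← hgdef, kosz_eq_vecComm]
  simp only [key, Finset.sum_add_distrib, ← Finset.smul_sum]
  rw [sum_extMap_contr e i _ g hg, add_eq_left]
  -- The coroot expanded in the dual basis.
  have hsum : ∑ a, (P.coroot' s (e a)) • contr i (e.coord a) x = contr i (P.coroot' s) x := by
    have h1 : P.coroot' (s : ι) = ∑ a, P.coroot' s (e a) • e.coord a := by
      refine e.ext fun c => ?_
      classical
      simp [Finsupp.single_apply]
    conv_rhs => rw [h1, contr_sum]
    simp [contr_smul]
  have hz (a : σ) : (c * (P.coroot' s (e a) : ℂ)) •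
      (f.1 h (extMap i g (contr i (e.coord a) x)) - f.1 h (contr i (e.coord a) x)) =
      c • (f.1 h (extMap i g (P.coroot' s (e a) • contr i (e.coord a) x)) -
        f.1 h (P.coroot' s (e a) • contr i (e.coord a) x)) := by
    rw [mul_smul, map_smul, map_smul, map_smul, ← smul_sub]
    congr 1
  rw [Finset.sum_congr rfl fun a _ => hz a, ← Finset.smul_sum, Finset.sum_sub_distrib, ← map_sum,
    ← map_sum, ← map_sum, hsum, extMap_reflection_contr i (P.root s) (P.coroot' s) g
    (fun v => weylGroupRootRep_ofIdx _ v), sub_self, smul_zero]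

variable [Finite ι] [P.IsCrystallographic] [P.IsReduced]

theorem kosz_t_mul (i : ℕ) (f : coind k (formRep k Y i)) (w : P.weylGroup) (h : Hecke k) :
    kosz e (vecElt k e) (vecAct k e) i f.1 (Hecke.t k w * h) =
      formRep k Y (i + 1) w (kosz e (vecElt k e) (vecAct k e) i f.1 h) := by
  induction w using weyl_induction b generalizing h with
  | one => rw [Hecke.t_one, one_mul, map_one]; rfl
  | mul s hs w ih =>
    rw [Hecke.t_mul, mul_assoc, kosz_t_simple_mul e i f ⟨s, hs⟩, ih, map_mul]
    rfl

variable (k Y) in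
/-- The terms of the Koszul resolution of `Y` by coinduced modules. -/
noncomputable abbrev KoszulTerm (i : ℕ) : Type u := coind k (formRep k Y i)

/-- The differential of the Koszul resolution. -/
noncomputable def koszulD (i : ℕ) : KoszulTerm k Y i →ₗ[Hecke k] KoszulTerm k Y (i + 1) where
  toFun f := ⟨kosz e (vecElt k e) (vecAct k e) i f.1, kosz_t_mul e i f⟩
  map_add' f g := Subtype.ext (map_add _ _ _)
  map_smul' h f := by
    apply Subtype.ext
    refine LinearMap.ext fun x => LinearMap.ext fun y => ?_
    simp only [kosz_apply, coind_smul_apply, RingHom.id_apply, mul_assoc]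

theorem coe_koszulD (i : ℕ) (f : KoszulTerm k Y i) :
    (koszulD e i f).1 = kosz e (vecElt k e) (vecAct k e) i f.1 := rfl

theorem vecElt_comm (a c : σ) : vecElt k e a * vecElt k e c = vecElt k e c * vecElt k e a :=
  Hecke.f_comm k _ _

theorem vecAct_comm (a c : σ) (y : Y) :
    vecAct k e a (vecAct k e c y) = vecAct k e c (vecAct k e a y) := by
  change vecElt k e a • vecElt k e c • y = vecElt k e c • vecElt k e a • y
  rw [← mul_smul, vecElt_comm, mul_smul]

theorem koszulD_koszulD (i : ℕ) (f : KoszulTerm k Y i) : koszulD e (i + 1) (koszulD e i f) = 0 :=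
  Subtype.ext (by
    rw [coe_koszulD, coe_koszulD]
    exact kosz_kosz e _ _ (vecElt_comm e) (vecAct_comm e) i f.1)

theorem kosz_comp_polyHom (i : ℕ) (f : Hecke k →ₗ[ℂ] (⋀[ℝ]^i V₀ →ₗ[ℝ] Y)) :
    kosz e (vecElt k e) (vecAct k e) i f ∘ₗ (polyHom e k).toLinearMap =
      kosz e MvPolynomial.X (vecAct k e) i (f ∘ₗ (polyHom e k).toLinearMap) := by
  refine LinearMap.ext fun p => LinearMap.ext fun x => ?_
  rw [kosz_apply, LinearMap.comp_apply, kosz_apply]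
  simp only [LinearMap.comp_apply, AlgHom.toLinearMap_apply, map_mul, polyHom_X]
  rfl

/-- Restriction to polynomials turns the complex into the polynomial Koszul complex, and a
polynomial primitive lifts back to the coinduced module. -/
theorem koszulD_exact (i : ℕ) (f : KoszulTerm k Y (i + 1)) (hf : koszulD e (i + 1) f = 0) :
    ∃ g, koszulD e i g = f := by
  have h1 := kosz_comp_polyHom e (i + 1) f.1
  rw [← coe_koszulD, hf] at h1
  obtain ⟨G, hG⟩ := kosz_exact e (vecAct k e) (vecAct_comm e) i
    (f.1 ∘ₗ (polyHom e k).toLinearMap) h1.symm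
  obtain ⟨g, hg⟩ := exists_coind_poly (ρ := formRep k Y i) e G
  refine ⟨g, coind_ext_poly e fun p => ?_⟩
  have hg' : g.1 ∘ₗ (polyHom e k).toLinearMap = G := LinearMap.ext hg
  have h2 := kosz_comp_polyHom e i g.1
  rw [hg', hG] at h2
  exact LinearMap.congr_fun h2 p

/-- The scalar defined by an element of `⋀⁰`. -/
noncomputable def extScalar {V : Type*} [AddCommGroup V] [Module ℝ V] : ⋀[ℝ]^0 V →ₗ[ℝ] ℝ :=
  (ExteriorAlgebra.algebraMapInv (R := ℝ) (M := V)).toLinearMap ∘ₗ (⋀[ℝ]^0 V).subtype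

theorem extScalar_extMap {V : Type*} [AddCommGroup V] [Module ℝ V] (g : V →ₗ[ℝ] V)
    (x : ⋀[ℝ]^0 V) : extScalar (extMap 0 g x) = extScalar x := by
  change ExteriorAlgebra.algebraMapInv (ExteriorAlgebra.map g (x : ExteriorAlgebra ℝ V)) = _
  obtain ⟨x, hx⟩ := x
  rw [ExteriorAlgebra.exteriorPower, pow_zero] at hx
  obtain ⟨r, rfl⟩ := Submodule.mem_one.mp hx
  simp [extScalar]

/-- The unit of the exterior algebra. -/
def extOne {V : Type*} [AddCommGroup V] [Module ℝ V] : ⋀[ℝ]^0 V :=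
  ⟨1, by rw [ExteriorAlgebra.exteriorPower, pow_zero]; exact Submodule.one_le.mp le_rfl⟩

theorem extScalar_smul_extOne {V : Type*} [AddCommGroup V] [Module ℝ V] (x : ⋀[ℝ]^0 V) :
    extScalar x • extOne = x := by
  apply Subtype.ext
  obtain ⟨x, hx⟩ := x
  rw [ExteriorAlgebra.exteriorPower, pow_zero] at hx
  obtain ⟨r, rfl⟩ := Submodule.mem_one.mp hx
  simp [extScalar, extOne, Algebra.algebraMap_eq_smul_one]

theorem extScalar_extOne {V : Type*} [AddCommGroup V] [Module ℝ V] :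
    extScalar (extOne : ⋀[ℝ]^0 V) = 1 := by
  simp [extScalar, extOne]

variable (Y) in
/-- The constant forms. -/
noncomputable def constForm : Y →ₗ[ℂ] (⋀[ℝ]^0 V₀ →ₗ[ℝ] Y) where
  toFun y := (LinearMap.toSpanSingleton ℝ Y y) ∘ₗ extScalar
  map_add' y y' := by ext; simp
  map_smul' c y := by
    refine LinearMap.ext fun x => ?_
    simp [smul_comm c]

theorem constForm_apply (y : Y) (x : ⋀[ℝ]^0 V₀) : constForm Y y x = extScalar x • y := rfl

variable (k Y) in
/-- The augmentation of the Koszul resolution. -/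
noncomputable def koszulAug : Y →ₗ[Hecke k] KoszulTerm k Y 0 :=
  coindLift (constForm Y) fun w y => by
    refine LinearMap.ext fun x => ?_
    rw [formRep_apply, constForm_apply, constForm_apply, extScalar_extMap, smul_comm]

theorem koszulAug_apply (y : Y) (h : Hecke k) (x : ⋀[ℝ]^0 V₀) :
    (koszulAug k Y y).1 h x = extScalar x • h • y := rfl

theorem koszulAug_injective : Function.Injective (koszulAug k Y) := by
  rw [injective_iff_map_eq_zero]
  intro y hy
  have := koszulAug_apply y (1 : Hecke k) extOne
  rw [hy, extScalar_extOne, one_smul, one_smul] at this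
  exact this.symm

theorem koszulAug_exact : Function.Exact (koszulAug k Y) (koszulD e 0) := by
  intro f
  constructor
  · intro hf
    -- A cocycle of degree zero is linear over S(V), so it is determined by its value at 1.
    refine ⟨f.1 1 extOne, coind_ext_poly e fun p => ?_⟩
    have h0 : kosz e (vecElt k e) (vecAct k e) 0 f.1 = 0 := congrArg Subtype.val hf
    induction p using MvPolynomial.induction_on with
    | C c =>
      refine LinearMap.ext fun x => ?_
      rw [koszulAug_apply, MvPolynomial.algHom_C, algebraMap_smul, smul_comm,
        Algebra.algebraMap_eq_smul_one, map_smul, LinearMap.smul_apply, ← map_smul,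
        extScalar_smul_extOne]
    | add p q hp hq => simp only [map_add, hp, hq]
    | mul_X p a hp =>
      rw [mul_comm, map_mul, polyHom_X]
      have := kosz_zero_eq_zero e (vecElt k e) (vecAct k e) h0 a (polyHom e k p)
      rw [show Hecke.f k ((1 : ℂ) ⊗ₜ[ℝ] e a) = vecElt k e a from rfl, this, ← hp]
      refine LinearMap.ext fun x => ?_
      rw [postMap_apply, koszulAug_apply, koszulAug_apply, mul_smul,
        show vecAct k e a = Algebra.lsmul ℂ ℂ Y (vecElt k e a) from rfl, Algebra.lsmul_coe, smul_comm]
  · rintro ⟨y, rfl⟩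
    apply Subtype.ext
    refine LinearMap.ext fun h => LinearMap.ext fun x => ?_
    rw [coe_koszulD, kosz_apply]
    refine Finset.sum_eq_zero fun a _ => ?_
    rw [koszulAug_apply, koszulAug_apply, mul_smul]
    exact sub_eq_zero.mpr (smul_comm (vecElt k e a) _ _)

/-- This bounds the length of the resolution and hence the degrees in which Ext can be nonzero. -/
theorem subsingleton_koszulTerm [FiniteDimensional ℝ V₀] {i : ℕ}
    (hi : Module.finrank ℝ V₀ < i) : Subsingleton (KoszulTerm k Y i) := by
  have h1 : Subsingleton (⋀[ℝ]^i V₀) := by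
    rw [← Module.finrank_zero_iff (R := ℝ), exteriorPower.finrank_eq, Nat.choose_eq_zero_of_lt hi]
  refine ⟨fun f g => Subtype.ext (LinearMap.ext fun h => LinearMap.ext fun x => ?_)⟩
  rw [Subsingleton.elim x 0, map_zero, map_zero]

end Resolution

/-! ### Traces on spaces of linear maps and on invariants. -/

section Traces

variable {K : Type*} [Field K]

/-- Under Hom(X, U) ≅ X* ⊗ U the operator is the tensor product of the transpose of B with A. -/
theorem trace_comp_hom {X U : Type*} [AddCommGroup X] [Module K X] [AddCommGroup U] [Module K U]
    [Module.Finite K X] [Module.Finite K U] (A : Module.End K U) (B : Module.End K X)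
    (T : Module.End K (X →ₗ[K] U)) (hT : ∀ φ, T φ = A ∘ₗ φ ∘ₗ B) :
    LinearMap.trace K _ T = LinearMap.trace K U A * LinearMap.trace K X B := by
  have h : ∀ x, dualTensorHomEquiv K X U
      (TensorProduct.map (Module.Dual.transpose (R := K) B) A x) =
        T (dualTensorHomEquiv K X U x) := by
    intro x
    induction x with
    | zero => simp
    | add x y hx hy => simp only [map_add, hx, hy]
    | tmul ξ u =>
      ext v
      simp [hT, dualTensorHom_apply, Module.Dual.transpose_apply]
  have h' := trace_eq_of_equiv (U := Module.Dual K X ⊗[K] U) (V := X →ₗ[K] U)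
    (dualTensorHomEquiv K X U)
    (TensorProduct.map (Module.Dual.transpose (R := K) B) A) T h
  rw [← h', LinearMap.trace_tensorProduct',
    LinearMap.trace_transpose', mul_comm]

theorem trace_restrict_of_isProj {H : Type*} [AddCommGroup H] [Module K H] [Module.Finite K H]
    (S : Submodule K H) (p : Module.End K H) (hp : LinearMap.IsProj S p) (T : Module.End K H)
    (hT : ∀ x ∈ S, T x ∈ S) :
    LinearMap.trace K S (T.restrict hT) = LinearMap.trace K H (T ∘ₗ p) := by
  have h1 : T ∘ₗ p = (T ∘ₗ S.subtype) ∘ₗ hp.codRestrict := rfl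
  have h2 : hp.codRestrict ∘ₗ (T ∘ₗ S.subtype) = T.restrict hT := by
    ext x
    exact hp.map_id _ (hT x x.2)
  rw [h1, ← LinearMap.trace_comp_comm', h2]

/-- The average of the group elements is a projection onto the invariants. -/
theorem trace_restrict_invariants {G : Type*} [Group G] [Fintype G] {H : Type*} [AddCommGroup H]
    [Module ℂ H] [Module.Finite ℂ H] (ρ : Representation ℂ G H) (T : Module.End ℂ H)
    (hT : ∀ x ∈ ρ.invariants, T x ∈ ρ.invariants) :
    LinearMap.trace ℂ ρ.invariants (T.restrict hT) =
      (Fintype.card G : ℂ)⁻¹ * ∑ g, LinearMap.trace ℂ H (T ∘ₗ ρ g) := by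
  have : Invertible (Fintype.card G : ℂ) := invertibleOfNonzero (by
    exact_mod_cast Fintype.card_ne_zero)
  rw [trace_restrict_of_isProj _ _ ρ.isProj_averageMap, Representation.averageMap,
    GroupAlgebra.average]
  simp only [map_smul, map_sum, LinearMap.comp_smul, MonoidAlgebra.of_apply,
    Representation.asAlgebraHom_single_one, smul_eq_mul, invOf_eq_inv]
  congr 1
  have : T ∘ₗ ∑ g, ρ g = ∑ g, T ∘ₗ ρ g := by
    ext x
    simp
  rw [this, map_sum]

/-- Real linear maps to a complex space as complex linear maps on the complexification. -/
theorem trace_postMap_preMap {L Y : Type*} [AddCommGroup L] [Module ℝ L] [Module.Finite ℝ L]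
    [AddCommGroup Y] [Module ℂ Y] [Module.Finite ℂ Y] (A : Module.End ℂ Y) (c : Module.End ℝ L) :
    LinearMap.trace ℂ (L →ₗ[ℝ] Y) (postMap A ∘ₗ preMap c) =
      LinearMap.trace ℂ Y A * (LinearMap.trace ℝ L c : ℂ) := by
  let E : (L →ₗ[ℝ] Y) ≃ₗ[ℂ] (ℂ ⊗[ℝ] L →ₗ[ℂ] Y) := LinearMap.liftBaseChangeEquiv ℂ
  let T : Module.End ℂ (ℂ ⊗[ℝ] L →ₗ[ℂ] Y) :=
    { toFun := fun φ => A ∘ₗ φ ∘ₗ c.baseChange ℂ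
      map_add' := fun φ ψ => by ext; simp
      map_smul' := fun r φ => by ext; simp }
  rw [trace_eq_of_equiv E _ T, trace_comp_hom A (c.baseChange ℂ) T (fun _ => rfl),
    LinearMap.trace_baseChange]
  · rfl
  · intro φ
    refine TensorProduct.AlgebraTensorModule.ext fun z x => ?_
    simp [E, T]

theorem finite_forms {L Y : Type*} [AddCommGroup L] [Module ℝ L] [Module.Finite ℝ L]
    [AddCommGroup Y] [Module ℂ Y] [Module.Finite ℂ Y] : Module.Finite ℂ (L →ₗ[ℝ] Y) :=
  Module.Finite.equiv (LinearMap.liftBaseChangeEquiv ℂ : (L →ₗ[ℝ] Y) ≃ₗ[ℂ] _).symm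

end Traces

/-! ### The action of θ on the Koszul resolution. -/

section TwistedResolution

variable {ι V₀ N : Type u} [AddCommGroup V₀] [Module ℝ V₀] [AddCommGroup N] [Module ℝ N]
  {P : RootPairing ι ℝ V₀ N} {b : P.Base} [Finite ι] [P.IsCrystallographic] [P.IsReduced]
  {k : Parameter b}

theorem theta_theta (h : Hecke k) : theta k (theta k h) = h := by
  induction h using Hecke.induction with
  | algebraMap c => rw [AlgHom.commutes, AlgHom.commutes]
  | t w =>
    rw [theta_t, theta_t]
    congr 1
    rw [longest_inv, mul_assoc, mul_assoc, longest_mul_self, mul_one, ← mul_assoc,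
      longest_mul_self, one_mul]
  | f v =>
    rw [theta_f, theta_f, map_neg, neg_neg, ← weylAct_mul, longest_mul_self, weylAct_one]
  | mul x y hx hy => rw [map_mul, map_mul, hx, hy]
  | add x y hx hy => rw [map_add, map_add, hx, hy]

theorem theta_f_tmul (v : V₀) : theta k (Hecke.f k ((1 : ℂ) ⊗ₜ[ℝ] v)) =
    Hecke.f k ((1 : ℂ) ⊗ₜ[ℝ] (-P.weylGroupRootRep (longest b)) v) := by
  rw [theta_f, weylAct_tmul, ← TensorProduct.tmul_neg]
  rfl

theorem neg_longest_neg_longest (v : V₀) :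
    (-P.weylGroupRootRep (longest b)) ((-P.weylGroupRootRep (longest b)) v) = v := by
  rw [LinearMap.neg_apply, LinearMap.neg_apply, map_neg, neg_neg, ← Module.End.mul_apply, ← map_mul,
    longest_mul_self, map_one]
  rfl

variable (Y : TwistedModule k)

theorem smul_tw (h : Hecke k) (y : Y.carrier) : h • Y.tw y = Y.tw (theta k h • y) := by
  rw [Y.tw_smul, theta_theta]

/-- The operator on alternating forms with values in `Y` induced by `θ`. -/
noncomputable def formTwist (i : ℕ) : Module.End ℂ (⋀[ℝ]^i V₀ →ₗ[ℝ] Y.carrier) :=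
  postMap Y.tw ∘ₗ preMap (extMap i (-P.weylGroupRootRep (longest b)))

theorem formTwist_apply (i : ℕ) (φ : ⋀[ℝ]^i V₀ →ₗ[ℝ] Y.carrier) (x : ⋀[ℝ]^i V₀) :
    formTwist Y i φ x = Y.tw (φ (extMap i (-P.weylGroupRootRep (longest b)) x)) := rfl

/-- Both θ on Y and −w₀ on V₀ intertwine w with its conjugate by w₀. This lets the twist preserve
the coinduced modules. -/
theorem formTwist_formRep (i : ℕ) (w : P.weylGroup) (φ : ⋀[ℝ]^i V₀ →ₗ[ℝ] Y.carrier) :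
    formTwist Y i (formRep k Y.carrier i (longest b * w * (longest b)⁻¹) φ) =
      formRep k Y.carrier i w (formTwist Y i φ) := by
  refine LinearMap.ext fun x => ?_
  rw [formTwist_apply, formRep_apply, formRep_apply, formTwist_apply, smul_tw, theta_t,
    ← extMap_comp, ← extMap_comp]
  have h1 : (longest b * w * (longest b)⁻¹)⁻¹ * longest b = longest b * w⁻¹ := by
    rw [mul_inv_rev, mul_inv_rev, inv_inv, longest_inv, mul_assoc, mul_assoc, longest_mul_self,
      mul_one]
  have h2 : P.weylGroupRootRep (longest b * w * (longest b)⁻¹)⁻¹ ∘ₗ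
      (-P.weylGroupRootRep (longest b)) =
      (-P.weylGroupRootRep (longest b)) ∘ₗ P.weylGroupRootRep w⁻¹ := by
    rw [LinearMap.comp_neg, LinearMap.neg_comp, ← Module.End.mul_eq_comp, ← Module.End.mul_eq_comp,
      ← map_mul, ← map_mul, h1]
  rw [h2]

/-- The operator on the terms of the Koszul resolution induced by `θ`. -/
noncomputable def koszulTwist (i : ℕ) : KoszulTerm k Y.carrier i →+ KoszulTerm k Y.carrier i where
  toFun f := ⟨formTwist Y i ∘ₗ f.1 ∘ₗ (theta k).toLinearMap, fun w h => by
    simp only [LinearMap.comp_apply, AlgHom.toLinearMap_apply, map_mul, theta_t]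
    rw [coind_t_mul, formTwist_formRep]⟩
  map_zero' := by apply Subtype.ext; ext; simp
  map_add' f g := by apply Subtype.ext; ext; simp

theorem koszulTwist_apply (i : ℕ) (f : KoszulTerm k Y.carrier i) (h : Hecke k) :
    (koszulTwist Y i f).1 h = formTwist Y i (f.1 (theta k h)) := rfl

theorem koszulTwist_smul (i : ℕ) (h : Hecke k) (f : KoszulTerm k Y.carrier i) :
    koszulTwist Y i (theta k h • f) = h • koszulTwist Y i f := by
  apply Subtype.ext
  refine LinearMap.ext fun x => ?_
  rw [koszulTwist_apply, coind_smul_apply, coind_smul_apply, koszulTwist_apply, ← map_mul (theta k)]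

theorem koszulTwist_aug (y : Y.carrier) :
    koszulTwist Y 0 (koszulAug k Y.carrier y) = koszulAug k Y.carrier (Y.tw y) := by
  apply Subtype.ext
  refine LinearMap.ext fun h => LinearMap.ext fun x => ?_
  rw [koszulTwist_apply, formTwist_apply, koszulAug_apply, koszulAug_apply, extScalar_extMap,
    smul_tw, ← Complex.coe_smul, map_smul, Complex.coe_smul]

variable {σ : Type} [Fintype σ] (e : Module.Basis σ ℝ V₀)

/-- On V the automorphism θ is the involution −w₀, and the tensor Σ e_a ⊗ e^a defining the
differential is invariant under it. -/
theorem koszulTwist_koszulD (i : ℕ) (f : KoszulTerm k Y.carrier i) :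
    koszulD e i (koszulTwist Y i f) = koszulTwist Y (i + 1) (koszulD e i f) := by
  apply Subtype.ext
  refine LinearMap.ext fun h => LinearMap.ext fun x => ?_
  rw [coe_koszulD, koszulTwist_apply, formTwist_apply, coe_koszulD, kosz_eq_vecComm,
    kosz_eq_vecComm, ← sum_extMap_contr e i _ _ (neg_longest_neg_longest (b := b)), map_sum]
  refine Finset.sum_congr rfl fun a _ => ?_
  rw [vecComm_apply, vecComm_apply, koszulTwist_apply, koszulTwist_apply, formTwist_apply,
    formTwist_apply, smul_tw, map_mul, theta_f_tmul, map_sub]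

end TwistedResolution

open CategoryTheory Abelian

/-! ### Frobenius reciprocity and the traces on the terms of the resolution. -/

section EulerFormula

variable {ι V₀ N : Type u} [AddCommGroup V₀] [Module ℝ V₀] [AddCommGroup N] [Module ℝ N]
  {P : RootPairing ι ℝ V₀ N} {b : P.Base} [Finite ι] [P.IsCrystallographic] [P.IsReduced]
  {k : Parameter b}

/-- The morphism `M^θ ⟶ M` defined by a `θ`-semilinear operator. -/
noncomputable def ofTwisting (M : Type u) [AddCommGroup M] [Module (Hecke k) M] (t : M →+ M)
    (ht : ∀ h m, t (theta k h • m) = h • t m) :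
    (twistFunctor k).obj (ModuleCat.of (Hecke k) M) ⟶ ModuleCat.of (Hecke k) M :=
  ModuleCat.ofHom (X := (twistFunctor k).obj (ModuleCat.of (Hecke k) M))
    { toFun := fun m => t m
      map_add' := fun m m' => map_add t m m'
      map_smul' := fun h m => ht h m }

theorem HasTwistedEuler.shift_module (X : TwistedModule k) {A B C : Type u} [AddCommGroup A]
    [Module (Hecke k) A] [AddCommGroup B] [Module (Hecke k) B] [AddCommGroup C]
    [Module (Hecke k) C] (f : A →ₗ[Hecke k] B) (g : B →ₗ[Hecke k] C) (hf : Function.Injective f)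
    (hfg : Function.Exact f g) (hg : Function.Surjective g) (tA : A →+ A) (tB : B →+ B) (tC : C →+ C)
    (hA : ∀ h m, tA (theta k h • m) = h • tA m) (hB : ∀ h m, tB (theta k h • m) = h • tB m)
    (hC : ∀ h m, tC (theta k h • m) = h • tC m) (h1 : ∀ a, tB (f a) = f (tA a))
    (h2 : ∀ a, tC (g a) = g (tB a)) (hinj : Injective (ModuleCat.of (Hecke k) B))
    (hfin : Module.Finite ℂ (Ext.{u} X.toHecke (ModuleCat.of (Hecke k) B) 0)) {D : ℕ} {r : ℂ}
    (h : HasTwistedEuler.{u + 1, u, u} (twistFunctor k) X.toTwist (ofTwisting C tC hC) D r) :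
    HasTwistedEuler.{u + 1, u, u} (twistFunctor k) X.toTwist (ofTwisting A tA hA) (D + 1)
      (LinearMap.trace ℂ _ (twOp.{u + 1, u, u} (twistFunctor k) X.toTwist
        (ofTwisting B tB hB) 0) - r) := by
  let S : ShortComplex (ModuleCat.{u} (Hecke k)) :=
    ShortComplex.mk (ModuleCat.ofHom f) (ModuleCat.ofHom g) (by
      ext x
      exact (hfg (f x)).mpr ⟨x, rfl⟩)
  have hS : S.ShortExact :=
    { exact := by
        rw [ShortComplex.ShortExact.moduleCat_exact_iff_function_exact]
        exact hfg
      mono_f := (ModuleCat.mono_iff_injective _).mpr hf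
      epi_g := (ModuleCat.epi_iff_surjective _).mpr hg }
  have : Injective S.X₂ := hinj
  have : Module.Finite ℂ (Ext.{u} X.toHecke S.X₂ 0) := hfin
  refine HasTwistedEuler.shift (twistFunctor k) X.toTwist hS (ofTwisting A tA hA)
    (ofTwisting B tB hB) (ofTwisting C tC hC) ?_ ?_ h
  · ext x
    exact h1 x
  · ext x
    exact h2 x

variable {U : Type u} [AddCommGroup U] [Module ℂ U] (ρ : Representation ℂ P.weylGroup U)
  (X Y : TwistedModule k)

/-- Frobenius reciprocity as an isomorphism of abelian groups. -/
noncomputable def coindHomEquiv : (X.toHecke ⟶ ModuleCat.of (Hecke k) (coind k ρ)) ≃+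
    (Representation.linHom X.weylRep ρ).invariants where
  toFun g := ⟨coindEval ∘ₗ (g.hom.restrictScalars ℂ : X.carrier →ₗ[ℂ] coind k ρ), fun w => by
    refine LinearMap.ext fun m => ?_
    change ρ w ((g.hom (Hecke.t k w⁻¹ • m) : coind k ρ).1 1) = (g.hom m : coind k ρ).1 1
    rw [← coind_t_mul, mul_one, coind_hom_apply, ← mul_smul, ← Hecke.t_mul, mul_inv_cancel,
      Hecke.t_one, one_smul]⟩
  invFun φ := ModuleCat.ofHom (coindLift φ.1 fun w m => by
    have h := LinearMap.congr_fun (φ.2 w) (X.weylRep w m)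
    change ρ w (φ.1 (X.weylRep w⁻¹ (X.weylRep w m))) = φ.1 (X.weylRep w m) at h
    rw [← Module.End.mul_apply (X.weylRep w⁻¹), ← map_mul, inv_mul_cancel, map_one] at h
    exact h.symm)
  left_inv g := by
    refine ModuleCat.hom_ext (LinearMap.ext fun m => Subtype.ext (LinearMap.ext fun h => ?_))
    exact (coind_hom_apply (g.hom : X.carrier →ₗ[Hecke k] coind k ρ) m h).symm
  right_inv φ := by
    refine Subtype.ext (LinearMap.ext fun m => ?_)
    change φ.1 ((1 : Hecke k) • m) = φ.1 m
    rw [one_smul]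
  map_add' g g' := rfl

/-- Frobenius reciprocity as an isomorphism of complex vector spaces. -/
noncomputable def coindExtEquiv : Ext.{u} X.toHecke (ModuleCat.of (Hecke k) (coind k ρ)) 0 ≃ₗ[ℂ]
    (Representation.linHom X.weylRep ρ).invariants :=
  { Ext.addEquiv₀.trans (coindHomEquiv ρ X) with
    map_smul' := fun c x => by
      obtain ⟨g, rfl⟩ := (Ext.mk₀_bijective _ _).2 x
      rw [← Ext.mk₀_smul]
      have h0 (f : X.toHecke ⟶ ModuleCat.of (Hecke k) (coind k ρ)) :
        Ext.addEquiv₀ (Ext.mk₀ f) = f := Ext.homEquiv₀.right_inv f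
      change coindHomEquiv ρ X (Ext.addEquiv₀ (Ext.mk₀ _)) =
        c • coindHomEquiv ρ X (Ext.addEquiv₀ (Ext.mk₀ _))
      rw [h0, h0]
      refine Subtype.ext (LinearMap.ext fun m => ?_)
      change ((algebraMap ℂ (Hecke k) c) • (g.hom m : coind k ρ)).1 1 =
        c • (g.hom m : coind k ρ).1 1
      rw [algebraMap_smul]
      rfl }

theorem coindExtEquiv_mk₀ (g : X.toHecke ⟶ ModuleCat.of (Hecke k) (coind k ρ)) :
    coindExtEquiv ρ X (Ext.mk₀ g) = coindHomEquiv ρ X g :=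
  congrArg (coindHomEquiv ρ X) (Ext.homEquiv₀.right_inv g)

/-- The trace of `w` on `X⁺ - X⁻`. -/
noncomputable def twChar (w : P.weylGroup) : ℂ :=
  LinearMap.trace ℂ X.carrier (X.twLongest ∘ₗ X.weylRep w)

theorem trace_weylRep_tw (w : P.weylGroup) :
    LinearMap.trace ℂ X.carrier (X.weylRep (w * longest b) ∘ₗ X.tw) = twChar X w := by
  rw [twChar]
  congr 1
  refine LinearMap.ext fun x => ?_
  rw [LinearMap.comp_apply, LinearMap.comp_apply, TwistedModule.twLongest_weylRep, map_mul,
    Module.End.mul_apply]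
  congr 1
  rw [TwistedModule.twLongest, LinearMap.comp_apply, TwistedModule.weylRep_apply,
    TwistedModule.weylRep_apply, X.tw_smul, theta_t, mul_inv_cancel_right]

theorem trace_tw_weylRep (w : P.weylGroup) :
    LinearMap.trace ℂ X.carrier (X.tw ∘ₗ X.weylRep (longest b * w)) = twChar X w := by
  rw [twChar, map_mul]
  rfl

/-- The factor w₀ in the group element cancels the one in θ, leaving −u⁻¹ on V₀ and hence the sign
(−1)^i on ⋀^i. -/
theorem trace_formTwist [FiniteDimensional ℝ V₀] (i : ℕ) (u : P.weylGroup) :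
    LinearMap.trace ℂ _ (formTwist Y i ∘ₗ formRep k Y.carrier i (longest b * u)) =
      twChar Y u * ((-1) ^ i * LinearMap.trace ℝ _ (extMap i (P.weylGroupRootRep u⁻¹)) : ℝ) := by
  have h : formTwist Y i ∘ₗ formRep k Y.carrier i (longest b * u) =
      postMap (Y.tw ∘ₗ Y.weylRep (longest b * u)) ∘ₗ
        preMap ((-1 : ℝ) ^ i • extMap i (P.weylGroupRootRep u⁻¹)) := by
    refine LinearMap.ext fun φ => LinearMap.ext fun x => ?_
    have hg : P.weylGroupRootRep (longest b * u)⁻¹ ∘ₗ (-P.weylGroupRootRep (longest b)) =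
        -P.weylGroupRootRep u⁻¹ := by
      rw [LinearMap.comp_neg, ← Module.End.mul_eq_comp, ← map_mul, mul_inv_rev, inv_mul_cancel_right]
    rw [← extMap_neg, ← hg, LinearMap.comp_apply, formTwist_apply, formRep_apply,
      LinearMap.comp_apply, postMap_apply, preMap_apply, extMap_comp]
    rfl
  rw [h, trace_postMap_preMap, trace_tw_weylRep, map_smul, smul_eq_mul]

theorem formTwist_mem_invariants (i : ℕ)
    (φ : X.carrier →ₗ[ℂ] (⋀[ℝ]^i V₀ →ₗ[ℝ] Y.carrier))
    (hφ : φ ∈ (Representation.linHom X.weylRep (formRep k Y.carrier i)).invariants) :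
    formTwist Y i ∘ₗ φ ∘ₗ X.tw ∈
      (Representation.linHom X.weylRep (formRep k Y.carrier i)).invariants := by
  intro w
  refine LinearMap.ext fun x => ?_
  have h := LinearMap.congr_fun (hφ (longest b * w * (longest b)⁻¹)) (X.tw x)
  change formRep k Y.carrier i _ (φ (X.weylRep _ (X.tw x))) = φ (X.tw x) at h
  change formRep k Y.carrier i w (formTwist Y i (φ (X.tw (X.weylRep w⁻¹ x)))) =
    formTwist Y i (φ (X.tw x))
  rw [← formTwist_formRep, ← h]
  congr 3
  rw [TwistedModule.weylRep_apply, TwistedModule.weylRep_apply, X.tw_smul, theta_t]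
  congr 3
  group

-- By Frobenius reciprocity the space is Hom_W(X, Hom(⋀^i V₀, Y)), on which θ acts by composition on
-- both sides. The trace on the invariants is an average over W, and the substitution w = w₀u
-- produces the twisted characters.
set_option maxHeartbeats 1000000 in
theorem trace_twOp_koszulTerm [FiniteDimensional ℝ V₀] [Fintype P.weylGroup] (i : ℕ) :
    Module.Finite ℂ (Ext.{u} X.toHecke (ModuleCat.of (Hecke k) (KoszulTerm k Y.carrier i)) 0) ∧
    LinearMap.trace ℂ _ (twOp.{u + 1, u, u} (twistFunctor k) X.toTwist
      (ofTwisting (KoszulTerm k Y.carrier i) (koszulTwist Y i) (koszulTwist_smul Y i)) 0) =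
      (-1) ^ i * ((Fintype.card P.weylGroup : ℂ)⁻¹ * ∑ u : P.weylGroup, twChar Y u *
        twChar X u⁻¹ * (LinearMap.trace ℝ _ (extMap i (P.weylGroupRootRep u⁻¹)) : ℝ)) := by
  have hU : Module.Finite ℂ (⋀[ℝ]^i V₀ →ₗ[ℝ] Y.carrier) := finite_forms
  let T : Module.End ℂ (X.carrier →ₗ[ℂ] (⋀[ℝ]^i V₀ →ₗ[ℝ] Y.carrier)) :=
    { toFun := fun φ => formTwist Y i ∘ₗ φ ∘ₗ X.tw
      map_add' := fun φ ψ => by ext; simp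
      map_smul' := fun r φ => by ext; simp }
  refine ⟨Module.Finite.equiv (coindExtEquiv (formRep k Y.carrier i) X).symm, ?_⟩
  have htr (w : P.weylGroup) : LinearMap.trace ℂ _
      (T ∘ₗ Representation.linHom X.weylRep (formRep k Y.carrier i) w) =
      LinearMap.trace ℂ _ (formTwist Y i ∘ₗ formRep k Y.carrier i w) *
        LinearMap.trace ℂ _ (X.weylRep w⁻¹ ∘ₗ X.tw) :=
    trace_comp_hom (formTwist Y i ∘ₗ formRep k Y.carrier i w) (X.weylRep w⁻¹ ∘ₗ X.tw) _ fun φ => rfl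
  have hT : ∀ φ ∈ (Representation.linHom X.weylRep (formRep k Y.carrier i)).invariants,
      T φ ∈ (Representation.linHom X.weylRep (formRep k Y.carrier i)).invariants :=
    formTwist_mem_invariants X Y i
  have hE (x) : coindExtEquiv (formRep k Y.carrier i) X (twOp.{u + 1, u, u} (twistFunctor k)
      X.toTwist (ofTwisting (KoszulTerm k Y.carrier i) (koszulTwist Y i) (koszulTwist_smul Y i))
        0 x) = T.restrict hT (coindExtEquiv (formRep k Y.carrier i) X x) := by
    obtain ⟨g, rfl⟩ := (Ext.mk₀_bijective _ _).2 x
    rw [twOp_zero, coindExtEquiv_mk₀, coindExtEquiv_mk₀]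
    refine Subtype.ext (LinearMap.ext fun m => ?_)
    change formTwist Y i ((g.hom (X.tw m) : KoszulTerm k Y.carrier i).1 (theta k 1)) =
      formTwist Y i ((g.hom (X.tw m) : KoszulTerm k Y.carrier i).1 1)
    rw [map_one]
  refine (trace_eq_of_equiv
    (V := (Representation.linHom X.weylRep (formRep k Y.carrier i)).invariants)
    (coindExtEquiv (formRep k Y.carrier i) X) _ _ hE).trans ?_
  refine (trace_restrict_invariants _ T hT).trans ?_
  have hterm (u : P.weylGroup) : LinearMap.trace ℂ (X.carrier →ₗ[ℂ] (⋀[ℝ]^i V₀ →ₗ[ℝ] Y.carrier))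
      (T ∘ₗ Representation.linHom X.weylRep (formRep k Y.carrier i) (longest b * u)) =
      (-1) ^ i * (twChar Y u * twChar X u⁻¹ *
        (LinearMap.trace ℝ _ (extMap i (P.weylGroupRootRep u⁻¹)) : ℝ)) := by
    rw [htr, trace_formTwist, mul_inv_rev, longest_inv, trace_weylRep_tw]
    push_cast
    ring
  have hsum : ∑ w, LinearMap.trace ℂ (X.carrier →ₗ[ℂ] (⋀[ℝ]^i V₀ →ₗ[ℝ] Y.carrier))
      (T ∘ₗ Representation.linHom X.weylRep (formRep k Y.carrier i) w) =
      (-1) ^ i * ∑ u : P.weylGroup, twChar Y u * twChar X u⁻¹ *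
        (LinearMap.trace ℝ _ (extMap i (P.weylGroupRootRep u⁻¹)) : ℝ) := by
    rw [Finset.mul_sum]
    exact (Equiv.sum_comp (Equiv.mulLeft (longest b)) fun w => LinearMap.trace ℂ _
      (T ∘ₗ Representation.linHom X.weylRep (formRep k Y.carrier i) w)).symm.trans
        (Finset.sum_congr rfl fun u _ => hterm u)
  exact (congrArg (fun z => (Fintype.card P.weylGroup : ℂ)⁻¹ * z) hsum).trans (mul_left_comm _ _ _)

/-- The trace of `w` on the exterior algebra of `V₀`. -/
noncomputable def extTrace (w : P.weylGroup) : ℝ :=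
  ∑ i ∈ Finset.range (Module.finrank ℝ V₀ + 1),
    LinearMap.trace ℝ _ (extMap i (P.weylGroupRootRep w))

variable {σ : Type} [Fintype σ] (e : Module.Basis σ ℝ V₀)

/-- The cocycles of the Koszul resolution. -/
noncomputable def koszulCocycles (i : ℕ) : Submodule (Hecke k) (KoszulTerm k Y.carrier i) :=
  LinearMap.ker (koszulD e i)

theorem koszulTwist_mem_koszulCocycles (i : ℕ) (f : KoszulTerm k Y.carrier i)
    (hf : f ∈ koszulCocycles Y e i) : koszulTwist Y i f ∈ koszulCocycles Y e i := by
  rw [koszulCocycles, LinearMap.mem_ker] at hf ⊢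
  rw [koszulTwist_koszulD, hf, map_zero]

/-- The operator induced by `θ` on the cocycles of the Koszul resolution. -/
noncomputable def cocycleTwist (i : ℕ) : koszulCocycles Y e i →+ koszulCocycles Y e i where
  toFun f := ⟨koszulTwist Y i f, koszulTwist_mem_koszulCocycles Y e i f f.2⟩
  map_zero' := Subtype.ext (map_zero _)
  map_add' _ _ := Subtype.ext (map_add _ _ _)

theorem cocycleTwist_smul (i : ℕ) (h : Hecke k) (f : koszulCocycles Y e i) :
    cocycleTwist Y e i (theta k h • f) = h • cocycleTwist Y e i f :=
  Subtype.ext (koszulTwist_smul Y i h f)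

/-- The differential of the Koszul resolution as a map to the cocycles. -/
noncomputable def toCocycles (i : ℕ) :
    KoszulTerm k Y.carrier i →ₗ[Hecke k] koszulCocycles Y e (i + 1) :=
  (koszulD e i).codRestrict _ fun f => koszulD_koszulD e i f

theorem toCocycles_surjective (i : ℕ) : Function.Surjective (toCocycles Y e i) := by
  rintro ⟨f, hf⟩
  obtain ⟨g, hg⟩ := koszulD_exact e i f hf
  exact ⟨g, Subtype.ext hg⟩

theorem toCocycles_eq_zero_iff (i : ℕ) (f : KoszulTerm k Y.carrier i) :
    toCocycles Y e i f = 0 ↔ koszulD e i f = 0 := by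
  rw [Subtype.ext_iff]
  rfl

theorem toCocycles_twist (i : ℕ) (f : KoszulTerm k Y.carrier i) :
    cocycleTwist Y e (i + 1) (toCocycles Y e i f) = toCocycles Y e i (koszulTwist Y i f) :=
  Subtype.ext (koszulTwist_koszulD Y e i f).symm

theorem exact_subtype_toCocycles (i : ℕ) :
    Function.Exact (koszulCocycles Y e i).subtype (toCocycles Y e i) := by
  intro f
  rw [toCocycles_eq_zero_iff]
  exact ⟨fun h => ⟨⟨f, h⟩, rfl⟩, by rintro ⟨g, rfl⟩; exact g.2⟩

variable [FiniteDimensional ℝ V₀]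

/-- The trace of `θ` on the morphisms to a term of the Koszul resolution. -/
noncomputable def koszulTrace (i : ℕ) : ℂ :=
  LinearMap.trace ℂ _ (twOp.{u + 1, u, u} (twistFunctor k) X.toTwist
      (ofTwisting (KoszulTerm k Y.carrier i) (koszulTwist Y i) (koszulTwist_smul Y i)) 0)

end EulerFormula

open CategoryTheory Abelian

/-! ### The Euler–Poincaré pairing as a weighted sum over the Weyl group. -/

section EulerFormula

variable {ι V₀ N : Type u} [AddCommGroup V₀] [Module ℝ V₀] [AddCommGroup N] [Module ℝ N]
  {P : RootPairing ι ℝ V₀ N} {b : P.Base} [Finite ι] [P.IsCrystallographic] [P.IsReduced]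
  {k : Parameter b}

variable (X Y : TwistedModule k) {σ : Type} [Fintype σ] (e : Module.Basis σ ℝ V₀) [FiniteDimensional ℝ V₀]
-- Descending induction on i along 0 → Z^i → K^i → Z^{i+1} → 0, where K^i is the i-th term and Z^i
-- its cocycles. It starts at i = dim V + 1, where K^i is zero.
theorem hasTwistedEuler_koszulCocycles (m i : ℕ) (hi : i + m = Module.finrank ℝ V₀ + 1) :
    HasTwistedEuler.{u + 1, u, u} (twistFunctor k) X.toTwist
      (ofTwisting (koszulCocycles Y e i) (cocycleTwist Y e i) (cocycleTwist_smul Y e i)) m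
      (∑ j ∈ Finset.range m, (-1) ^ j * koszulTrace X Y (i + j)) := by
  have := finite_weylGroup b
  have := Fintype.ofFinite P.weylGroup
  induction m generalizing i with
  | zero =>
    have : Subsingleton (KoszulTerm k Y.carrier i) := subsingleton_koszulTerm (by lia)
    exact hasTwistedEuler_of_isZero _ _ _ (ModuleCat.isZero_of_subsingleton _)
  | succ m ih =>
    have h := HasTwistedEuler.shift_module X (koszulCocycles Y e i).subtype (toCocycles Y e i)
      Subtype.val_injective (exact_subtype_toCocycles Y e i) (toCocycles_surjective Y e i)
      (cocycleTwist Y e i) (koszulTwist Y i) (cocycleTwist Y e (i + 1))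
      (cocycleTwist_smul Y e i) (koszulTwist_smul Y i) (cocycleTwist_smul Y e (i + 1))
      (fun _ => rfl) (toCocycles_twist Y e i) coind_injective
      (trace_twOp_koszulTerm X Y i).1 (ih (i + 1) (by lia))
    have hs : ∑ j ∈ Finset.range (m + 1), (-1) ^ j * koszulTrace X Y (i + j) =
        koszulTrace X Y i - ∑ j ∈ Finset.range m, (-1) ^ j * koszulTrace X Y (i + 1 + j) := by
      rw [Finset.sum_range_succ', pow_zero, one_mul, add_zero, add_comm, sub_eq_add_neg,
        ← Finset.sum_neg_distrib]
      congr 1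
      refine Finset.sum_congr rfl fun j _ => ?_
      rw [pow_succ, add_right_comm, add_assoc]
      ring
    rw [hs]
    exact h

/-- One more shift, along 0 → Y → K⁰ → Z¹ → 0. The bound dim V + 1 gives the finiteness and
vanishing statements at once. -/
theorem hasTwistedEuler_module :
    HasTwistedEuler.{u + 1, u, u} (twistFunctor k) X.toTwist Y.ofTwist
      (Module.finrank ℝ V₀ + 1)
      (∑ j ∈ Finset.range (Module.finrank ℝ V₀ + 1), (-1) ^ j * koszulTrace X Y j) := by
  have := finite_weylGroup b
  have := Fintype.ofFinite P.weylGroup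
  let e := Module.finBasis ℝ V₀
  have htw (h : Hecke k) (y : Y.carrier) : Y.tw.toAddMonoidHom (theta k h • y) =
      h • Y.tw.toAddMonoidHom y := (smul_tw Y h y).symm
  have h := HasTwistedEuler.shift_module X (koszulAug k Y.carrier) (toCocycles Y e 0)
    koszulAug_injective (fun f => (toCocycles_eq_zero_iff Y e 0 f).trans (koszulAug_exact e f))
    (toCocycles_surjective Y e 0) Y.tw.toAddMonoidHom (koszulTwist Y 0) (cocycleTwist Y e 1)
    htw (koszulTwist_smul Y 0) (cocycleTwist_smul Y e 1) (koszulTwist_aug Y)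
    (toCocycles_twist Y e 0) coind_injective (trace_twOp_koszulTerm X Y 0).1
    (hasTwistedEuler_koszulCocycles X Y e (Module.finrank ℝ V₀) 1 (by lia))
  have hs : ∑ j ∈ Finset.range (Module.finrank ℝ V₀ + 1), (-1) ^ j * koszulTrace X Y j =
      koszulTrace X Y 0 -
        ∑ j ∈ Finset.range (Module.finrank ℝ V₀), (-1) ^ j * koszulTrace X Y (1 + j) := by
    rw [Finset.sum_range_succ', pow_zero, one_mul, add_comm, sub_eq_add_neg,
      ← Finset.sum_neg_distrib]
    congr 1
    refine Finset.sum_congr rfl fun j _ => ?_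
    rw [pow_succ, add_comm 1 j]
    ring
  rw [hs]
  exact h

theorem finite_heckeExt (n : ℕ) : Module.Finite ℂ (HeckeExt X Y n) :=
  (hasTwistedEuler_module X Y).finite n

theorem subsingleton_heckeExt (n : ℕ) (hn : Module.finrank ℝ V₀ < n) :
    Subsingleton (HeckeExt X Y n) :=
  (hasTwistedEuler_module X Y).subsingleton n hn

theorem twistedEP_eq [Fintype P.weylGroup] : twistedEP X Y = (Fintype.card P.weylGroup : ℂ)⁻¹ *
    ∑ w : P.weylGroup, twChar X w * twChar Y w⁻¹ * (extTrace w : ℂ) := by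
  have h1 : twistedEP X Y = ∑ n ∈ Finset.range (Module.finrank ℝ V₀ + 1),
      (-1) ^ n * LinearMap.trace ℂ (HeckeExt X Y n) (thetaStar X Y n) := by
    refine finsum_eq_sum_of_support_subset _ fun n hn => ?_
    rw [Finset.coe_range, Set.mem_Iio]
    by_contra hlt
    have := subsingleton_heckeExt X Y n (by lia)
    apply hn
    change (-1 : ℂ) ^ n * LinearMap.trace ℂ (HeckeExt X Y n) (thetaStar X Y n) = 0
    rw [Subsingleton.elim (thetaStar X Y n) 0, map_zero, mul_zero]
  have h2 : twistedEP X Y =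
      ∑ j ∈ Finset.range (Module.finrank ℝ V₀ + 1), (-1) ^ j * koszulTrace X Y j :=
    h1.trans (hasTwistedEuler_module X Y).sum_trace
  -- The sign of the Euler characteristic meets the sign of −w₀ on ⋀^j; their product is 1.
  have h3 (j : ℕ) : (-1) ^ j * koszulTrace X Y j = (Fintype.card P.weylGroup : ℂ)⁻¹ *
      ∑ u : P.weylGroup, twChar Y u * twChar X u⁻¹ *
        (LinearMap.trace ℝ _ (extMap j (P.weylGroupRootRep u⁻¹)) : ℝ) := by
    rw [koszulTrace, (trace_twOp_koszulTerm X Y j).2, ← mul_assoc, ← mul_pow]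
    simp
  rw [h2, Finset.sum_congr rfl fun j _ => h3 j, ← Finset.mul_sum, Finset.sum_comm]
  congr 1
  rw [← Equiv.sum_comp (Equiv.inv P.weylGroup)]
  refine Finset.sum_congr rfl fun u _ => ?_
  simp only [Equiv.inv_apply, inv_inv, extTrace]
  push_cast
  rw [Finset.mul_sum]
  exact Finset.sum_congr rfl fun j _ => by ring

end EulerFormula

/-! ### The grading of the exterior algebra. -/

section ExteriorGrading

variable {V : Type*} [AddCommGroup V] [Module ℝ V] [FiniteDimensional ℝ V]

theorem exteriorPower_eq_bot {i : ℕ} (hi : Module.finrank ℝ V < i) : ⋀[ℝ]^i V = ⊥ := by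
  rw [← Submodule.finrank_eq_zero, exteriorPower.finrank_eq, Nat.choose_eq_zero_of_lt hi]

theorem iSupIndep_exteriorPower : iSupIndep fun i : ℕ => ⋀[ℝ]^i V :=
  (DirectSum.Decomposition.isInternal (fun i : ℕ => ⋀[ℝ]^i V)).submodule_iSupIndep

theorem iSup_exteriorPower : ⨆ i : ℕ, ⋀[ℝ]^i V = ⊤ :=
  (DirectSum.Decomposition.isInternal (fun i : ℕ => ⋀[ℝ]^i V)).submodule_iSup_eq_top

theorem iSup_fin_exteriorPower :
    ⨆ i : Fin (Module.finrank ℝ V + 1), ⋀[ℝ]^(i : ℕ) V = ⊤ := by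
  rw [eq_top_iff, ← iSup_exteriorPower, iSup_le_iff]
  intro i
  rcases Nat.lt_or_ge (Module.finrank ℝ V) i with h | h
  · rw [exteriorPower_eq_bot h]; exact bot_le
  · exact le_iSup (fun j : Fin (Module.finrank ℝ V + 1) => ⋀[ℝ]^(j : ℕ) V)
      ⟨i, Nat.lt_succ_of_le h⟩

instance finite_exteriorAlgebra : Module.Finite ℝ (ExteriorAlgebra ℝ V) := by
  have : Module.Finite ℝ
      ((⨆ i : Fin (Module.finrank ℝ V + 1), ⋀[ℝ]^(i : ℕ) V : Submodule ℝ (ExteriorAlgebra ℝ V))) :=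
    Submodule.finite_iSup _
  rw [iSup_fin_exteriorPower] at this
  exact Module.Finite.equiv Submodule.topEquiv

theorem isInternal_exteriorPower :
    DirectSum.IsInternal fun i : Fin (Module.finrank ℝ V + 1) => ⋀[ℝ]^(i : ℕ) V :=
  DirectSum.isInternal_submodule_of_iSupIndep_of_iSup_eq_top
    ((iSupIndep_exteriorPower (V := V)).comp Fin.val_injective) iSup_fin_exteriorPower

theorem trace_exteriorAlgebra_map (f : V →ₗ[ℝ] V) :
    LinearMap.trace ℝ _ (ExteriorAlgebra.map f).toLinearMap =
      ∑ i ∈ Finset.range (Module.finrank ℝ V + 1), LinearMap.trace ℝ _ (extMap i f) := by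
  rw [LinearMap.trace_eq_sum_trace_restrict isInternal_exteriorPower
    (fun i => map_mem_exteriorPower f i), Finset.sum_range]
  rfl

/-- The degree operator Σ e_a ∧ ι_a kills such an element, and it multiplies the component of degree
i by i, so only degree 0 survives. -/
theorem mem_range_of_contractLeft_eq_zero (x : ExteriorAlgebra ℝ V)
    (h : ∀ ξ : Module.Dual ℝ V, CliffordAlgebra.contractLeft (Q := (0 : QuadraticForm ℝ V)) ξ x = 0) :
    ∃ r : ℝ, x = algebraMap ℝ _ r := by
  let e := Module.finBasis ℝ V
  let D : ExteriorAlgebra ℝ V →ₗ[ℝ] ExteriorAlgebra ℝ V :=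
    ∑ a, LinearMap.mulLeft ℝ (ExteriorAlgebra.ι ℝ (e a)) ∘ₗ
      CliffordAlgebra.contractLeft (Q := (0 : QuadraticForm ℝ V)) (e.coord a)
  have hD (y) : D y = ∑ a, ExteriorAlgebra.ι ℝ (e a) *
      CliffordAlgebra.contractLeft (Q := (0 : QuadraticForm ℝ V)) (e.coord a) y := by
    simp only [D, LinearMap.sum_apply]
    rfl
  have h0 : ∀ y ∈ ⋀[ℝ]^0 V, ∃ r : ℝ, y = algebraMap ℝ _ r := by
    intro y hy
    rw [ExteriorAlgebra.exteriorPower, pow_zero] at hy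
    obtain ⟨r, rfl⟩ := Submodule.mem_one.mp hy
    exact ⟨r, rfl⟩
  have hdeg : ∀ i : ℕ, ∀ y ∈ ⋀[ℝ]^i V, D y = (i : ℝ) • y := by
    intro i y hy
    rw [hD]
    cases i with
    | zero =>
      obtain ⟨r, rfl⟩ := h0 y hy
      rw [Nat.cast_zero, zero_smul]
      refine Finset.sum_eq_zero fun a _ => ?_
      have : CliffordAlgebra.contractLeft (Q := (0 : QuadraticForm ℝ V)) (e.coord a)
        (algebraMap ℝ _ r) = 0 := CliffordAlgebra.contractLeft_algebraMap _ _ _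
      erw [this, mul_zero]
    | succ i =>
      have := congrArg (Subtype.val) (sum_wedge_contr e i ⟨y, hy⟩)
      rw [AddSubmonoidClass.coe_finsetSum] at this
      exact this
  have hx : D x = 0 := by
    rw [hD]
    exact Finset.sum_eq_zero fun a _ => by rw [h]; exact mul_zero _
  let c : ℕ → ExteriorAlgebra ℝ V := fun i =>
    (DirectSum.decompose (fun i : ℕ => ⋀[ℝ]^i V) x i : ExteriorAlgebra ℝ V)
  have hc (i : ℕ) : c i ∈ ⋀[ℝ]^i V := SetLike.coe_mem _
  classical
  have hsum := DirectSum.sum_support_decompose (fun i : ℕ => ⋀[ℝ]^i V) x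
  set s := (DirectSum.decompose (fun i : ℕ => ⋀[ℝ]^i V) x).support
  have hz : ∑ i ∈ s, (i : ℝ) • c i = 0 := by
    rw [← hx, ← hsum, map_sum]
    exact Finset.sum_congr rfl fun i _ => (hdeg i _ (hc i)).symm
  have hzero := (iSupIndep_iff_finsetSum_eq_zero_imp_eq_zero (fun i : ℕ => ⋀[ℝ]^i V)).mp
    iSupIndep_exteriorPower s (fun i => (i : ℝ) • c i)
    (fun i _ => Submodule.smul_mem _ _ (hc i)) hz
  have hx0 : x = c 0 := by
    rw [← hsum]
    refine Finset.sum_eq_single 0 (fun i hi h => ?_) (fun h => ?_)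
    · exact (smul_eq_zero.mp (hzero i hi)).resolve_left (by exact_mod_cast h)
    · simpa [s] using h
  exact hx0 ▸ h0 _ (hc 0)

end ExteriorGrading

/-! ### Orthonormal frames and the supercentre of the Clifford algebra. -/

section CliffordFrame

open CliffordAlgebra

variable {V : Type*} [AddCommGroup V] [Module ℝ V] [FiniteDimensional ℝ V]
  {F : QuadraticForm ℝ V}

instance finite_cliffordAlgebra (F : QuadraticForm ℝ V) : Module.Finite ℝ (CliffordAlgebra F) :=
  Module.Finite.equiv (CliffordAlgebra.equivExterior F).symm

theorem exists_orthonormal_frame (hF : F.PosDef) :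
    ∃ e : Module.Basis (Fin (Module.finrank ℝ V)) ℝ V,
      (∀ a, F (e a) = 1) ∧ ∀ a b, a ≠ b → QuadraticMap.polar F (e a) (e b) = 0 := by
  obtain ⟨v, hv⟩ := LinearMap.BilinForm.exists_orthogonal_basis
    (QuadraticForm.associated_isSymm ℝ F)
  have hpos (a) : 0 < F (v a) := hF _ (v.ne_zero a)
  have hw (a) : IsUnit ((Real.sqrt (F (v a)))⁻¹) :=
    (inv_ne_zero (Real.sqrt_pos.mpr (hpos a)).ne').isUnit
  refine ⟨v.isUnitSMul hw, fun a => ?_, fun a b hab => ?_⟩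
  · rw [Module.Basis.isUnitSMul_apply, QuadraticMap.map_smul, smul_eq_mul, ← mul_inv,
      Real.mul_self_sqrt (hpos a).le, inv_mul_cancel₀ (hpos a).ne']
  · rw [Module.Basis.isUnitSMul_apply, Module.Basis.isUnitSMul_apply, QuadraticMap.polar_smul_left,
      QuadraticMap.polar_smul_right]
    have h : QuadraticMap.associated F (v a) (v b) = 0 := hv hab
    have h2 : QuadraticMap.polar F (v a) (v b) = 0 := by
      rw [← QuadraticMap.polarBilin_apply_apply, ← QuadraticMap.two_nsmul_associated ℝ F]
      rw [LinearMap.smul_apply, LinearMap.smul_apply, h, smul_zero]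
    rw [h2, smul_zero, smul_zero]

/-- Vectors that anticommute in the graded sense with an element of the Clifford algebra measure
its contractions. -/
theorem ι_mul_sub_involute_mul_ι (q : QuadraticForm ℝ V) (v : V) (y : CliffordAlgebra q) :
    ι q v * y - involute y * ι q v = contractLeft (QuadraticMap.polarBilin q v) y := by
  induction y using CliffordAlgebra.left_induction with
  | algebraMap r =>
    rw [contractLeft_algebraMap, AlgHom.commutes, Algebra.commutes, sub_self]
  | add x y hx hy => rw [map_add, map_add, ← hx, ← hy]; noncomm_ring
  | ι_mul x a hx =>
    rw [contractLeft_ι_mul, ← hx, map_mul, involute_ι]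
    have h : ι q v * ι q a = algebraMap ℝ _ (QuadraticMap.polar q v a) - ι q a * ι q v :=
      eq_sub_of_add_eq (ι_mul_ι_add_swap v a)
    rw [← mul_assoc, h, QuadraticMap.polarBilin_apply_apply, Algebra.smul_def]
    noncomm_ring

/-- The twisted commutator with v is the contraction with the polar form of v. The form is definite,
so all contractions of y vanish, also after transport to the exterior algebra. -/
theorem mem_range_of_twisted_commute (hF : F.PosDef) (y : CliffordAlgebra (-F))
    (h : ∀ v, ι (-F) v * y = involute y * ι (-F) v) : ∃ r : ℝ, y = algebraMap ℝ _ r := by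
  have hsurj (ξ : Module.Dual ℝ V) : ∃ v, QuadraticMap.polarBilin (-F) v = ξ := by
    have hinj : Function.Injective (QuadraticMap.polarBilin (-F) : V →ₗ[ℝ] Module.Dual ℝ V) := by
      rw [← LinearMap.ker_eq_bot, LinearMap.ker_eq_bot']
      intro v hv
      by_contra hne
      have h1 := LinearMap.congr_fun hv v
      rw [QuadraticMap.polarBilin_apply_apply, QuadraticMap.polar_self] at h1
      have := hF v hne
      simp at h1
      exact this.ne' h1
    exact (LinearMap.injective_iff_surjective_of_finrank_eq_finrank
      Subspace.dual_finrank_eq.symm).mp hinj ξ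
  obtain ⟨r, hr⟩ := mem_range_of_contractLeft_eq_zero (equivExterior (-F) y) fun ξ => by
    obtain ⟨v, rfl⟩ := hsurj ξ
    have := changeForm_contractLeft (changeForm.associated_neg_proof (Q := -F))
      (QuadraticMap.polarBilin (-F) v) y
    rw [← ι_mul_sub_involute_mul_ι, h, sub_self, map_zero] at this
    exact this.symm
  refine ⟨r, (equivExterior (-F)).injective (hr.trans ?_)⟩
  exact (changeForm_algebraMap (changeForm.associated_neg_proof (Q := -F)) r).symm

end CliffordFrame

/-! ### The normalised trace on the Clifford algebra and its uniqueness. -/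

section CliffordTrace

open CliffordAlgebra

variable {V : Type*} [AddCommGroup V] [Module ℝ V] [FiniteDimensional ℝ V]
  {F : QuadraticForm ℝ V}

/-- The generators of the Clifford algebra that belong to an orthonormal frame. -/
structure CliffordFrame (F : QuadraticForm ℝ V) where
  basis : Module.Basis (Fin (Module.finrank ℝ V)) ℝ V
  form_basis : ∀ a, F (basis a) = 1
  polar_basis : ∀ a b, a ≠ b → QuadraticMap.polar F (basis a) (basis b) = 0

theorem nonempty_cliffordFrame (hF : F.PosDef) : Nonempty (CliffordFrame F) :=
  let ⟨e, h, h'⟩ := exists_orthonormal_frame hF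
  ⟨⟨e, h, h'⟩⟩

namespace CliffordFrame

variable (e : CliffordFrame F)

/-- The generator that belongs to a basis vector. -/
noncomputable def gen (a : Fin (Module.finrank ℝ V)) : CliffordAlgebra (-F) := ι (-F) (e.basis a)

theorem gen_mul_gen_self (a) : e.gen a * e.gen a = -1 := by
  rw [gen, ι_sq_scalar, neg_apply, e.form_basis, map_neg, map_one]

theorem gen_mul_gen {a b} (h : a ≠ b) : e.gen a * e.gen b = -(e.gen b * e.gen a) := by
  have := ι_mul_ι_add_swap (Q := -F) (e.basis a) (e.basis b)
  rw [show QuadraticMap.polar (-F) (e.basis a) (e.basis b) = 0 by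
    rw [FunLike.coe_neg, QuadraticMap.polar_neg, e.polar_basis a b h, neg_zero], map_zero]
    at this
  exact eq_neg_of_add_eq_zero_left this

theorem involute_gen (a) : involute (e.gen a) = -e.gen a := involute_ι _

theorem gen_mul_mul_gen (a) (x : CliffordAlgebra (-F)) : e.gen a * (e.gen a * x) = -x := by
  rw [← mul_assoc, gen_mul_gen_self, neg_one_mul]

theorem ι_eq_sum (v : V) : ι (-F) v = ∑ a, e.basis.repr v a • e.gen a := by
  calc ι (-F) v = ι (-F) (∑ a, e.basis.repr v a • e.basis a) := by rw [e.basis.sum_repr]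
    _ = _ := by simp only [map_sum, map_smul, gen]

/-- The projection to the elements that supercommute with a generator. -/
theorem exists_twisted_commute {M : Type*} [AddCommGroup M] [Module ℝ M]
    (s : Finset (Fin (Module.finrank ℝ V))) (x : CliffordAlgebra (-F)) :
    ∃ y : CliffordAlgebra (-F), (∀ a ∈ s, e.gen a * y = involute y * e.gen a) ∧
      ∀ f : CliffordAlgebra (-F) →ₗ[ℝ] M,
        (∀ a z, f (e.gen a * involute z * e.gen a) = -f z) → f x = f y := by
  induction s using Finset.induction_on with
  | empty => exact ⟨x, by simp, fun _ _ => rfl⟩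
  | insert a s ha ih =>
    obtain ⟨y, hy, hf⟩ := ih
    -- As u² = −1, the map y ↦ −u ε(y) u is an involution that fixes exactly the elements
    -- supercommuting with u; this is the average over it. Since distinct generators anticommute,
    -- the earlier conditions persist.
    refine ⟨(2⁻¹ : ℝ) • (y - e.gen a * involute y * e.gen a), ?_, fun f h => ?_⟩
    · intro b hb
      rw [mul_smul_comm, map_smul, smul_mul_assoc, map_sub, map_mul, map_mul, involute_involute,
        e.involute_gen]
      congr 1
      rw [mul_sub, sub_mul]
      rcases Finset.mem_insert.mp hb with rfl | hb'
      · have h1 : e.gen b * (e.gen b * involute y * e.gen b) = -(involute y * e.gen b) := by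
          rw [mul_assoc, e.gen_mul_mul_gen]
        have h2 : -e.gen b * y * -e.gen b * e.gen b = -(e.gen b * y) := by
          rw [mul_assoc, neg_mul (e.gen b) (e.gen b), e.gen_mul_gen_self, neg_neg, mul_one, neg_mul]
        rw [h1, h2]
        abel
      · have hne : b ≠ a := by rintro rfl; exact ha hb'
        have h0 := hy b hb'
        have h1 : e.gen b * involute y = y * e.gen b := by
          have := congrArg involute h0
          rw [map_mul, map_mul, involute_involute, e.involute_gen, neg_mul, mul_neg,
            neg_inj] at this
          exact this
        have h2 : e.gen b * (e.gen a * involute y * e.gen a) =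
            e.gen a * y * e.gen a * e.gen b := by
          rw [← mul_assoc, ← mul_assoc, e.gen_mul_gen hne, neg_mul, neg_mul, mul_assoc (e.gen a),
            h1, mul_assoc (e.gen a) (y * _), mul_assoc y, e.gen_mul_gen hne]
          noncomm_ring
        rw [h0, h2]
        noncomm_ring
    · rw [map_smul, map_sub, h, sub_neg_eq_add, ← two_smul ℝ, smul_smul, hf f h]
      norm_num

end CliffordFrame

/-- Functionals that are invariant under all `z ↦ -u ε(z) u`, with `u` in an orthonormal frame, are
determined by their value at `1`. -/
theorem exists_eq_smul_apply_one {M : Type*} [AddCommGroup M] [Module ℝ M] (hF : F.PosDef)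
    (e : CliffordFrame F) (x : CliffordAlgebra (-F)) :
    ∃ r : ℝ, ∀ f : CliffordAlgebra (-F) →ₗ[ℝ] M,
      (∀ a z, f (e.gen a * involute z * e.gen a) = -f z) → f x = r • f 1 := by
  obtain ⟨y, hy, hf⟩ := e.exists_twisted_commute (M := M) Finset.univ x
  obtain ⟨r, rfl⟩ := mem_range_of_twisted_commute hF y fun v => by
    rw [e.ι_eq_sum, Finset.sum_mul, Finset.mul_sum]
    refine Finset.sum_congr rfl fun a _ => ?_
    rw [smul_mul_assoc, mul_smul_comm, hy a (Finset.mem_univ a)]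
  refine ⟨r, fun f h => ?_⟩
  rw [hf f h, Algebra.algebraMap_eq_smul_one, map_smul]

/-- The normalised trace on the Clifford algebra. -/
noncomputable def cliffordTrace (F : QuadraticForm ℝ V) :
    CliffordAlgebra (-F) →ₗ[ℝ] ℝ :=
  (Module.finrank ℝ (CliffordAlgebra (-F)) : ℝ)⁻¹ •
    (LinearMap.trace ℝ (CliffordAlgebra (-F)) ∘ₗ (Algebra.lmul ℝ (CliffordAlgebra (-F))).toLinearMap)

theorem finrank_clifford_ne_zero : (Module.finrank ℝ (CliffordAlgebra (-F)) : ℝ) ≠ 0 := by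
  have : Nontrivial (CliffordAlgebra (-F)) := inferInstance
  exact_mod_cast (Module.finrank_pos (R := ℝ)).ne'

theorem trace_lmul (x : CliffordAlgebra (-F)) :
    LinearMap.trace ℝ _ (LinearMap.mulLeft ℝ x) =
      Module.finrank ℝ (CliffordAlgebra (-F)) * cliffordTrace F x := by
  rw [cliffordTrace, LinearMap.smul_apply, smul_eq_mul, mul_inv_cancel_left₀ finrank_clifford_ne_zero]
  rfl

theorem cliffordTrace_one : cliffordTrace F 1 = 1 := by
  refine mul_left_cancel₀ (finrank_clifford_ne_zero (F := F)) ?_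
  rw [← trace_lmul, LinearMap.mulLeft_one, mul_one]
  exact LinearMap.trace_one ℝ _

theorem trace_mulLeft_mul (x y : CliffordAlgebra (-F)) :
    LinearMap.trace ℝ _ (LinearMap.mulLeft ℝ (x * y)) =
      LinearMap.trace ℝ _ (LinearMap.mulLeft ℝ (y * x)) := by
  rw [LinearMap.mulLeft_mul, LinearMap.trace_comp_comm', ← LinearMap.mulLeft_mul]

theorem cliffordTrace_mul_comm (x y : CliffordAlgebra (-F)) :
    cliffordTrace F (x * y) = cliffordTrace F (y * x) :=
  mul_left_cancel₀ (finrank_clifford_ne_zero (F := F)) (by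
    rw [← trace_lmul, ← trace_lmul, trace_mulLeft_mul])

theorem cliffordTrace_involute (x : CliffordAlgebra (-F)) :
    cliffordTrace F (involute x) = cliffordTrace F x := by
  refine mul_left_cancel₀ (finrank_clifford_ne_zero (F := F)) ?_
  rw [← trace_lmul, ← trace_lmul]
  refine (trace_eq_of_equiv (V := CliffordAlgebra (-F)) involuteEquiv.toLinearEquiv _ _ fun y => ?_).symm
  exact map_mul involute x y

theorem map_gen_of_tracial (e : CliffordFrame F) {M : Type*} [AddCommGroup M] [Module ℝ M]
    (f : CliffordAlgebra (-F) →ₗ[ℝ] M) (h1 : ∀ x y, f (x * y) = f (y * x))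
    (h2 : ∀ x, f (involute x) = f x) (a) (z) : f (e.gen a * involute z * e.gen a) = -f z := by
  rw [h1, e.gen_mul_mul_gen, map_neg, h2]

theorem eq_cliffordTrace_smul {M : Type*} [AddCommGroup M] [Module ℝ M] (hF : F.PosDef)
    (e : CliffordFrame F) (f : CliffordAlgebra (-F) →ₗ[ℝ] M)
    (h : ∀ a z, f (e.gen a * involute z * e.gen a) = -f z) (x : CliffordAlgebra (-F)) :
    f x = cliffordTrace F x • f 1 := by
  obtain ⟨r, hr⟩ := exists_eq_smul_apply_one (M := M × ℝ) hF e x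
  -- Pairing `f` with the normalised trace forces one scalar r to serve for both.
  have key := hr (f.prod (cliffordTrace F)) fun a z => by
    simp only [LinearMap.prod_apply, Function.prod_apply, h,
      map_gen_of_tracial e (cliffordTrace F) cliffordTrace_mul_comm cliffordTrace_involute]
    rfl
  have k1 : f x = r • f 1 := congrArg Prod.fst key
  have k2 : cliffordTrace F x = r • cliffordTrace F 1 := congrArg Prod.snd key
  rw [cliffordTrace_one, smul_eq_mul, mul_one] at k2
  rw [k1, k2]

theorem cliffordTrace_star (hF : F.PosDef) (x : CliffordAlgebra (-F)) :
    cliffordTrace F (star x) = cliffordTrace F x := by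
  obtain ⟨e⟩ := nonempty_cliffordFrame hF
  let st : CliffordAlgebra (-F) →ₗ[ℝ] CliffordAlgebra (-F) :=
    reverse ∘ₗ (involute (Q := -F)).toLinearMap
  have hst (y) : (cliffordTrace F ∘ₗ st) y = cliffordTrace F (star y) :=
    congrArg (cliffordTrace F) (star_def y).symm
  have h := eq_cliffordTrace_smul hF e (cliffordTrace F ∘ₗ st) (fun a z => by
    have h1 : star (e.gen a) = -e.gen a := star_ι _
    have h2 : star (involute z) = involute (star z) := by
      rw [star_def, star_def, reverse_involute]
    rw [hst, hst, star_mul, star_mul, h1, h2, neg_mul,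
      mul_neg, mul_neg, neg_neg, ← mul_assoc]
    exact map_gen_of_tracial e _ cliffordTrace_mul_comm cliffordTrace_involute a _) x
  rw [hst, hst, star_one, cliffordTrace_one,
    smul_eq_mul, mul_one] at h
  exact h

theorem trace_mulRight (hF : F.PosDef) (x : CliffordAlgebra (-F)) :
    LinearMap.trace ℝ _ (LinearMap.mulRight ℝ x) =
      Module.finrank ℝ (CliffordAlgebra (-F)) * cliffordTrace F x := by
  rw [← cliffordTrace_star hF, ← trace_lmul]
  let st : CliffordAlgebra (-F) ≃ₗ[ℝ] CliffordAlgebra (-F) :=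
    LinearEquiv.ofInvolutive (reverse ∘ₗ (involute (Q := -F)).toLinearMap) fun x => by
      change star (star x) = x
      exact star_star x
  refine trace_eq_of_equiv (V := CliffordAlgebra (-F)) st _ _ fun y => ?_
  exact star_mul y x

/-- For fixed even h this is, as a function of g, tracial and invariant under the main involution,
hence a multiple of the normalised trace. -/
theorem trace_mulLeft_mulRight (hF : F.PosDef) (g h : CliffordAlgebra (-F)) (hh : involute h = h) :
    LinearMap.trace ℝ _ (LinearMap.mulLeft ℝ g ∘ₗ LinearMap.mulRight ℝ h) =
      Module.finrank ℝ (CliffordAlgebra (-F)) * (cliffordTrace F g * cliffordTrace F h) := by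
  obtain ⟨e⟩ := nonempty_cliffordFrame hF
  let f : CliffordAlgebra (-F) →ₗ[ℝ] ℝ := LinearMap.trace ℝ _ ∘ₗ
    (LinearMap.mulRight ℝ (LinearMap.mulRight ℝ h)) ∘ₗ
      (Algebra.lmul ℝ (CliffordAlgebra (-F))).toLinearMap
  have hf (x) : f x = LinearMap.trace ℝ _ (LinearMap.mulLeft ℝ x ∘ₗ LinearMap.mulRight ℝ h) := rfl
  have key := eq_cliffordTrace_smul hF e f (map_gen_of_tracial e f (fun x y => ?_) fun x => ?_) g
  · rw [← hf, key, hf, LinearMap.mulLeft_one, LinearMap.id_comp, trace_mulRight hF, smul_eq_mul]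
    ring
  · rw [hf, hf, LinearMap.mulLeft_mul, LinearMap.mulLeft_mul, LinearMap.comp_assoc,
      LinearMap.trace_comp_comm']
    congr 1
    ext z
    simp [mul_assoc]
  · rw [hf, hf]
    refine (trace_eq_of_equiv (V := CliffordAlgebra (-F)) involuteEquiv.toLinearEquiv _ _
      fun y => ?_).symm
    change involute (x * (y * h)) = involute x * (involute y * h)
    rw [map_mul, map_mul, hh]

/-- As a function of g this is again a multiple of the normalised trace, which vanishes on odd
elements. -/
theorem trace_mulLeft_mulRight_involute (hF : F.PosDef) (g h : CliffordAlgebra (-F))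
    (hg : involute g = -g) (hh : involute h = -h) :
    LinearMap.trace ℝ _ (LinearMap.mulLeft ℝ g ∘ₗ LinearMap.mulRight ℝ h ∘ₗ
      (involute (Q := -F)).toLinearMap) = 0 := by
  have hg0 : cliffordTrace F g = 0 := by
    have := cliffordTrace_involute g
    rw [hg, map_neg] at this
    linarith
  obtain ⟨e⟩ := nonempty_cliffordFrame hF
  set T := LinearMap.mulRight ℝ h ∘ₗ (involute (Q := -F)).toLinearMap with hT
  let f : CliffordAlgebra (-F) →ₗ[ℝ] ℝ := LinearMap.trace ℝ _ ∘ₗ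
    (LinearMap.mulRight ℝ (A := Module.End ℝ (CliffordAlgebra (-F))) T) ∘ₗ
      (Algebra.lmul ℝ (CliffordAlgebra (-F))).toLinearMap
  have hf (x) : f x = LinearMap.trace ℝ _ (LinearMap.mulLeft ℝ x ∘ₗ T) := rfl
  have key := eq_cliffordTrace_smul hF e f (fun a z => ?_) g
  · rw [← hf, key, hg0, zero_smul]
  · have h1 : f (involute z) = -f z := by
      rw [hf, hf, ← map_neg]
      refine (trace_eq_of_equiv (V := CliffordAlgebra (-F)) involuteEquiv.toLinearEquiv _ _
        fun y => ?_).symm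
      change involute (-(z * (involute y * h))) = involute z * (involute (involute y) * h)
      rw [map_neg, map_mul, map_mul, hh, mul_neg, mul_neg, neg_neg]
    rw [← h1, hf, hf, mul_assoc, LinearMap.mulLeft_mul, LinearMap.comp_assoc,
      LinearMap.trace_comp_comm']
    congr 1
    refine LinearMap.ext fun y => ?_
    simp only [LinearMap.comp_apply, LinearMap.mulLeft_apply, hT, LinearMap.mulRight_apply,
      AlgHom.toLinearMap_apply, map_mul, e.involute_gen]
    have := e.gen_mul_mul_gen a (involute y * h)
    simp only [mul_assoc, neg_mul, mul_neg, this, neg_neg]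

end CliffordTrace

/-! ### Traces of isometries on the exterior algebra. -/

section CliffordIsometry

open CliffordAlgebra

variable {V : Type*} [AddCommGroup V] [Module ℝ V] [FiniteDimensional ℝ V]
  {F : QuadraticForm ℝ V}

theorem equivExterior_map (w : (-F) →qᵢ (-F)) (x : CliffordAlgebra (-F)) :
    equivExterior (-F) (CliffordAlgebra.map w x) =
      ExteriorAlgebra.map w.toLinearMap (equivExterior (-F) x) := by
  have hB := changeForm.associated_neg_proof (Q := -F)
  change changeForm hB (CliffordAlgebra.map w x) =
    ExteriorAlgebra.map w.toLinearMap (changeForm hB x)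
  induction x using CliffordAlgebra.left_induction with
  | algebraMap r =>
    rw [AlgHom.commutes, changeForm_algebraMap]
    exact (AlgHom.commutes (ExteriorAlgebra.map w.toLinearMap) r).symm
  | add x y hx hy => simp only [map_add, hx, hy]
  | ι_mul y v hy =>
    have hinv : (QuadraticMap.associated (R := ℝ) (M := V) (-(-F)) (w v)) ∘ₗ w.toLinearMap =
        QuadraticMap.associated (R := ℝ) (M := V) (-(-F)) v := by
      refine LinearMap.ext fun z => ?_
      have h1 (z : V) : (-(-F)) (w z) = (-(-F)) z := by
        have := w.map_app z
        simpa using this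
      change QuadraticMap.associated (R := ℝ) (M := V) (-(-F)) (w v) (w z) = _
      simp only [QuadraticMap.associated_apply, ← map_add, h1]
    rw [map_mul, CliffordAlgebra.map_apply_ι, changeForm_ι_mul, changeForm_ι_mul, hy,
      contractLeft_map, hinv, map_sub]
    congr 1
    refine Eq.trans ?_ (map_mul (ExteriorAlgebra.map w.toLinearMap) _ _).symm
    congr 1
    exact (ExteriorAlgebra.map_apply_ι w.toLinearMap v).symm

/-- Elements of the Lipschitz group are products of vectors and their inverses, so they are
homogeneous for the parity. -/
theorem involute_eq_of_mem_pinGroup {q : QuadraticForm ℝ V} {g : CliffordAlgebra q}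
    (hg : g ∈ pinGroup q) : involute g = g ∨ involute g = -g := by
  obtain ⟨x, hx, rfl⟩ := pinGroup.mem_lipschitzGroup hg
  change involute (x : CliffordAlgebra q) = x ∨ involute (x : CliffordAlgebra q) = -x
  clear hg
  induction hx using Subgroup.closure_induction with
  | mem x hx =>
    obtain ⟨v, hv⟩ := hx
    right
    rw [← hv, involute_ι]
  | one => left; simp
  | mul x y _ _ hx hy =>
    rw [Units.val_mul, map_mul]
    rcases hx with hx | hx <;> rcases hy with hy | hy <;> rw [hx, hy] <;> simp
  | inv x _ hx =>
    have h1 : involute (↑x⁻¹ : CliffordAlgebra q) * involute (x : CliffordAlgebra q) = 1 := by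
      rw [← map_mul, Units.inv_mul, map_one]
    rcases hx with hx | hx
    · left
      rw [hx] at h1
      exact eq_comm.mp (Units.inv_eq_of_mul_eq_one_left h1)
    · right
      rw [hx, mul_neg, ← neg_mul] at h1
      exact neg_eq_iff_eq_neg.mp (Units.inv_eq_of_mul_eq_one_left h1).symm

/-- Transported to the Clifford algebra, w acts by x ↦ g x g* for even g and by x ↦ g ε(x) g* for
odd g. The even case gives 2^d τ(g)τ(g*) with τ(g*) = τ(g); in the odd case both sides vanish. -/
theorem trace_exteriorAlgebra_map_eq (hF : F.PosDef) (w : V →ₗ[ℝ] V) (hw : ∀ v, F (w v) = F v)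
    (g : CliffordAlgebra (-F)) (hg : g ∈ pinGroup (-F))
    (h : ∀ v, involute g * ι (-F) v = ι (-F) (w v) * g) :
    LinearMap.trace ℝ _ (ExteriorAlgebra.map w).toLinearMap =
      Module.finrank ℝ (CliffordAlgebra (-F)) * cliffordTrace F g ^ 2 := by
  let w' : (-F) →qᵢ (-F) := { w with map_app' := fun v => congrArg Neg.neg (hw v) }
  have h1 : LinearMap.trace ℝ _ (CliffordAlgebra.map w').toLinearMap =
      LinearMap.trace ℝ _ (ExteriorAlgebra.map w).toLinearMap :=
    trace_eq_of_equiv (V := ExteriorAlgebra ℝ V) (equivExterior (-F)) _ _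
      fun x => equivExterior_map w' x
  have hstar : g * star g = 1 := pinGroup.mul_star_self_of_mem hg
  have hw' (v : V) (x : CliffordAlgebra (-F)) : CliffordAlgebra.map w' (ι (-F) v * x) =
      ι (-F) (w v) * CliffordAlgebra.map w' x := by
    rw [map_mul, CliffordAlgebra.map_apply_ι]
    rfl
  rw [← h1]
  rcases involute_eq_of_mem_pinGroup hg with hi | hi
  · have hs : involute (star g) = star g := by
      rw [star_def, hi, ← reverse_involute, hi]
    have : (CliffordAlgebra.map w').toLinearMap =
        LinearMap.mulLeft ℝ g ∘ₗ LinearMap.mulRight ℝ (star g) := by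
      refine LinearMap.ext fun x => ?_
      change CliffordAlgebra.map w' x = g * (x * star g)
      induction x using CliffordAlgebra.left_induction with
      | algebraMap r =>
        rw [AlgHom.commutes, ← mul_assoc, ← Algebra.commutes, mul_assoc, hstar, mul_one]
      | add x y hx hy => rw [map_add, hx, hy, add_mul, mul_add]
      | ι_mul x v hx =>
        rw [hw', hx, ← mul_assoc (ι (-F) (w v)), ← h, hi]
        simp only [mul_assoc]
    rw [this, trace_mulLeft_mulRight hF g _ hs, cliffordTrace_star hF, sq]
  · have hs : involute (star g) = -star g := by
      rw [star_def, ← reverse_involute, involute_involute, hi, map_neg, neg_neg]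
    have : (CliffordAlgebra.map w').toLinearMap =
        LinearMap.mulLeft ℝ g ∘ₗ LinearMap.mulRight ℝ (star g) ∘ₗ
          (involute (Q := -F)).toLinearMap := by
      refine LinearMap.ext fun x => ?_
      change CliffordAlgebra.map w' x = g * (involute x * star g)
      induction x using CliffordAlgebra.left_induction with
      | algebraMap r =>
        rw [AlgHom.commutes, AlgHom.commutes, ← mul_assoc, ← Algebra.commutes, mul_assoc, hstar,
          mul_one]
      | add x y hx hy => rw [map_add, hx, hy, map_add, add_mul, mul_add]
      | ι_mul x v hx =>
        rw [hw', hx, ← mul_assoc (ι (-F) (w v)), ← h, hi, map_mul, involute_ι]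
        simp only [mul_assoc, neg_mul, mul_neg]
    have hg0 : cliffordTrace F g = 0 := by
      have := cliffordTrace_involute g
      rw [hi, map_neg] at this
      linarith
    rw [this, trace_mulLeft_mulRight_involute hF g _ hi hs, hg0]
    simp

end CliffordIsometry

/-! ### The spin cover: surjectivity and finiteness. -/

section SpinCover

open RootPairing.weylGroup (ofIdx)
open CliffordAlgebra

variable {ι V₀ N : Type u} [AddCommGroup V₀] [Module ℝ V₀] [AddCommGroup N] [Module ℝ N]
  {P : RootPairing ι ℝ V₀ N} {b : P.Base} [Finite ι] [P.IsCrystallographic] [P.IsReduced]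
  [FiniteDimensional ℝ V₀] (Q : InvariantForm P)

theorem extTrace_proj (g : spinCover Q) : extTrace (spinCover.proj Q g) =
    Module.finrank ℝ (Cliff Q) * cliffordTrace Q.form (g.1.2 : Cliff Q) ^ 2 := by
  rw [extTrace, ← trace_exteriorAlgebra_map]
  exact trace_exteriorAlgebra_map_eq Q.posDef _ (fun v => Q.invariant _ v) _ g.1.2.2 g.2

/-- Compare the polar form of α and v with that of s(α) = −α and s(v). -/
theorem polar_root (i : ι) (v : V₀) :
    QuadraticMap.polar Q.form (P.root i) v = P.coroot' i v * Q.form (P.root i) := by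
  have hinv (x y : V₀) : QuadraticMap.polar Q.form (ofIdx P i • x) (ofIdx P i • y) =
      QuadraticMap.polar Q.form x y := by
    simp only [QuadraticMap.polar, ← smul_add, Q.invariant]
  have h1 : ofIdx P i • P.root i = -P.root i := by
    rw [ofIdx_smul_vec]
    have : P.coroot' i (P.root i) = 2 := by simp
    rw [this, two_smul]
    abel
  have h2 := hinv (P.root i) v
  rw [h1, ofIdx_smul_vec, QuadraticMap.polar_neg_left, QuadraticMap.polar_sub_right,
    QuadraticMap.polar_smul_right, QuadraticMap.polar_self, smul_eq_mul, two_smul] at h2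
  linarith

/-- The unit vector along the root, viewed in the Clifford algebra, lies over the reflection. -/
theorem exists_spin_lift_ofIdx (i : ι) : ∃ g : spinCover Q, spinCover.proj Q g = ofIdx P i := by
  have hpos : 0 < Q.form (P.root i) := Q.posDef _ (P.ne_zero i)
  set c := (Real.sqrt (Q.form (P.root i)))⁻¹ with hc
  have hcc : c * c * Q.form (P.root i) = 1 := by
    rw [hc, ← mul_inv, Real.mul_self_sqrt hpos.le, inv_mul_cancel₀ hpos.ne']
  set g : Cliff Q := CliffordAlgebra.ι (-Q.form) (c • P.root i) with hg
  have hgg : g * g = -1 := by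
    rw [hg, ι_sq_scalar, neg_apply, QuadraticMap.map_smul, smul_eq_mul, hcc, map_neg, map_one]
  have hu : g ∈ pinGroup (-Q.form) := by
    let x : (Cliff Q)ˣ := ⟨g, -g, by rw [mul_neg, hgg, neg_neg], by rw [neg_mul, hgg, neg_neg]⟩
    refine pinGroup.mem_iff.mpr ⟨⟨x, Subgroup.subset_closure ⟨_, rfl⟩, rfl⟩, ?_⟩
    have hs : star g = -g := star_ι _
    rw [Unitary.mem_iff, hs, neg_mul, mul_neg, hgg, neg_neg]
    exact ⟨rfl, rfl⟩
  refine ⟨⟨(ofIdx P i, ⟨g, hu⟩), fun v => ?_⟩, rfl⟩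
  change involute g * CliffordAlgebra.ι (-Q.form) v =
    CliffordAlgebra.ι (-Q.form) (ofIdx P i • v) * g
  have h1 : CliffordAlgebra.ι (-Q.form) v * g =
      algebraMap ℝ _ (-(c * (P.coroot' i v * Q.form (P.root i)))) -
        g * CliffordAlgebra.ι (-Q.form) v := by
    rw [← polar_root, eq_sub_iff_add_eq, add_comm, hg, ι_mul_ι_add_swap, FunLike.coe_neg,
      QuadraticMap.polar_neg, QuadraticMap.polar_smul_left, smul_eq_mul]
  have h2 : CliffordAlgebra.ι (-Q.form) (P.root i) * g =
      algebraMap ℝ _ (-(c * Q.form (P.root i))) := by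
    rw [hg, map_smul, mul_smul_comm, ι_sq_scalar, Algebra.smul_def, ← map_mul, neg_apply, mul_neg]
  rw [ofIdx_smul_vec, map_sub, map_smul, sub_mul, smul_mul_assoc, h1, h2, show involute g = -g from involute_ι _,
    Algebra.smul_def, ← map_mul (algebraMap ℝ (Cliff Q)), neg_mul]
  rw [show P.coroot' i v * -(c * Q.form (P.root i)) =
    -(c * (P.coroot' i v * Q.form (P.root i))) by ring]
  abel

theorem spinCover_proj_surjective (b : P.Base) : Function.Surjective (spinCover.proj Q) := by
  intro w
  induction w using weyl_induction b with
  | one => exact ⟨1, map_one _⟩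
  | mul i _ w ih =>
    obtain ⟨g, hg⟩ := ih
    obtain ⟨g', hg'⟩ := exists_spin_lift_ofIdx Q i
    exact ⟨g' * g, by rw [map_mul, hg, hg']⟩

theorem finite_spinCover (b : P.Base) : Finite (spinCover Q) := by
  have := finite_weylGroup b
  have hker : Finite (spinCover.proj Q).ker := by
    -- An element over 1 supercommutes with all vectors, so it is a real scalar r; membership in the
    -- Pin group gives r² = 1.
    have key (g : (spinCover.proj Q).ker) : ∃ r : ℤˣ,
        (g.1.1.2 : Cliff Q) = algebraMap ℝ _ ((r : ℤ) : ℝ) := by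
      have hg1 : g.1.1.1 = 1 := g.2
      obtain ⟨r, hr⟩ := mem_range_of_twisted_commute Q.posDef (g.1.1.2 : Cliff Q) fun v => by
        have := g.1.2 v
        rw [hg1, one_smul] at this
        exact this.symm
      have h1 := pinGroup.star_mul_self_of_mem g.1.1.2.2
      rw [hr, star_algebraMap, ← map_mul, ← map_one (algebraMap ℝ (Cliff Q))] at h1
      have h2 := (FaithfulSMul.algebraMap_injective ℝ (Cliff Q)) h1
      rcases mul_self_eq_one_iff.mp h2 with h | h
      · exact ⟨1, by rw [hr, h]; simp⟩
      · exact ⟨-1, by rw [hr, h]; simp⟩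
    choose r hr using key
    refine Finite.of_injective r fun g g' h => ?_
    apply Subtype.ext
    apply Subtype.ext
    refine Prod.ext ((show g.1.1.1 = 1 from g.2).trans (show g'.1.1.1 = 1 from g'.2).symm) ?_
    apply Subtype.ext
    rw [hr, hr, h]
  choose s hs using spinCover_proj_surjective Q b
  refine Finite.of_injective (β := P.weylGroup × (spinCover.proj Q).ker)
    (fun g => (spinCover.proj Q g, ⟨g * (s (spinCover.proj Q g))⁻¹, by
      rw [MonoidHom.mem_ker, map_mul, map_inv, hs, mul_inv_cancel]⟩)) fun g g' h => ?_
  have h1 := congrArg Prod.fst h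
  have h2 := congrArg (fun x => (x.2 : spinCover Q)) h
  dsimp only at h1 h2
  rw [h1] at h2
  exact mul_right_cancel h2

end SpinCover

/-! ### Averages along a surjection of finite groups. -/

section Average

theorem average_comp_surjective {G H : Type*} [Group G] [Group H] [Finite G] [Fintype H]
    (f : G →* H) (hf : Function.Surjective f) (φ : H → ℂ) :
    (Nat.card G : ℂ)⁻¹ * ∑ᶠ g, φ (f g) = (Fintype.card H : ℂ)⁻¹ * ∑ h, φ h := by
  classical
  have := Fintype.ofFinite G
  set c := (Finset.univ.filter fun g => f g = 1).card with hc
  -- All fibres are cosets of the kernel.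
  have hcard (h : H) : (Finset.univ.filter fun g => f g = h).card = c :=
    MonoidHom.card_fiber_eq_of_mem_range f (hf h) (hf 1)
  have key (ψ : H → ℂ) : ∑ g, ψ (f g) = c * ∑ h, ψ h := by
    rw [← Finset.sum_fiberwise Finset.univ f, Finset.mul_sum]
    refine Finset.sum_congr rfl fun h _ => ?_
    rw [Finset.sum_congr rfl fun g hg => by rw [(Finset.mem_filter.mp hg).2], Finset.sum_const,
      hcard, nsmul_eq_mul]
  have hG : (Fintype.card G : ℂ) = c * Fintype.card H := by
    have := key fun _ => 1
    simpa using this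
  have hc0 : (c : ℂ) ≠ 0 := by
    intro h0
    rw [h0, zero_mul] at hG
    exact Fintype.card_ne_zero (by exact_mod_cast hG)
  rw [finsum_eq_sum_of_fintype, key, Nat.card_eq_fintype_card, hG, mul_inv]
  field_simp

end Average

/-! ### The separability idempotent and dimensions of spaces of intertwiners. -/

section Separability

open CliffordAlgebra

variable {V : Type*} [AddCommGroup V] [Module ℝ V] [FiniteDimensional ℝ V]
  {F : QuadraticForm ℝ V}

theorem finrank_clifford (F : QuadraticForm ℝ V) :
    Module.finrank ℝ (CliffordAlgebra F) = 2 ^ Module.finrank ℝ V := by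
  rw [(equivExterior F).finrank_eq]
  have h := trace_exteriorAlgebra_map (LinearMap.id : V →ₗ[ℝ] V)
  rw [ExteriorAlgebra.map_id] at h
  have h1 : (AlgHom.id ℝ (ExteriorAlgebra ℝ V)).toLinearMap = LinearMap.id := rfl
  simp only [h1, extMap_id, LinearMap.trace_id, exteriorPower.finrank_eq] at h
  rw [← Nat.sum_range_choose]
  exact_mod_cast h

/-- The space of intertwiners between two representations of an algebra. -/
def intertwiners {A K M N : Type*} [Ring A] [Algebra ℝ A] [Field K] [Algebra ℝ K]
    [AddCommGroup M] [Module K M] [Module ℝ M] [IsScalarTower ℝ K M]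
    [AddCommGroup N] [Module K N] [Module ℝ N] [IsScalarTower ℝ K N]
    (ρ : A →ₐ[ℝ] Module.End K M) (σ : A →ₐ[ℝ] Module.End K N) : Submodule K (M →ₗ[K] N) where
  carrier := {φ | ∀ x, σ x ∘ₗ φ = φ ∘ₗ ρ x}
  zero_mem' x := by rw [LinearMap.comp_zero, LinearMap.zero_comp]
  add_mem' h h' x := by rw [LinearMap.comp_add, LinearMap.add_comp, h x, h' x]
  smul_mem' c φ h x := by rw [LinearMap.comp_smul, LinearMap.smul_comp, h x]

variable {K M N : Type*} [Field K] [Algebra ℝ K]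
    [AddCommGroup M] [Module K M] [Module ℝ M] [IsScalarTower ℝ K M] [Module.Finite K M]
    [AddCommGroup N] [Module K N] [Module ℝ N] [IsScalarTower ℝ K N] [Module.Finite K N]
    (ρ : CliffordAlgebra (-F) →ₐ[ℝ] Module.End K M) (σ : CliffordAlgebra (-F) →ₐ[ℝ] Module.End K N)

/-- The action of `A ⊗ A` on linear maps: `x ⊗ y` sends `φ` to `x φ y`. -/
noncomputable def bimoduleAction : CliffordAlgebra (-F) ⊗[ℝ] CliffordAlgebra (-F) →ₗ[ℝ]
    Module.End K (M →ₗ[K] N) :=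
  TensorProduct.lift (LinearMap.mk₂ ℝ
    (fun x y => LinearMap.compRight K (σ x) ∘ₗ LinearMap.lcomp K N (ρ y))
    (fun x x' y => by ext φ m; simp) (fun c x y => by ext φ m; simp)
    (fun x y y' => by ext φ m; simp)
    (fun c x y => by
      ext φ m
      simp only [map_smul, LinearMap.comp_apply, LinearMap.compRight_apply, LinearMap.lcomp_apply',
        LinearMap.smul_apply, LinearMap.map_smul_of_tower]))

theorem bimoduleAction_tmul (x y : CliffordAlgebra (-F)) (φ : M →ₗ[K] N) :
    bimoduleAction ρ σ (x ⊗ₜ y) φ = σ x ∘ₗ φ ∘ₗ ρ y := rfl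

theorem trace_bimoduleAction_tmul (x y : CliffordAlgebra (-F)) :
    LinearMap.trace K _ (bimoduleAction ρ σ (x ⊗ₜ y)) =
      LinearMap.trace K N (σ x) * LinearMap.trace K M (ρ y) :=
  trace_comp_hom _ _ _ fun φ => bimoduleAction_tmul ρ σ x y φ

/-- The element of `A ⊗ A` that belongs to a list of generators. -/
noncomputable def sepElement (e : CliffordFrame F) :
    List (Fin (Module.finrank ℝ V)) → CliffordAlgebra (-F) ⊗[ℝ] CliffordAlgebra (-F)
  | [] => 1 ⊗ₜ 1
  | a :: l => (2⁻¹ : ℝ) • (sepElement e l - TensorProduct.map (LinearMap.mulLeft ℝ (e.gen a))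
      (LinearMap.mulRight ℝ (e.gen a)) (sepElement e l))

variable (e : CliffordFrame F)

theorem bimoduleAction_sepElement_cons (a) (l : List (Fin (Module.finrank ℝ V)))
    (φ : M →ₗ[K] N) :
    bimoduleAction ρ σ (sepElement e (a :: l)) φ =
      (2⁻¹ : ℝ) • (bimoduleAction ρ σ (sepElement e l) φ -
        σ (e.gen a) ∘ₗ bimoduleAction ρ σ (sepElement e l) φ ∘ₗ ρ (e.gen a)) := by
  have h (z : CliffordAlgebra (-F) ⊗[ℝ] CliffordAlgebra (-F)) :
      bimoduleAction ρ σ (TensorProduct.map (LinearMap.mulLeft ℝ (e.gen a))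
      (LinearMap.mulRight ℝ (e.gen a)) z) φ =
        σ (e.gen a) ∘ₗ bimoduleAction ρ σ z φ ∘ₗ ρ (e.gen a) := by
    induction z with
    | zero => simp
    | add x y hx hy =>
      simp only [map_add, LinearMap.add_apply, hx, hy, LinearMap.add_comp, LinearMap.comp_add]
    | tmul x y =>
      rw [TensorProduct.map_tmul, bimoduleAction_tmul, bimoduleAction_tmul,
        LinearMap.mulLeft_apply, LinearMap.mulRight_apply, map_mul, map_mul]
      rfl
  rw [sepElement, map_smul, map_sub, LinearMap.smul_apply, LinearMap.sub_apply, h]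

theorem comp_gen_comp_gen (ρ : CliffordAlgebra (-F) →ₐ[ℝ] Module.End K M) (a) :
    ρ (e.gen a) ∘ₗ ρ (e.gen a) = -LinearMap.id := by
  change ρ (e.gen a) * ρ (e.gen a) = -1
  rw [← map_mul, e.gen_mul_gen_self, map_neg, map_one]

theorem comp_gen_anticomm (ρ : CliffordAlgebra (-F) →ₐ[ℝ] Module.End K M) {a b} (h : a ≠ b) :
    ρ (e.gen a) ∘ₗ ρ (e.gen b) = -(ρ (e.gen b) ∘ₗ ρ (e.gen a)) := by
  change ρ (e.gen a) * ρ (e.gen b) = -(ρ (e.gen b) * ρ (e.gen a))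
  rw [← map_mul, e.gen_mul_gen h, map_neg, map_mul]

/-- Each step replaces φ by ½(φ − uφu), which commutes with u because u² = −1. Anticommutation with
the other generators preserves what earlier steps achieved. -/
theorem gen_comp_bimoduleAction (l : List (Fin (Module.finrank ℝ V))) (hl : l.Nodup)
    (φ : M →ₗ[K] N) : ∀ b ∈ l, σ (e.gen b) ∘ₗ bimoduleAction ρ σ (sepElement e l) φ =
      bimoduleAction ρ σ (sepElement e l) φ ∘ₗ ρ (e.gen b) := by
  induction l with
  | nil => simp
  | cons a l ih =>
    intro b hb
    rw [List.nodup_cons] at hl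
    rw [bimoduleAction_sepElement_cons]
    set ψ := bimoduleAction ρ σ (sepElement e l) φ
    rw [LinearMap.comp_smul, LinearMap.smul_comp]
    congr 1
    rw [LinearMap.comp_sub, LinearMap.sub_comp]
    rcases List.mem_cons.mp hb with rfl | hb'
    · have h1 : σ (e.gen b) ∘ₗ σ (e.gen b) ∘ₗ ψ ∘ₗ ρ (e.gen b) = -(ψ ∘ₗ ρ (e.gen b)) := by
        rw [← LinearMap.comp_assoc, comp_gen_comp_gen, LinearMap.neg_comp, LinearMap.id_comp]
      have h2 : (σ (e.gen b) ∘ₗ ψ ∘ₗ ρ (e.gen b)) ∘ₗ ρ (e.gen b) = -(σ (e.gen b) ∘ₗ ψ) := by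
        rw [LinearMap.comp_assoc, LinearMap.comp_assoc, comp_gen_comp_gen, LinearMap.comp_neg,
          LinearMap.comp_id, LinearMap.comp_neg]
      rw [h1, h2]
      abel
    · have hne : b ≠ a := by rintro rfl; exact hl.1 hb'
      have h0 := ih hl.2 b hb'
      rw [← LinearMap.comp_assoc, comp_gen_anticomm e σ hne, LinearMap.neg_comp,
        LinearMap.comp_assoc, ← LinearMap.comp_assoc (ρ _) ψ, h0, LinearMap.comp_assoc,
        comp_gen_anticomm e ρ hne]
      simp only [LinearMap.comp_neg, LinearMap.comp_assoc, neg_neg]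

theorem bimoduleAction_sepElement_of_mem (l : List (Fin (Module.finrank ℝ V)))
    (φ : M →ₗ[K] N) (hφ : φ ∈ intertwiners ρ σ) :
    bimoduleAction ρ σ (sepElement e l) φ = φ := by
  induction l with
  | nil =>
    rw [sepElement, bimoduleAction_tmul, map_one, map_one]
    rfl
  | cons a l ih =>
    rw [bimoduleAction_sepElement_cons, ih, ← LinearMap.comp_assoc, hφ, LinearMap.comp_assoc,
      comp_gen_comp_gen, LinearMap.comp_neg, LinearMap.comp_id, sub_neg_eq_add, ← two_smul ℝ,
      smul_smul]
    norm_num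

theorem mem_intertwiners_of_gen (φ : M →ₗ[K] N)
    (h : ∀ a, σ (e.gen a) ∘ₗ φ = φ ∘ₗ ρ (e.gen a)) : φ ∈ intertwiners ρ σ := by
  intro x
  induction x using CliffordAlgebra.induction with
  | algebraMap r =>
    rw [AlgHom.commutes, AlgHom.commutes]
    ext m
    simp [Module.algebraMap_end_apply, LinearMap.map_smul_of_tower]
  | ι v =>
    refine LinearMap.ext fun m => ?_
    simp only [e.ι_eq_sum, map_sum, map_smul, LinearMap.comp_apply, LinearMap.sum_apply,
      LinearMap.smul_apply, LinearMap.map_smul_of_tower]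
    exact Finset.sum_congr rfl fun a _ => congrArg _ (LinearMap.congr_fun (h a) m)
  | mul x y hx hy =>
    rw [map_mul, map_mul]
    change (σ x ∘ₗ σ y) ∘ₗ φ = φ ∘ₗ ρ x ∘ₗ ρ y
    rw [LinearMap.comp_assoc, hy, ← LinearMap.comp_assoc, hx, LinearMap.comp_assoc]
  | add x y hx hy =>
    rw [map_add, map_add, LinearMap.add_comp, LinearMap.comp_add, hx, hy]

/-- The separability element of the Clifford algebra. -/
noncomputable def sepIdempotent : CliffordAlgebra (-F) ⊗[ℝ] CliffordAlgebra (-F) :=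
  sepElement e (List.finRange _)

/-- The separability element acts as a projection onto the intertwiners, and the trace of a
projection is its rank. -/
theorem finrank_intertwiners :
    (Module.finrank K (intertwiners ρ σ) : K) =
      LinearMap.trace K _ (bimoduleAction ρ σ (sepIdempotent e)) := by
  have h : LinearMap.IsProj (intertwiners ρ σ) (bimoduleAction ρ σ (sepIdempotent e)) :=
    ⟨fun φ => mem_intertwiners_of_gen ρ σ e _ fun a =>
      gen_comp_bimoduleAction ρ σ e _ (List.nodup_finRange _) φ a (List.mem_finRange a),
      fun φ hφ => bimoduleAction_sepElement_of_mem ρ σ e _ φ hφ⟩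
  exact h.trace.symm

/-- The value of the normalised trace at the separability element. -/
noncomputable def sepTrace : ℝ :=
  TensorProduct.lift (LinearMap.mk₂ ℝ (fun x y => cliffordTrace F x * cliffordTrace F y)
    (fun _ _ _ => by rw [map_add, add_mul]) (fun _ _ _ => by rw [map_smul, smul_mul_assoc])
    (fun _ _ _ => by rw [map_add, mul_add]) (fun _ _ _ => by rw [map_smul, mul_smul_comm]))
    (sepIdempotent e)

theorem apply_sepIdempotent (L : CliffordAlgebra (-F) ⊗[ℝ] CliffordAlgebra (-F) →ₗ[ℝ] K) (c : K)
    (h : ∀ x y, L (x ⊗ₜ y) = (cliffordTrace F x * cliffordTrace F y) • c) :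
    L (sepIdempotent e) = sepTrace e • c := by
  have : L = (LinearMap.toSpanSingleton ℝ K c) ∘ₗ
      TensorProduct.lift (LinearMap.mk₂ ℝ (fun x y => cliffordTrace F x * cliffordTrace F y)
    (fun _ _ _ => by rw [map_add, add_mul]) (fun _ _ _ => by rw [map_smul, smul_mul_assoc])
    (fun _ _ _ => by rw [map_add, mul_add]) (fun _ _ _ => by rw [map_smul, mul_smul_comm])) := by
    apply TensorProduct.ext'
    intro x y
    rw [h]
    rfl
  rw [this]
  rfl

/-- Count the endomorphisms of the regular representation: they are the right multiplications, of
dimension D = dim Cliff, while the trace formula gives D² times the unknown. -/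
theorem sepTrace_eq : sepTrace e = (Module.finrank ℝ (CliffordAlgebra (-F)) : ℝ)⁻¹ := by
  let ρ : CliffordAlgebra (-F) →ₐ[ℝ] Module.End ℝ (CliffordAlgebra (-F)) :=
    Algebra.lmul ℝ (CliffordAlgebra (-F))
  let eqv : intertwiners ρ ρ ≃ₗ[ℝ] CliffordAlgebra (-F) :=
    { toFun := fun φ => φ.1 1
      map_add' := fun _ _ => rfl
      map_smul' := fun _ _ => rfl
      invFun := fun y => ⟨LinearMap.mulRight ℝ y, fun x => by
        ext z
        exact (mul_assoc x z y).symm⟩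
      left_inv := fun φ => by
        apply Subtype.ext
        refine LinearMap.ext fun x => ?_
        have := LinearMap.congr_fun (φ.2 x) 1
        refine this.trans ?_
        change φ.1 (x * 1) = _
        rw [mul_one]
      right_inv := fun y => one_mul y }
  have h1 := finrank_intertwiners ρ ρ e
  rw [eqv.finrank_eq] at h1
  have h2 := apply_sepIdempotent e (LinearMap.trace ℝ _ ∘ₗ bimoduleAction ρ ρ)
    ((Module.finrank ℝ (CliffordAlgebra (-F)) : ℝ) * Module.finrank ℝ (CliffordAlgebra (-F)))
    fun x y => by
      rw [LinearMap.comp_apply, trace_bimoduleAction_tmul]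
      refine (congrArg₂ (· * ·) (trace_lmul x) (trace_lmul y)).trans ?_
      rw [smul_eq_mul]
      ring
  rw [LinearMap.comp_apply, ← h1, smul_eq_mul] at h2
  have h0 := finrank_clifford_ne_zero (F := F)
  field_simp
  refine mul_left_cancel₀ h0 ?_
  rw [mul_one]
  linarith

end Separability

/-! ### Dimensions and characters of irreducible Clifford modules. -/

section CliffordReps

open CliffordAlgebra

variable {V : Type*} [AddCommGroup V] [Module ℝ V] [FiniteDimensional ℝ V]
  {F : QuadraticForm ℝ V}
variable {M N : Type*} [AddCommGroup M] [Module ℂ M] [Module.Finite ℂ M]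
  [AddCommGroup N] [Module ℂ N] [Module.Finite ℂ N]
  (ρ : CliffordAlgebra (-F) →ₐ[ℝ] Module.End ℂ M) (σ : CliffordAlgebra (-F) →ₐ[ℝ] Module.End ℂ N)

/-- The twist of a representation of the Clifford algebra by the main involution. -/
noncomputable def involuteRep : CliffordAlgebra (-F) →ₐ[ℝ] Module.End ℂ M := ρ.comp involute

theorem intertwiners_involute_left :
    intertwiners (involuteRep ρ) σ = intertwiners ρ (involuteRep σ) := by
  ext φ
  constructor
  · intro h x
    have := h (involute x)
    change σ (involute x) ∘ₗ φ = φ ∘ₗ ρ (involute (involute x)) at this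
    rwa [involute_involute] at this
  · intro h x
    have := h (involute x)
    change σ (involute (involute x)) ∘ₗ φ = φ ∘ₗ ρ (involute x) at this
    rwa [involute_involute] at this

theorem involuteRep_involuteRep : involuteRep (involuteRep ρ) = ρ := by
  exact AlgHom.ext fun x => congrArg ρ (involute_involute x)

theorem trace_eq_of_involute_invariant (hF : F.PosDef)
    (h : ∀ x, LinearMap.trace ℂ M (ρ (involute x)) = LinearMap.trace ℂ M (ρ x))
    (x : CliffordAlgebra (-F)) :
    LinearMap.trace ℂ M (ρ x) = cliffordTrace F x • (Module.finrank ℂ M : ℂ) := by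
  obtain ⟨e⟩ := nonempty_cliffordFrame hF
  let f : CliffordAlgebra (-F) →ₗ[ℝ] ℂ :=
    (LinearMap.trace ℂ M).restrictScalars ℝ ∘ₗ ρ.toLinearMap
  have hf (x) : f x = LinearMap.trace ℂ M (ρ x) := rfl
  have := eq_cliffordTrace_smul hF e f (map_gen_of_tracial e f (fun x y => by
    rw [hf, hf, map_mul ρ, map_mul ρ, LinearMap.trace_mul_comm]) h) x
  rw [← hf, this, hf, map_one, LinearMap.trace_one]

theorem trace_add_involute (hF : F.PosDef) (x : CliffordAlgebra (-F)) :
    LinearMap.trace ℂ M (ρ x) + LinearMap.trace ℂ M (involuteRep ρ x) =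
      cliffordTrace F x • (2 * Module.finrank ℂ M : ℂ) := by
  obtain ⟨e⟩ := nonempty_cliffordFrame hF
  let f : CliffordAlgebra (-F) →ₗ[ℝ] ℂ :=
    (LinearMap.trace ℂ M).restrictScalars ℝ ∘ₗ (ρ.toLinearMap + (involuteRep ρ).toLinearMap)
  have hf (x) : f x = LinearMap.trace ℂ M (ρ x) + LinearMap.trace ℂ M (involuteRep ρ x) :=
    map_add (LinearMap.trace ℂ M) _ _
  have := eq_cliffordTrace_smul hF e f (map_gen_of_tracial e f (fun x y => by
    rw [hf, hf, map_mul ρ, map_mul ρ, LinearMap.trace_mul_comm, map_mul (involuteRep ρ),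
      map_mul (involuteRep ρ), LinearMap.trace_mul_comm ℂ (involuteRep ρ x)]) fun x => by
        rw [hf, hf, add_comm]
        congr 1
        change LinearMap.trace ℂ M (ρ (involute (involute x))) = _
        rw [involute_involute]) x
  rw [← hf, this, hf, map_one ρ, map_one (involuteRep ρ), LinearMap.trace_one, two_mul]

/-- The sum of a character and its twist by the main involution is a multiple of the normalised
trace. Apply the separability element to all four combinations of twisted and untwisted
representations; the four spaces of intertwiners are equal in pairs. -/
theorem finrank_intertwiners_add (hF : F.PosDef) :
    (Module.finrank ℂ (intertwiners ρ σ) + Module.finrank ℂ (intertwiners ρ (involuteRep σ))) *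
      2 ^ Module.finrank ℝ V = 2 * (Module.finrank ℂ M * Module.finrank ℂ N) := by
  obtain ⟨e⟩ := nonempty_cliffordFrame hF
  let L : CliffordAlgebra (-F) ⊗[ℝ] CliffordAlgebra (-F) →ₗ[ℝ] ℂ :=
    (LinearMap.trace ℂ (M →ₗ[ℂ] N)).restrictScalars ℝ ∘ₗ
      (bimoduleAction ρ σ + bimoduleAction ρ (involuteRep σ) + bimoduleAction (involuteRep ρ) σ +
        bimoduleAction (involuteRep ρ) (involuteRep σ))
  have hL (z) : L z = LinearMap.trace ℂ _ (bimoduleAction ρ σ z) +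
      LinearMap.trace ℂ _ (bimoduleAction ρ (involuteRep σ) z) +
      LinearMap.trace ℂ _ (bimoduleAction (involuteRep ρ) σ z) +
      LinearMap.trace ℂ _ (bimoduleAction (involuteRep ρ) (involuteRep σ) z) := by
    simp only [← map_add]
    rfl
  have key := apply_sepIdempotent e L
    ((2 * Module.finrank ℂ N : ℂ) * (2 * Module.finrank ℂ M : ℂ)) fun x y => by
      rw [hL]
      simp only [trace_bimoduleAction_tmul]
      have h1 := trace_add_involute σ hF x
      have h2 := trace_add_involute ρ hF y
      rw [Complex.real_smul] at h1 h2 ⊢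
      push_cast
      linear_combination (LinearMap.trace ℂ M (ρ y) + LinearMap.trace ℂ M (involuteRep ρ y)) * h1 +
        cliffordTrace F x * (2 * Module.finrank ℂ N) * h2
  rw [hL] at key
  simp only [← finrank_intertwiners] at key
  rw [intertwiners_involute_left, intertwiners_involute_left, involuteRep_involuteRep,
    sepTrace_eq, finrank_clifford] at key
  have h0 : (2 ^ Module.finrank ℝ V : ℂ) ≠ 0 := pow_ne_zero _ two_ne_zero
  have key2 : ((Module.finrank ℂ (intertwiners ρ σ) : ℂ) +
      Module.finrank ℂ (intertwiners ρ (involuteRep σ))) *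
      2 ^ Module.finrank ℝ V = 2 * (Module.finrank ℂ M * Module.finrank ℂ N) := by
    rw [Complex.real_smul] at key
    push_cast at key
    field_simp at key
    linear_combination key / 2
  exact_mod_cast key2

/-- Irreducibility of a representation of the Clifford algebra. -/
def IsIrreducibleRep : Prop :=
  Nontrivial M ∧ ∀ p : Submodule ℂ M, (∀ x, ∀ m ∈ p, ρ x m ∈ p) → p = ⊥ ∨ p = ⊤

variable {ρ σ}

theorem IsIrreducibleRep.involuteRep (h : IsIrreducibleRep ρ) :
    IsIrreducibleRep (involuteRep ρ) := by
  refine ⟨h.1, fun p hp => h.2 p fun x m hm => ?_⟩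
  have := hp (involute x) m hm
  change ρ (involute (involute x)) m ∈ p at this
  rwa [involute_involute] at this

theorem bijective_of_mem_intertwiners (h : IsIrreducibleRep ρ) (h' : IsIrreducibleRep σ)
    {φ : M →ₗ[ℂ] N} (hφ : φ ∈ intertwiners ρ σ) (hne : φ ≠ 0) : Function.Bijective φ := by
  have hx (x m) : φ (ρ x m) = σ x (φ m) := (LinearMap.congr_fun (hφ x) m).symm
  constructor
  · rw [← LinearMap.ker_eq_bot]
    refine (h.2 (LinearMap.ker φ) fun x m hm => ?_).resolve_right fun ht => ?_
    · rw [LinearMap.mem_ker] at hm ⊢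
      rw [hx, hm, map_zero]
    · exact hne (LinearMap.ker_eq_top.mp ht)
  · rw [← LinearMap.range_eq_top]
    refine (h'.2 (LinearMap.range φ) ?_).resolve_left fun hb => ?_
    · rintro x _ ⟨m, rfl⟩
      exact ⟨ρ x m, hx x m⟩
    · exact hne (LinearMap.range_eq_bot.mp hb)

/-- Schur's lemma: a nonzero intertwiner is bijective, and subtracting an eigenvalue multiple of it
from another one creates a kernel. -/
theorem finrank_intertwiners_le_one (h : IsIrreducibleRep ρ) (h' : IsIrreducibleRep σ) :
    Module.finrank ℂ (intertwiners ρ σ) ≤ 1 := by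
  by_cases h0 : intertwiners ρ σ = ⊥
  · rw [h0, finrank_bot]; exact zero_le_one
  obtain ⟨φ₀, hφ₀, hne⟩ := Submodule.exists_mem_ne_zero_of_ne_bot h0
  have hbij := bijective_of_mem_intertwiners h h' hφ₀ hne
  let E := LinearEquiv.ofBijective φ₀ hbij
  have := h.1
  refine finrank_le_one ⟨φ₀, hφ₀⟩ fun φ => ?_
  obtain ⟨c, hc⟩ := Module.End.exists_eigenvalue (E.symm.toLinearMap ∘ₗ φ.1)
  obtain ⟨m, hm⟩ := hc.exists_hasEigenvector
  refine ⟨c, ?_⟩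
  have hmem : φ.1 - c • φ₀ ∈ intertwiners ρ σ :=
    Submodule.sub_mem _ φ.2 (Submodule.smul_mem _ _ hφ₀)
  have hz : (φ.1 - c • φ₀) m = 0 := by
    have h1 : E.symm (φ.1 m) = c • m := hm.apply_eq_smul
    rw [LinearEquiv.symm_apply_eq, map_smul] at h1
    exact sub_eq_zero.mpr h1
  by_contra hcon
  have hne' : φ.1 - c • φ₀ ≠ 0 := fun h => hcon (Subtype.ext (sub_eq_zero.mp h).symm)
  exact hm.2 ((bijective_of_mem_intertwiners h h' hmem hne').1 (hz.trans (map_zero _).symm))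

theorem finrank_intertwiners_self (h : IsIrreducibleRep ρ) :
    Module.finrank ℂ (intertwiners ρ ρ) = 1 := by
  refine le_antisymm (finrank_intertwiners_le_one h h) (Nat.one_le_iff_ne_zero.mpr fun h0 => ?_)
  rw [Submodule.finrank_eq_zero] at h0
  have h1 : LinearMap.id ∈ intertwiners ρ ρ := fun x => rfl
  rw [h0, Submodule.mem_bot] at h1
  have := h.1
  obtain ⟨m, hm⟩ := exists_ne (0 : M)
  exact hm (LinearMap.congr_fun h1 m)

theorem exists_equiv_of_finrank_ne_zero (h : IsIrreducibleRep ρ) (h' : IsIrreducibleRep σ)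
    (hr : Module.finrank ℂ (intertwiners ρ σ) ≠ 0) :
    ∃ E : M ≃ₗ[ℂ] N, ∀ x m, E (ρ x m) = σ x (E m) := by
  rw [ne_eq, Submodule.finrank_eq_zero] at hr
  obtain ⟨φ, hφ, hne⟩ := Submodule.exists_mem_ne_zero_of_ne_bot hr
  exact ⟨LinearEquiv.ofBijective φ (bijective_of_mem_intertwiners h h' hφ hne), fun x m =>
    (LinearMap.congr_fun (hφ x) m).symm⟩

theorem trace_rep_eq_of_finrank_ne_zero (h : IsIrreducibleRep ρ) (h' : IsIrreducibleRep σ)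
    (hr : Module.finrank ℂ (intertwiners ρ σ) ≠ 0) (x : CliffordAlgebra (-F)) :
    LinearMap.trace ℂ M (ρ x) = LinearMap.trace ℂ N (σ x) :=
  let ⟨E, hE⟩ := exists_equiv_of_finrank_ne_zero h h' hr
  trace_eq_of_equiv (V := N) E _ _ (hE x)

theorem two_pow_ne_two_mul_sq {d m : ℕ} (hd : Even d) : 2 ^ d ≠ 2 * (m * m) := by
  intro h
  have hm : m ≠ 0 := by rintro rfl; simp at h
  have h1 := congrArg (padicValNat 2) h
  rw [padicValNat.prime_pow, padicValNat.mul two_ne_zero (mul_ne_zero hm hm),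
    padicValNat.mul hm hm, padicValNat_self] at h1
  obtain ⟨j, rfl⟩ := hd
  omega

theorem two_pow_ne_sq {d m : ℕ} (hd : Odd d) : 2 ^ d ≠ m * m := by
  intro h
  have hm : m ≠ 0 := by rintro rfl; simp at h
  have h1 := congrArg (padicValNat 2) h
  rw [padicValNat.prime_pow, padicValNat.mul hm hm] at h1
  obtain ⟨j, rfl⟩ := hd
  omega

/-- By Schur's lemma the count reads (1 + r) 2^d = 2m², with r equal to 0 or 1. For even d the
2-adic valuation excludes r = 0, so the module is isomorphic to its twist and its character is
parity invariant. -/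
theorem irreducibleRep_even (hF : F.PosDef) (hd : Even (Module.finrank ℝ V))
    (h : IsIrreducibleRep ρ) :
    Module.finrank ℂ M * Module.finrank ℂ M = 2 ^ Module.finrank ℝ V ∧
      ∀ x, LinearMap.trace ℂ M (ρ x) = cliffordTrace F x • (Module.finrank ℂ M : ℂ) := by
  have key := finrank_intertwiners_add ρ ρ hF
  rw [finrank_intertwiners_self h] at key
  have hle := finrank_intertwiners_le_one h h.involuteRep
  have hne : Module.finrank ℂ (intertwiners ρ (involuteRep ρ)) ≠ 0 := by
    intro h0
    rw [h0, add_zero, one_mul] at key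
    exact two_pow_ne_two_mul_sq hd key
  have h1 : Module.finrank ℂ (intertwiners ρ (involuteRep ρ)) = 1 := by omega
  rw [h1] at key
  refine ⟨by omega, trace_eq_of_involute_invariant ρ hF fun x => ?_⟩
  exact (trace_rep_eq_of_finrank_ne_zero h h.involuteRep hne x).symm

/-- In the same count an odd d excludes r = 1, since 2^d is not a square. -/
theorem irreducibleRep_odd (hF : F.PosDef) (hd : Odd (Module.finrank ℝ V))
    (h : IsIrreducibleRep ρ) :
    2 * (Module.finrank ℂ M * Module.finrank ℂ M) = 2 ^ Module.finrank ℝ V := by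
  have key := finrank_intertwiners_add ρ ρ hF
  rw [finrank_intertwiners_self h] at key
  have hle := finrank_intertwiners_le_one h h.involuteRep
  rcases Nat.le_one_iff_eq_zero_or_eq_one.mp hle with h0 | h0
  · rw [h0, add_zero, one_mul] at key
    exact key.symm
  · rw [h0] at key
    exact absurd (by omega) (two_pow_ne_sq (m := Module.finrank ℂ M) hd)

/-- The count leaves no room for both intertwiner spaces to vanish, so the second module is the
first one twisted by the main involution. -/
theorem irreducibleRep_pair_odd (hF : F.PosDef) (hd : Odd (Module.finrank ℝ V))
    (h : IsIrreducibleRep ρ) (h' : IsIrreducibleRep σ)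
    (hno : ¬ ∃ E : M ≃ₗ[ℂ] N, ∀ x m, E (ρ x m) = σ x (E m)) :
    Module.finrank ℂ M = Module.finrank ℂ N ∧
      ∀ x, LinearMap.trace ℂ M (ρ x) + LinearMap.trace ℂ N (σ x) =
        cliffordTrace F x • (2 * Module.finrank ℂ M : ℂ) := by
  have h1 := irreducibleRep_odd hF hd h
  have h2 := irreducibleRep_odd hF hd h'
  have heq : Module.finrank ℂ M = Module.finrank ℂ N :=
    Nat.mul_self_inj.mp (by omega)
  refine ⟨heq, fun x => ?_⟩
  have key := finrank_intertwiners_add σ ρ hF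
  have h0 : Module.finrank ℂ (intertwiners σ ρ) = 0 := by
    by_contra hne
    obtain ⟨E, hE⟩ := exists_equiv_of_finrank_ne_zero h' h hne
    exact hno ⟨E.symm, fun x m => E.injective (by rw [hE]; simp)⟩
  have hne : Module.finrank ℂ (intertwiners σ (involuteRep ρ)) ≠ 0 := by
    intro h3
    rw [h0, h3, ← heq, h1] at key
    simp only [add_zero, zero_mul] at key
    exact absurd key.symm (by positivity)
  rw [trace_rep_eq_of_finrank_ne_zero h' h.involuteRep hne]
  exact trace_add_involute ρ hF x

end CliffordReps

/-! ### The trace of the inverse of an operator of finite order. -/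

section TraceInverse

-- The Hermitian form H = Σ_k (A^k)* A^k is positive definite, because of the term k = 0, and
-- invariant under A. Hence A⁻¹ is conjugate to A*.
open scoped ComplexOrder in
theorem matrix_trace_eq_star_of_pow_eq_one {m : Type*} [Fintype m] [DecidableEq m]
    (A B : Matrix m m ℂ) {n : ℕ} (hn : 0 < n) (hA : A ^ n = 1) (hAB : A * B = 1) :
    B.trace = star A.trace := by
  set H : Matrix m m ℂ := ∑ k ∈ Finset.range n, (A ^ k).conjTranspose * A ^ k with hH
  have hpos : H.PosDef := by
    obtain ⟨n, rfl⟩ := Nat.exists_eq_succ_of_ne_zero hn.ne'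
    rw [hH, Finset.sum_range_succ']
    refine Matrix.PosDef.posSemidef_add ?_ ?_
    · exact Matrix.posSemidef_sum _ fun k _ => Matrix.posSemidef_conjTranspose_mul_self _
    · rw [pow_zero, Matrix.conjTranspose_one, mul_one]
      exact Matrix.PosDef.one
  have hinv : A.conjTranspose * H * A = H := by
    rw [hH, Finset.mul_sum, Finset.sum_mul]
    have h (k : ℕ) : A.conjTranspose * ((A ^ k).conjTranspose * A ^ k) * A =
        (A ^ (k + 1)).conjTranspose * A ^ (k + 1) := by
      rw [pow_succ, Matrix.conjTranspose_mul]
      simp only [mul_assoc]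
    simp only [h]
    have h1 := Finset.sum_range_succ (fun k => (A ^ k).conjTranspose * A ^ k) n
    have h2 := Finset.sum_range_succ' (fun k => (A ^ k).conjTranspose * A ^ k) n
    rw [h1, hA, pow_zero] at h2
    exact (add_right_cancel h2).symm
  have hdet := (Matrix.isUnit_iff_isUnit_det _).mp hpos.isUnit
  have h1 : A.conjTranspose * H = H * B := by
    rw [← congrArg (· * B) hinv]
    simp only [mul_assoc, hAB, mul_one]
  have h2 : B = H⁻¹ * (A.conjTranspose * H) := by
    rw [h1, ← mul_assoc, Matrix.nonsing_inv_mul _ hdet, one_mul]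
  rw [h2, Matrix.trace_mul_comm, mul_assoc, Matrix.mul_nonsing_inv _ hdet, mul_one,
    Matrix.trace_conjTranspose]

theorem trace_eq_star_of_pow_eq_one {M : Type*} [AddCommGroup M] [Module ℂ M] [Module.Finite ℂ M]
    (A B : Module.End ℂ M) {n : ℕ} (hn : 0 < n) (hA : A ^ n = 1) (hAB : A * B = 1) :
    LinearMap.trace ℂ M B = star (LinearMap.trace ℂ M A) := by
  let e := Module.finBasis ℂ M
  rw [LinearMap.trace_eq_matrix_trace ℂ e, LinearMap.trace_eq_matrix_trace ℂ e]
  refine matrix_trace_eq_star_of_pow_eq_one _ _ hn ?_ ?_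
  · rw [LinearMap.toMatrix_pow, hA, LinearMap.toMatrix_one]
  · rw [← LinearMap.toMatrix_mul, hAB, LinearMap.toMatrix_one]

end TraceInverse

/-! ### The spin module: its dimension and character. -/

section SpinModule

variable {ι V₀ N : Type u} [AddCommGroup V₀] [Module ℝ V₀] [AddCommGroup N] [Module ℝ N]
  {P : RootPairing ι ℝ V₀ N} [FiniteDimensional ℝ V₀] (Q : InvariantForm P)

/-- The representation of the real Clifford algebra on a module over its complexification. -/
noncomputable def cliffRep (S : Type*) [AddCommGroup S] [Module ℂ S]
    [Module (ℂ ⊗[ℝ] Cliff Q) S] [IsScalarTower ℂ (ℂ ⊗[ℝ] Cliff Q) S] :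
    Cliff Q →ₐ[ℝ] Module.End ℂ S :=
  ((Algebra.lsmul ℂ ℂ S : ℂ ⊗[ℝ] Cliff Q →ₐ[ℂ] Module.End ℂ S).restrictScalars ℝ).comp
    Algebra.TensorProduct.includeRight

section

variable {S T : Type*} [AddCommGroup S] [Module ℂ S]
    [Module (ℂ ⊗[ℝ] Cliff Q) S] [IsScalarTower ℂ (ℂ ⊗[ℝ] Cliff Q) S] [AddCommGroup T] [Module ℂ T]
    [Module (ℂ ⊗[ℝ] Cliff Q) T] [IsScalarTower ℂ (ℂ ⊗[ℝ] Cliff Q) T]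

theorem cliffRep_apply (x : Cliff Q) (s : S) :
    cliffRep Q S x s = ((1 : ℂ) ⊗ₜ[ℝ] x : ℂ ⊗[ℝ] Cliff Q) • s := rfl

theorem tmul_smul_eq (c : ℂ) (x : Cliff Q) (s : S) :
    (c ⊗ₜ[ℝ] x : ℂ ⊗[ℝ] Cliff Q) • s = c • cliffRep Q S x s := by
  rw [cliffRep_apply, ← smul_assoc, TensorProduct.smul_tmul', smul_eq_mul, mul_one]

theorem isIrreducibleRep_cliffRep (h : IsSimpleModule (ℂ ⊗[ℝ] Cliff Q) S) :
    IsIrreducibleRep (cliffRep Q S) := by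
  refine ⟨IsSimpleModule.nontrivial (ℂ ⊗[ℝ] Cliff Q) S, fun p hp => ?_⟩
  let p' : Submodule (ℂ ⊗[ℝ] Cliff Q) S :=
    { p.toAddSubmonoid with
      smul_mem' := fun a s hs => by
        induction a with
        | zero =>
          rw [← TensorProduct.zero_tmul ℂ (0 : Cliff Q), tmul_smul_eq, zero_smul]
          exact p.zero_mem
        | add a a' h h' => rw [add_smul]; exact p.add_mem h h'
        | tmul c x => rw [tmul_smul_eq]; exact p.smul_mem c (hp x s hs) }
  rcases eq_bot_or_eq_top p' with h' | h'
  · left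
    refine (Submodule.eq_bot_iff p).mpr fun s hs => ?_
    have : s ∈ p' := hs
    rwa [h', Submodule.mem_bot] at this
  · right
    refine Submodule.eq_top_iff'.mpr fun s => ?_
    have : s ∈ p' := h' ▸ Submodule.mem_top
    exact this

theorem nonempty_equiv_of_cliffRep (E : S ≃ₗ[ℂ] T)
    (hE : ∀ x s, E (cliffRep Q S x s) = cliffRep Q T x (E s)) :
    Nonempty (S ≃ₗ[ℂ ⊗[ℝ] Cliff Q] T) := by
  refine ⟨{ E.toAddEquiv with map_smul' := fun a s => ?_ }⟩
  change E (a • s) = a • E s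
  induction a with
  | zero =>
    rw [← TensorProduct.zero_tmul ℂ (0 : Cliff Q), tmul_smul_eq, tmul_smul_eq, zero_smul,
      zero_smul, map_zero]
  | add a a' h h' => rw [add_smul, add_smul, map_add, h, h']
  | tmul c x => rw [tmul_smul_eq, tmul_smul_eq, map_smul, hE]

end

/-- For even d a single irreducible module already has a parity invariant character. For odd d the
two irreducible characters are exchanged by the main involution and only their sum is a multiple of
the normalised trace; this is why S is the sum of both, and where n = 2 comes from. -/
theorem spinModule_trace (S : Type u) [AddCommGroup S] [Module ℂ S] [Module.Finite ℂ S]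
    [Module (ℂ ⊗[ℝ] Cliff Q) S] [IsScalarTower ℂ (ℂ ⊗[ℝ] Cliff Q) S] (hS : IsSpinModule Q S) :
    Module.finrank ℂ S * Module.finrank ℂ S =
        (if Even (Module.finrank ℝ V₀) then 1 else 2) * 2 ^ Module.finrank ℝ V₀ ∧
      ∀ x, LinearMap.trace ℂ S (cliffRep Q S x) =
        cliffordTrace Q.form x • (Module.finrank ℂ S : ℂ) := by
  by_cases hd : Even (Module.finrank ℝ V₀)
  · rw [if_pos hd, one_mul]
    exact irreducibleRep_even Q.posDef hd (isIrreducibleRep_cliffRep Q (hS.1 hd))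
  · rw [if_neg hd]
    have hd' := Nat.not_even_iff_odd.mp hd
    obtain ⟨S₁, S₂, hc, h1, h2, hno⟩ := hS.2 hd'
    have : Module.Finite ℂ S₁ := Module.Finite.of_injective (S₁.subtype.restrictScalars ℂ)
      S₁.injective_subtype
    have : Module.Finite ℂ S₂ := Module.Finite.of_injective (S₂.subtype.restrictScalars ℂ)
      S₂.injective_subtype
    have i1 := isIrreducibleRep_cliffRep Q h1
    have i2 := isIrreducibleRep_cliffRep Q h2
    obtain ⟨heq, htr⟩ := irreducibleRep_pair_odd Q.posDef hd' i1 i2 fun ⟨E, hE⟩ =>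
      (nonempty_equiv_of_cliffRep Q E hE).elim hno.false
    let E : (S₁ × S₂) ≃ₗ[ℂ] S := (Submodule.prodEquivOfIsCompl S₁ S₂ hc).restrictScalars ℂ
    have hE (x : Cliff Q) (p) : E ((cliffRep Q S₁ x).prodMap (cliffRep Q S₂ x) p) =
        cliffRep Q S x (E p) :=
      (map_smul (Submodule.prodEquivOfIsCompl S₁ S₂ hc)
        ((1 : ℂ) ⊗ₜ[ℝ] x : ℂ ⊗[ℝ] Cliff Q) p)
    have : Module.Free ℂ S₁ := Module.Free.of_divisionRing ℂ S₁
    have : Module.Free ℂ S₂ := Module.Free.of_divisionRing ℂ S₂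
    have hdim : Module.finrank ℂ S = 2 * Module.finrank ℂ S₁ := by
      rw [← E.finrank_eq, Module.finrank_prod, ← heq, two_mul]
    constructor
    · rw [hdim, ← irreducibleRep_odd Q.posDef hd' i1]
      ring
    · intro x
      rw [← trace_eq_of_equiv (U := S₁ × S₂) (V := S) E
        ((cliffRep Q S₁ x).prodMap (cliffRep Q S₂ x)) _ (hE x), LinearMap.trace_prodMap', htr, hdim]
      push_cast
      rfl

end SpinModule

/-! ### The character of the Dirac index and the comparison with the pairing. -/

section DiracIndex

variable {ι V₀ N : Type u} [AddCommGroup V₀] [Module ℝ V₀] [AddCommGroup N] [Module ℝ N]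
  {P : RootPairing ι ℝ V₀ N} {b : P.Base} [Finite ι] [P.IsCrystallographic] [P.IsReduced]
  {k : Parameter b}

theorem twLongest_twLongest (X : TwistedModule k) (x : X.carrier) :
    X.twLongest (X.twLongest x) = x := by
  have h2 : X.tw (X.weylRep (longest b) x) = X.weylRep (longest b) (X.tw x) := by
    rw [X.weylRep_apply, X.tw_smul, theta_t, mul_inv_cancel_right]
    rfl
  simp only [TwistedModule.twLongest, LinearMap.comp_apply]
  rw [h2, ← Module.End.mul_apply (X.weylRep _), ← map_mul, longest_mul_self, map_one]
  exact X.tw_tw x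

/-- The operator θ t_{w₀} is an involution commuting with W, so its product with t_w has finite
order. -/
theorem twChar_inv (X : TwistedModule k) (w : P.weylGroup) :
    twChar X w⁻¹ = star (twChar X w) := by
  have := finite_weylGroup b
  have hcomm : Commute X.twLongest (X.weylRep w) :=
    LinearMap.ext fun x => X.twLongest_weylRep w x
  have hsq : X.twLongest * X.twLongest = 1 := LinearMap.ext fun x => twLongest_twLongest X x
  refine trace_eq_star_of_pow_eq_one (X.twLongest * X.weylRep w) (X.twLongest * X.weylRep w⁻¹)
    (n := 2 * Nat.card P.weylGroup) (Nat.mul_pos two_pos Nat.card_pos) ?_ ?_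
  · rw [hcomm.mul_pow, pow_mul, pow_two, hsq, one_pow, one_mul, ← map_pow, mul_comm, pow_mul,
      pow_card_eq_one', one_pow, map_one]
  · rw [hcomm.eq, mul_assoc, ← mul_assoc X.twLongest, hsq, one_mul, ← map_mul, mul_inv_cancel,
      map_one]

theorem trace_eigenRep (X : TwistedModule k) (c : ℂ) (hc : c * c = 1) (w : P.weylGroup) :
    LinearMap.trace ℂ (X.eigenRep c).toSubmodule ((X.eigenRep c).toRepresentation w) =
      2⁻¹ * (LinearMap.trace ℂ _ (X.weylRep w) + c * twChar X w) := by
  -- The projection onto the eigenspace of an involution for the eigenvalue c = ±1.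
  let p : Module.End ℂ X.carrier := (2⁻¹ : ℂ) • (LinearMap.id + c • X.twLongest)
  have hp : LinearMap.IsProj (X.eigenRep c).toSubmodule p := by
    constructor
    · intro x
      refine Module.End.mem_eigenspace_iff.mpr ?_
      simp only [p, LinearMap.smul_apply, LinearMap.add_apply, LinearMap.id_apply, map_smul,
        map_add, twLongest_twLongest]
      rw [smul_comm c, smul_add c, smul_smul c c, hc, one_smul, add_comm]
    · intro x hx
      have hx' : X.twLongest x = c • x := Module.End.mem_eigenspace_iff.mp hx
      simp only [p, LinearMap.smul_apply, LinearMap.add_apply, LinearMap.id_apply, hx']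
      rw [smul_smul c c, hc, one_smul, ← two_smul ℂ x, smul_smul]
      norm_num
  refine (trace_restrict_of_isProj _ p hp (X.weylRep w)
    fun x hx => (X.eigenRep c).apply_mem_toSubmodule w hx).trans ?_
  have h : X.weylRep w ∘ₗ p = (2⁻¹ : ℂ) • (X.weylRep w + c • (X.twLongest ∘ₗ X.weylRep w)) := by
    refine LinearMap.ext fun x => ?_
    simp only [p, LinearMap.comp_apply, LinearMap.smul_apply, LinearMap.add_apply,
      LinearMap.id_apply, map_smul, map_add, X.twLongest_weylRep]
  rw [h, map_smul, map_add, map_smul]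
  rfl

variable [FiniteDimensional ℝ V₀] (Q : InvariantForm P) (S : Type u) [AddCommGroup S] [Module ℂ S]
  [Module.Finite ℂ S] [Module (ℂ ⊗[ℝ] Cliff Q) S] [IsScalarTower ℂ (ℂ ⊗[ℝ] Cliff Q) S]

theorem character_diracIndex (X : TwistedModule k) (g : spinCover Q) :
    (diracIndex Q S X).character g = twChar X (spinCover.proj Q g) *
      LinearMap.trace ℂ S (cliffRep Q S (g.1.2 : Cliff Q)) := by
  have h (c : ℂ) (hc : c * c = 1) : LinearMap.trace ℂ (eigenTensorSpin Q S X c)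
      ((eigenTensorSpin Q S X c).ρ g) =
      2⁻¹ * (LinearMap.trace ℂ _ (X.weylRep (spinCover.proj Q g)) +
        c * twChar X (spinCover.proj Q g)) *
          LinearMap.trace ℂ S (cliffRep Q S (g.1.2 : Cliff Q)) := by
    rw [← trace_eigenRep X c hc]
    exact LinearMap.trace_tensorProduct' _ _
  rw [VirtualRep.character]
  refine (congrArg₂ (· - ·) (h 1 (by norm_num)) (h (-1) (by norm_num))).trans ?_
  ring

theorem twistedEP_eq_star [Fintype P.weylGroup] (X Y : TwistedModule k) :
    twistedEP X Y = (Fintype.card P.weylGroup : ℂ)⁻¹ *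
      ∑ w : P.weylGroup, twChar X w * star (twChar Y w) * (extTrace w : ℂ) := by
  simp only [twistedEP_eq, twChar_inv]

/-- The squared modulus of the character of S at g is (dim S)² τ(g)² = n 2^d τ(g)², which is n times
the exterior trace of the image of g in W. The summand therefore factors through W. -/
theorem mul_twistedEP_eq_inner (hS : IsSpinModule Q S) (X Y : TwistedModule k) :
    (if Even (Module.finrank ℝ V₀) then 1 else 2 : ℂ) * twistedEP X Y =
      (diracIndex Q S X).inner (diracIndex Q S Y) := by
  have := finite_weylGroup b
  have := Fintype.ofFinite P.weylGroup
  have := finite_spinCover Q b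
  obtain ⟨hdim, htr⟩ := spinModule_trace Q S hS
  set n : ℂ := if Even (Module.finrank ℝ V₀) then 1 else 2 with hn
  have hdim' : (Module.finrank ℂ S : ℂ) * Module.finrank ℂ S = n * 2 ^ Module.finrank ℝ V₀ := by
    have := congrArg (Nat.cast : ℕ → ℂ) hdim
    rw [hn]
    push_cast at this
    exact this
  rw [VirtualRep.inner, twistedEP_eq_star]
  let φ (w : P.weylGroup) : ℂ := n * (twChar X w * star (twChar Y w) * (extTrace w : ℂ))
  have key (g : spinCover Q) : (diracIndex Q S X).character g *
      star ((diracIndex Q S Y).character g) = φ (spinCover.proj Q g) := by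
    dsimp only [φ]
    rw [character_diracIndex, character_diracIndex, htr, extTrace_proj, finrank_clifford]
    rw [Complex.real_smul, star_mul', star_mul', Complex.star_def,
      Complex.conj_ofReal, Complex.conj_natCast]
    push_cast
    linear_combination (twChar X (spinCover.proj Q g) * (starRingEnd ℂ)
      (twChar Y (spinCover.proj Q g)) * (cliffordTrace Q.form (g.1.2 : Cliff Q) : ℂ) ^ 2) * hdim'
  rw [finsum_congr key]
  refine Eq.trans ?_ (average_comp_surjective (spinCover.proj Q)
    (spinCover_proj_surjective Q b) φ).symm
  rw [← Finset.mul_sum]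
  ring

end DiracIndex

/-! ### Positivity of the form weighted by exterior traces. -/

section Positivity

variable {ι V₀ N : Type u} [AddCommGroup V₀] [Module ℝ V₀] [AddCommGroup N] [Module ℝ N]
  {P : RootPairing ι ℝ V₀ N} {b : P.Base} [Finite ι] [P.IsCrystallographic] [P.IsReduced]
  [FiniteDimensional ℝ V₀]

/-- Average a sum of squares of coordinates over W. An auxiliary form is needed because positivity
is asserted without a chosen inner product. -/
theorem nonempty_invariantForm (b : P.Base) : Nonempty (InvariantForm P) := by
  have := finite_weylGroup b
  have := Fintype.ofFinite P.weylGroup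
  let e := Module.finBasis ℝ V₀
  let F : QuadraticForm ℝ V₀ := ∑ w : P.weylGroup, ∑ a,
    (QuadraticMap.sq (R := ℝ)).comp (e.coord a ∘ₗ P.weylGroupRootRep w)
  have hF (v : V₀) : F v = ∑ w : P.weylGroup, ∑ a, e.coord a (w • v) * e.coord a (w • v) := by
    simp only [F, sum_apply]
    rfl
  refine ⟨⟨F, fun v hv => ?_, fun w v => ?_⟩⟩
  · rw [hF]
    have h0 (w : P.weylGroup) : 0 ≤ ∑ a, e.coord a (w • v) * e.coord a (w • v) :=
      Finset.sum_nonneg fun a _ => mul_self_nonneg _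
    refine Finset.sum_pos' (fun w _ => h0 w) ⟨1, Finset.mem_univ _, ?_⟩
    rw [one_smul]
    obtain ⟨a, ha⟩ : ∃ a, e.coord a v ≠ 0 := by
      by_contra! h
      exact hv ((e.forall_coord_eq_zero_iff).mp h)
    exact Finset.sum_pos' (fun a _ => mul_self_nonneg _)
      ⟨a, Finset.mem_univ _, mul_self_pos.mpr ha⟩
  · rw [hF, hF]
    simp only [smul_smul]
    exact Equiv.sum_comp (Equiv.mulRight w) fun u : P.weylGroup =>
      ∑ a, e.coord a (u • v) * e.coord a (u • v)

/-- A lift to the spin cover exhibits the trace as a positive multiple of a square. -/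
theorem extTrace_nonneg (b : P.Base) (w : P.weylGroup) : 0 ≤ extTrace w := by
  obtain ⟨Q⟩ := nonempty_invariantForm b
  obtain ⟨g, rfl⟩ := spinCover_proj_surjective Q b w
  rw [extTrace_proj]
  positivity

/-- The sesquilinear form on a space of class functions, weighted by the traces on the exterior
algebra. -/
noncomputable def extForm [Fintype P.weylGroup] {U : Type*} [AddCommGroup U] [Module ℂ U]
    (Ψ : U →ₗ[ℂ] (P.weylGroup → ℂ)) : U →ₗ[ℂ] U →ₗ⋆[ℂ] ℂ :=
  LinearMap.mk₂'ₛₗ (RingHom.id ℂ) (starRingEnd ℂ)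
    (fun x y => (Fintype.card P.weylGroup : ℂ)⁻¹ *
      ∑ w : P.weylGroup, Ψ x w * star (Ψ y w) * (extTrace w : ℂ))
    (fun x x' y => by
      simp only [map_add, Pi.add_apply, add_mul, Finset.sum_add_distrib, mul_add])
    (fun c x y => by
      simp only [map_smul, Pi.smul_apply, smul_eq_mul, RingHom.id_apply, Finset.mul_sum]
      exact Finset.sum_congr rfl fun w _ => by ring)
    (fun x y y' => by
      simp only [map_add, Pi.add_apply, star_add, mul_add, add_mul, Finset.sum_add_distrib])
    (fun c x y => by
      simp only [map_smul, Pi.smul_apply, smul_eq_mul, star_mul', Finset.mul_sum,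
        Complex.star_def]
      exact Finset.sum_congr rfl fun w _ => by ring)

variable [Fintype P.weylGroup] {U : Type*} [AddCommGroup U] [Module ℂ U]
  (Ψ : U →ₗ[ℂ] (P.weylGroup → ℂ))

theorem extForm_apply (x y : U) : extForm Ψ x y = (Fintype.card P.weylGroup : ℂ)⁻¹ *
      ∑ w : P.weylGroup, Ψ x w * star (Ψ y w) * (extTrace w : ℂ) := rfl

theorem extForm_swap (x y : U) : extForm Ψ y x = star (extForm Ψ x y) := by
  rw [extForm_apply, extForm_apply, star_mul', star_inv₀, star_sum, star_natCast]
  congr 1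
  refine Finset.sum_congr rfl fun w _ => ?_
  rw [star_mul', star_mul', star_star, Complex.star_def, Complex.conj_ofReal]
  ring

theorem extForm_self (x : U) : extForm Ψ x x = (((Fintype.card P.weylGroup : ℝ)⁻¹ *
      ∑ w : P.weylGroup, Complex.normSq (Ψ x w) * extTrace w : ℝ) : ℂ) := by
  rw [extForm_apply]
  push_cast
  congr 1
  refine Finset.sum_congr rfl fun w _ => ?_
  rw [Complex.star_def, Complex.mul_conj]

theorem extForm_self_nonneg (b : P.Base) (x : U) : 0 ≤ (extForm Ψ x x).re := by
  rw [extForm_self, Complex.ofReal_re]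
  exact mul_nonneg (by positivity) (Finset.sum_nonneg fun w _ =>
    mul_nonneg (Complex.normSq_nonneg _) (extTrace_nonneg b w))

/-- A vanishing sum of nonnegative terms vanishes termwise: for each w the character of x or the
weight is zero, and this kills every pairing with x. -/
theorem extForm_eq_zero (b : P.Base) (x : U) (h : (extForm Ψ x x).re ≤ 0) : extForm Ψ x = 0 := by
  rw [extForm_self, Complex.ofReal_re] at h
  have hterm (w : P.weylGroup) : 0 ≤ Complex.normSq (Ψ x w) * extTrace w :=
    mul_nonneg (Complex.normSq_nonneg _) (extTrace_nonneg b w)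
  have hsum : ∑ w : P.weylGroup, Complex.normSq (Ψ x w) * extTrace w = 0 := by
    refine le_antisymm (nonpos_of_mul_nonpos_right h (by positivity))
      (Finset.sum_nonneg fun w _ => hterm w)
  rw [Finset.sum_eq_zero_iff_of_nonneg fun w _ => hterm w] at hsum
  refine LinearMap.ext fun y => ?_
  rw [extForm_apply, LinearMap.zero_apply, Finset.sum_eq_zero, mul_zero]
  intro w hw
  rcases mul_eq_zero.mp (hsum w hw) with h0 | h0
  · rw [Complex.normSq_eq_zero.mp h0, zero_mul, zero_mul]
  · rw [h0, Complex.ofReal_zero, mul_zero]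

end Positivity

/-! ### Descent to the Grothendieck group, to K^θ and to the elliptic space. -/

section Grothendieck

variable {ι V₀ N : Type u} [AddCommGroup V₀] [Module ℝ V₀] [AddCommGroup N] [Module ℝ N]
  {P : RootPairing ι ℝ V₀ N} {b : P.Base} [Finite ι] [P.IsCrystallographic] [P.IsReduced]
  {k : Parameter b}

theorem twChar_of_isExtension {X Y Z : TwistedModule k} (h : X.IsExtension Y Z) (w : P.weylGroup) :
    twChar Y w = twChar X w + twChar Z w := by
  obtain ⟨f, g, hf, hg, hinj, hex, hsurj⟩ := h
  refine trace_add_of_exact (f.restrictScalars ℂ) (g.restrictScalars ℂ) hinj hsurj hex _ _ _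
    (fun x => ?_) (fun y => ?_)
  · change f (X.tw (Hecke.t k _ • Hecke.t k w • x)) = Y.tw (Hecke.t k _ • Hecke.t k w • f x)
    rw [hf, map_smul f, map_smul f]
  · change g (Y.tw (Hecke.t k _ • Hecke.t k w • y)) = Z.tw (Hecke.t k _ • Hecke.t k w • g y)
    rw [hg, map_smul g, map_smul g]

theorem twChar_bar (X : TwistedModule k) (w : P.weylGroup) : twChar X.bar w = -twChar X w := by
  rw [twChar, twChar, ← map_neg]
  rfl

/-- For a proper nonzero ℍ-submodule U, both U ∩ θU and U + θU are stable under θ, so X = U ⊕ θU.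
The Weyl group preserves both summands and θ exchanges them, so the diagonal blocks of θ t_{w₀} t_w
are zero. -/
theorem twChar_eq_zero_of_not_isSimpleModule (X : TwistedModule k) (hX : X.IsIrreducible)
    (hs : ¬ IsSimpleModule (Hecke k) X.carrier) (w : P.weylGroup) : twChar X w = 0 := by
  have := hX.1
  obtain ⟨U, hbot, htop⟩ : ∃ U : Submodule (Hecke k) X.carrier, U ≠ ⊥ ∧ U ≠ ⊤ := by
    by_contra! h
    exact hs { eq_bot_or_eq_top := fun U => or_iff_not_imp_left.mpr (h U) }
  let U' : Submodule (Hecke k) X.carrier :=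
    { carrier := {x | X.tw x ∈ U}
      zero_mem' := by
        change X.tw 0 ∈ U
        rw [map_zero]
        exact U.zero_mem
      add_mem' := fun {x y} hx hy => by
        change X.tw (x + y) ∈ U
        rw [map_add]
        exact U.add_mem hx hy
      smul_mem' := fun a x hx => by
        change X.tw (a • x) ∈ U
        rw [X.tw_smul]
        exact U.smul_mem _ hx }
  have hU' (x) : x ∈ U' ↔ X.tw x ∈ U := Iff.rfl
  have hinf : U ⊓ U' = ⊥ := by
    refine (hX.2 (U ⊓ U') fun x hx => ?_).resolve_right fun h => htop (top_le_iff.mp ?_)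
    · refine ⟨hx.2, ?_⟩
      rw [SetLike.mem_coe, hU', X.tw_tw]
      exact hx.1
    · exact h ▸ inf_le_left
  have hsup : U ⊔ U' = ⊤ := by
    refine (hX.2 (U ⊔ U') fun x hx => ?_).resolve_left fun h => hbot (le_bot_iff.mp ?_)
    · obtain ⟨y, hy, z, hz, rfl⟩ := Submodule.mem_sup.mp hx
      rw [map_add, add_comm]
      refine Submodule.add_mem_sup hz ?_
      rw [hU', X.tw_tw]
      exact hy
    · exact h ▸ le_sup_left
  have hcompl : IsCompl (U.restrictScalars ℂ) (U'.restrictScalars ℂ) := by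
    rw [isCompl_iff, Submodule.disjoint_def, codisjoint_iff, Submodule.eq_top_iff']
    constructor
    · intro x hx hx'
      have : x ∈ U ⊓ U' := ⟨hx, hx'⟩
      rwa [hinf, Submodule.mem_bot] at this
    · intro x
      obtain ⟨y, hy, z, hz, rfl⟩ := Submodule.mem_sup.mp (hsup ▸ Submodule.mem_top : x ∈ U ⊔ U')
      exact Submodule.add_mem_sup (S := U.restrictScalars ℂ) (T := U'.restrictScalars ℂ) hy hz
  let A : Bool → Submodule ℂ X.carrier := fun i =>
    if i then U.restrictScalars ℂ else U'.restrictScalars ℂ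
  have hA : DirectSum.IsInternal A := by
    refine (DirectSum.isInternal_submodule_iff_isCompl A (i := true) (j := false) (by decide) ?_).mpr
      hcompl
    ext i
    cases i <;> simp
  refine LinearMap.trace_eq_zero_of_mapsTo_ne hA (fun i => !i) (fun i => by cases i <;> decide) ?_
  intro i x hx
  cases i with
  | false =>
    change X.tw (Hecke.t k _ • Hecke.t k w • x) ∈ U
    exact U'.smul_mem _ (U'.smul_mem _ hx)
  | true =>
    change X.tw (X.tw (Hecke.t k _ • Hecke.t k w • x)) ∈ U
    rw [X.tw_tw]
    exact U.smul_mem _ (U.smul_mem _ hx)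

/-- The twisted character on the complexified Grothendieck group. -/
noncomputable def grothendieckChar (k : Parameter b) :
    GrothendieckSpace k →ₗ[ℂ] (P.weylGroup → ℂ) :=
  Submodule.liftQ _ (Finsupp.linearCombination ℂ fun X : TwistedModule k => twChar X) (by
    rw [Submodule.span_le]
    rintro _ ⟨X, Y, Z, h, rfl⟩
    rw [SetLike.mem_coe, LinearMap.mem_ker]
    ext w
    simp [twChar_of_isExtension h])

theorem grothendieckChar_cls (X : TwistedModule k) : grothendieckChar k X.cls = twChar X := by
  refine (Submodule.liftQ_apply _ _ _).trans ?_
  simp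

/-- The twisted character on `K^θ`. -/
noncomputable def kThetaChar (k : Parameter b) : KTheta k →ₗ[ℂ] (P.weylGroup → ℂ) :=
  Submodule.liftQ _ (grothendieckChar k) (by
    rw [sup_le_iff, K1, K2, Submodule.span_le, Submodule.span_le]
    constructor
    · rintro _ ⟨X, hX, hs, rfl⟩
      rw [SetLike.mem_coe, LinearMap.mem_ker, grothendieckChar_cls]
      exact funext fun w => twChar_eq_zero_of_not_isSimpleModule X hX hs w
    · rintro _ ⟨X, -, -, rfl⟩
      rw [SetLike.mem_coe, LinearMap.mem_ker, map_add, grothendieckChar_cls, grothendieckChar_cls]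
      exact funext fun w => by
        rw [Pi.add_apply, twChar_bar, add_neg_cancel, Pi.zero_apply])

/-- A Hermitian form induces a form on the quotient by its radical. -/
noncomputable def radicalForm {U : Type*} [AddCommGroup U] [Module ℂ U]
    (E : U →ₗ[ℂ] U →ₗ⋆[ℂ] ℂ) (hE : ∀ x y, E y x = star (E x y)) :
    (U ⧸ LinearMap.ker E) →ₗ[ℂ] (U ⧸ LinearMap.ker E) →ₗ⋆[ℂ] ℂ :=
  -- Hermitian symmetry makes the radical in the first variable a radical in the second as well.
  have h (x : U) : LinearMap.ker E ≤ LinearMap.ker (E x) := fun y hy => by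
    rw [LinearMap.mem_ker, hE, LinearMap.mem_ker.mp hy, LinearMap.zero_apply, star_zero]
  Submodule.liftQ _
    { toFun := fun x => Submodule.liftQ _ (E x) (h x)
      map_add' := fun x x' => by
        refine LinearMap.ext fun y => ?_
        obtain ⟨y, rfl⟩ := Submodule.Quotient.mk_surjective _ y
        exact LinearMap.congr_fun (map_add E x x') y
      map_smul' := fun c x => by
        refine LinearMap.ext fun y => ?_
        obtain ⟨y, rfl⟩ := Submodule.Quotient.mk_surjective _ y
        exact LinearMap.congr_fun (map_smul E c x) y } fun x hx => by
      rw [LinearMap.mem_ker]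
      refine LinearMap.ext fun y => ?_
      obtain ⟨y, rfl⟩ := Submodule.Quotient.mk_surjective _ y
      exact LinearMap.congr_fun (LinearMap.mem_ker.mp hx) y

end Grothendieck

end GradedHecke

theorem mainTheorem7 {ι V₀ N : Type u} [Finite ι] [AddCommGroup V₀] [Module ℝ V₀]
    [FiniteDimensional ℝ V₀] [AddCommGroup N] [Module ℝ N]
    (P : RootPairing ι ℝ V₀ N) [P.IsCrystallographic] [P.IsReduced] (b : P.Base)
    (k : Parameter b) :
    -- the pairing is a finite alternating sum of traces on finite-dimensional spaces
    (∀ X₁ X₂ : TwistedModule k,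
      (∀ n : ℕ, Module.Finite ℂ (HeckeExt X₁ X₂ n)) ∧
      (∀ n : ℕ, Module.finrank ℝ V₀ < n → Subsingleton (HeckeExt X₁ X₂ n))) ∧
    -- the comparison with the inner product of Dirac indices
    (∀ (Q : InvariantForm P) (S : Type u) [AddCommGroup S] [Module ℂ S] [Module.Finite ℂ S]
        [Module (ℂ ⊗[ℝ] Cliff Q) S] [IsScalarTower ℂ (ℂ ⊗[ℝ] Cliff Q) S],
      IsSpinModule Q S → ∀ X₁ X₂ : TwistedModule k,
        (if Even (Module.finrank ℝ V₀) then 1 else 2 : ℂ) * twistedEP X₁ X₂ =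
          (diracIndex Q S X₁).inner (diracIndex Q S X₂)) ∧
    -- the form on the Grothendieck group, the form on `K^θ` and the form on the elliptic space
    ∃ (E : GrothendieckSpace k →ₗ[ℂ] GrothendieckSpace k →ₗ⋆[ℂ] ℂ)
      (Eθ : KTheta k →ₗ[ℂ] KTheta k →ₗ⋆[ℂ] ℂ)
      (B : EllTheta Eθ →ₗ[ℂ] EllTheta Eθ →ₗ⋆[ℂ] ℂ),
      (∀ X₁ X₂ : TwistedModule k, E X₁.cls X₂.cls = twistedEP X₁ X₂) ∧
      (∀ x y, E y x = star (E x y)) ∧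
      (∀ x, 0 ≤ (E x x).re) ∧
      (∀ x y, Eθ (Submodule.Quotient.mk x) (Submodule.Quotient.mk y) = E x y) ∧
      (∀ x y, B (Submodule.Quotient.mk x) (Submodule.Quotient.mk y) = Eθ x y) ∧
      (∀ x y, B y x = star (B x y)) ∧
      (∀ x, x ≠ 0 → 0 < (B x x).re) := by
  have := finite_weylGroup b
  have := Fintype.ofFinite P.weylGroup
  -- Both forms are pullbacks of one weighted form on functions on W along twisted characters, so
  -- their compatibilities hold by definition.
  refine ⟨fun X₁ X₂ => ⟨finite_heckeExt X₁ X₂, subsingleton_heckeExt X₁ X₂⟩,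
    fun Q S _ _ _ _ _ hS X₁ X₂ => mul_twistedEP_eq_inner Q S hS X₁ X₂,
    extForm (grothendieckChar k), extForm (kThetaChar k),
    radicalForm (extForm (kThetaChar k)) (extForm_swap _), fun X₁ X₂ => ?_, extForm_swap _,
    extForm_self_nonneg _ b, fun x y => rfl, fun x y => rfl, fun x y => ?_, fun x hx => ?_⟩
  · rw [extForm_apply, grothendieckChar_cls, grothendieckChar_cls, twistedEP_eq_star]
  · obtain ⟨x, rfl⟩ := Submodule.Quotient.mk_surjective _ x
    obtain ⟨y, rfl⟩ := Submodule.Quotient.mk_surjective _ y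
    exact extForm_swap (kThetaChar k) x y
  · obtain ⟨x, rfl⟩ := Submodule.Quotient.mk_surjective _ x
    by_contra h
    exact hx ((Submodule.Quotient.mk_eq_zero _).mpr
      (extForm_eq_zero (kThetaChar k) b x (not_lt.mp h)))
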